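/- Let $\kappa\ge 2$ (so $n=\kappa+2\ge 4$), let $0\le K<N$, let $U\subseteq\mathbb R^N$ be a nonempty open set, and let observables on an open set be the smooth real functions on it. Let $\mathbb J$ be a smooth Poisson matrix on $U$ (an antisymmetric matrix-valued function such that $\{A,B\}=\sum_{i,j} J_{ij}\,\partial_iA\,\partial_jB$ satisfies the Jacobi identity) of constant rank $N-K$, i.e. with $K$ independent local Casimir invariants. A Nambu tensor of order $m$ is a smooth, totally antisymmetric tensor $\lambda_{i_1\cdots i_m}$ whose bracket $\{A_1,\dots,A_m\}=\sum\lambda_{i_1\cdots i_m}\,\partial_{i_1}A_1\cdots\partial_{i_m}A_m$ satisfies, for all observables, the fundamental identity $$\{\{A_1,\dots,A_m\},E_1,\dots,E_{m-1}\}=\sum_{k=1}^m\{A_1,\dots,A_{k-1},\{A_k,E_1,\dots,E_{m-1}\},A_{k+1},\dots,A_m\}.$$ Under a change of variables $x=h(z)$, $\lambda$ and $\mathbb J$ become $\widetilde\lambda_{i_1\cdots i_m}=\{h_{i_1},\dots,h_{i_m}\}\circ h^{-1}$ and $\widetilde J_{ij}=\{h_i,h_j\}\circ h^{-1}$. The canonical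 Poisson matrix has entries $\widetilde J_{12}=1$, $\widetilde J_{21}=-1$ and all others zero. The canonical (Levi-Civita) tensor of order $n$ is $\epsilon_{i_1\cdots i_n}$ if $i_1,\dots,i_n\in\{1,\dots,n\}$, and $0$ otherwise. (A) Suppose that the Poisson bracket is derived from an $n$-linear Nambu bracket: there are a Nambu tensor $\lambda$ of order $n=\kappa+2$ and observables $C_1,\dots,C_\kappa$ on $U$ with $\{A,B\}=\{A,B,C_1,\dots,C_\kappa\}$ for all observables $A,B$. Then: 1. $\{A,B,E\}:=\{A,B,E,C_2,\dots,C_\kappa\}$ is the bracket of a Nambu tensor of order 3, and $\{A,B\}=\{A,B,C_1\}$; so the Poisson bracket is also derived from a tri-linear Nambu bracket. 2. $N=K+2$ and $\kappa\le K$. 3. Call a smooth local change of variables $x=h(z)$ (with smooth inverse), defined on an open subset of $U$, canonical if $x_3,\dots,x_N$ are Casimir invariants of $\{\cdot,\cdot\}$, $x_{k+2}=C_k$ for $k=1,\dots,\kappa$, and $\widetilde{\mathbb J}$ is the canonical Poisson matrix. Around each point of $U$ there are canonical coordinates in which $\widetilde\lambda$ is the Levi-Civita tensor of order $\kappa+2$.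 Moreover, in all canonical coordinates $\widetilde\lambda_{i_1\cdots i_{\kappa+2}}=\epsilon_{i_1\cdots i_{\kappa+2}}$ for all $i_1,\dots,i_{\kappa+2}\in\{1,\dots,\kappa+2\}$ (which are all components if $\kappa=K$), and, near each point of their domain, they can be changed to canonical coordinates with the same $x_1,\dots,x_{\kappa+2}$ in which $\widetilde\lambda$ is the Levi-Civita tensor of order $\kappa+2$. Thus, up to a change of variables, the canonical Levi-Civita brackets are locally the only possible ones. (B) Conversely, if $N=K+2$ and $\kappa\le K$, then each point of $U$ has an open neighbourhood $V\subseteq U$ on which the Poisson bracket is derived from an $n$-linear Nambu bracket: there are a Nambu tensor of order $\kappa+2$ and observables $C_1,\dots,C_\kappa$ on $V$ with $\{A,B\}=\{A,B,C_1,\dots,C_\kappa\}$ for all observables $A,B$ on $V$. -/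

import Mathlib

open scoped ContDiff

/-- Observables on an open set `U` of phase space `ℝ^N`: the functions that are smooth on `U`. -/
def IsObservable {N : ℕ} (U : Set (Fin N → ℝ)) (A : (Fin N → ℝ) → ℝ) : Prop :=
  ContDiffOn ℝ ∞ A U

/-- The partial derivative `∂A/∂z_i` at `z`. -/
noncomputable def pderivAt {N : ℕ} (i : Fin N) (A : (Fin N → ℝ) → ℝ) (z : Fin N → ℝ) : ℝ :=
  fderiv ℝ A z (Pi.single i 1)

/-- `{A, B} = ∑_{i,j} J_{ij}(z) ∂A/∂z_i ∂B/∂z_j`. -/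
noncomputable def poissonBracket {N : ℕ} (J : (Fin N → ℝ) → Matrix (Fin N) (Fin N) ℝ)
    (A B : (Fin N → ℝ) → ℝ) : (Fin N → ℝ) → ℝ :=
  fun z => ∑ i, ∑ j, J z i j * pderivAt i A z * pderivAt j B z

/-- `J` is a (smooth) Poisson matrix on `U`: it is antisymmetric and its bracket satisfies the
Jacobi identity. -/
structure IsPoissonMatrix {N : ℕ} (U : Set (Fin N → ℝ))
    (J : (Fin N → ℝ) → Matrix (Fin N) (Fin N) ℝ) : Prop where
  smooth : ∀ i j, ContDiffOn ℝ ∞ (fun z => J z i j) U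
  antisymm : ∀ z ∈ U, ∀ i j, J z j i = -J z i j
  jacobi : ∀ A B D, IsObservable U A → IsObservable U B → IsObservable U D → ∀ z ∈ U,
    poissonBracket J (poissonBracket J A B) D z + poissonBracket J (poissonBracket J D A) B z
      + poissonBracket J (poissonBracket J B D) A z = 0

/-- `C` is a Casimir invariant of the bracket of `J` on `U`. -/
def IsCasimir {N : ℕ} (U : Set (Fin N → ℝ)) (J : (Fin N → ℝ) → Matrix (Fin N) (Fin N) ℝ)
    (C : (Fin N → ℝ) → ℝ) : Prop :=
  ∀ A, IsObservable U A → ∀ z ∈ U, poissonBracket J A C z = 0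

/-- The `n`-linear bracket with tensor `lam`:
`{A_1, …, A_n} = ∑ lam_{i_1 ⋯ i_n}(z) ∂A_1/∂z_{i_1} ⋯ ∂A_n/∂z_{i_n}`. -/
noncomputable def nambuBracket {N n : ℕ} (lam : (Fin N → ℝ) → (Fin n → Fin N) → ℝ)
    (A : Fin n → (Fin N → ℝ) → ℝ) : (Fin N → ℝ) → ℝ :=
  fun z => ∑ i : Fin n → Fin N, lam z i * ∏ k, pderivAt (i k) (A k) z

/-- `lam` is a (smooth) Nambu tensor of order `m + 1` on `U`: it is totally antisymmetric, and its
bracket satisfies the fundamental identity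
`{{A_0, …, A_m}, E_1, …, E_m} = ∑_k {A_0, …, {A_k, E_1, …, E_m}, …, A_m}`. -/
structure IsNambuTensor {N m : ℕ} (U : Set (Fin N → ℝ))
    (lam : (Fin N → ℝ) → (Fin (m + 1) → Fin N) → ℝ) : Prop where
  smooth : ∀ i, ContDiffOn ℝ ∞ (fun z => lam z i) U
  antisymm : ∀ z ∈ U, ∀ (i : Fin (m + 1) → Fin N) (σ : Equiv.Perm (Fin (m + 1))),
    lam z (i ∘ σ) = ((Equiv.Perm.sign σ : ℤ) : ℝ) * lam z i
  fundamental : ∀ (A : Fin (m + 1) → (Fin N → ℝ) → ℝ) (E : Fin m → (Fin N → ℝ) → ℝ),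
    (∀ k, IsObservable U (A k)) → (∀ k, IsObservable U (E k)) → ∀ z ∈ U,
      nambuBracket lam (Matrix.vecCons (nambuBracket lam A) E) z =
        ∑ k, nambuBracket lam
          (Function.update A k (nambuBracket lam (Matrix.vecCons (A k) E))) z

/-- The Poisson bracket of `J` is derived on `U` from the Nambu bracket of `lam` and the
observables `C_1, …, C_κ`: `{A, B} = {A, B, C_1, …, C_κ}` for all observables `A`, `B`. -/
def IsDerivedFrom {N κ : ℕ} (U : Set (Fin N → ℝ))
    (J : (Fin N → ℝ) → Matrix (Fin N) (Fin N) ℝ)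
    (lam : (Fin N → ℝ) → (Fin (κ + 2) → Fin N) → ℝ) (C : Fin κ → (Fin N → ℝ) → ℝ) : Prop :=
  ∀ A B, IsObservable U A → IsObservable U B → ∀ z ∈ U,
    poissonBracket J A B z = nambuBracket lam (Matrix.vecCons A (Matrix.vecCons B C)) z

/-- The Poisson matrix in the variables `x = h(z)`: `{h_i, h_j}` at `z = h⁻¹(x)`. -/
noncomputable def transformedPoisson {N : ℕ} (h : OpenPartialHomeomorph (Fin N → ℝ) (Fin N → ℝ))
    (J : (Fin N → ℝ) → Matrix (Fin N) (Fin N) ℝ) (x : Fin N → ℝ) : Matrix (Fin N) (Fin N) ℝ :=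
  Matrix.of fun i j => poissonBracket J (fun z => h z i) (fun z => h z j) (h.symm x)

/-- The Nambu tensor in the variables `x = h(z)`: its component with indices `i_1, …, i_n` is
`∑ lam_{j_1 ⋯ j_n} ∂h_{i_1}/∂z_{j_1} ⋯ ∂h_{i_n}/∂z_{j_n} = {h_{i_1}, …, h_{i_n}}`
at `z = h⁻¹(x)`. -/
noncomputable def transformedNambu {N n : ℕ}
    (h : OpenPartialHomeomorph (Fin N → ℝ) (Fin N → ℝ))
    (lam : (Fin N → ℝ) → (Fin n → Fin N) → ℝ) (x : Fin N → ℝ) (i : Fin n → Fin N) : ℝ :=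
  nambuBracket lam (fun k z => h z (i k)) (h.symm x)

/-- The canonical Poisson matrix with one degree of freedom: `J_{12} = 1`, `J_{21} = -1`, and all
other entries vanish (indices start at `0` in the code). -/
def canonicalPoisson (N : ℕ) : Matrix (Fin N) (Fin N) ℝ :=
  Matrix.of fun i j =>
    if i.val = 0 ∧ j.val = 1 then 1 else if i.val = 1 ∧ j.val = 0 then -1 else 0

/-- The `n`-dimensional Levi-Civita tensor, placed on the first `n` of `N` indices: it is `sign σ`
if `(i_1, …, i_n)` is the permutation `σ` of the first `n` indices, and `0` otherwise (at most one
summand is nonzero). -/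
def leviCivita (N n : ℕ) (i : Fin n → Fin N) : ℝ :=
  ∑ σ : Equiv.Perm (Fin n),
    if ∀ k, (i k).val = (σ k).val then ((Equiv.Perm.sign σ : ℤ) : ℝ) else 0

/-- `x = h(z)` is a smooth local change of variables in `U` (with smooth inverse) for which
`x_3, …, x_N` are Casimir invariants, the first `κ` of which are `C_1, …, C_κ`, and which brings
the Poisson matrix `J` into the canonical form. -/
structure IsCanonicalChart {N κ : ℕ} (U : Set (Fin N → ℝ))
    (J : (Fin N → ℝ) → Matrix (Fin N) (Fin N) ℝ) (C : Fin κ → (Fin N → ℝ) → ℝ)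
    (h : OpenPartialHomeomorph (Fin N → ℝ) (Fin N → ℝ)) : Prop where
  source_subset : h.source ⊆ U
  smooth : ContDiffOn ℝ ∞ h h.source
  smooth_symm : ContDiffOn ℝ ∞ h.symm h.target
  casimir : ∀ i : Fin N, 2 ≤ i.val → IsCasimir h.source J (fun z => h z i)
  casimir_eq : ∀ (k : Fin κ) (i : Fin N), i.val = k.val + 2 → ∀ z ∈ h.source, h z i = C k z
  poisson_eq : ∀ x ∈ h.target, transformedPoisson h J x = canonicalPoisson N

/-! The Nambu side rests on a pointwise algebraic fact. If one entry of the fundamental identity is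
half the square of an affine function vanishing at z, only first derivatives survive at z and a
quadratic relation for the alternating form Λ of the tensor remains
(`IsNambuTensor.nambuQuadratic`). When the order is at least three, this relation makes Λ
decomposable: given Λ(ε) = 1, a covector that cannot replace any member of ε lies in the kernel of Λ
(`NambuQuadratic.map_eq_zero`). Since J = Λ(·, ·, dC) kills both that kernel and the dC_k, it has
rank two wherever it is nonzero, and N = K + 2 follows.

For the normal form, choose x₁, x₂ with {x₁, x₂} = 1. Then x₁, x₂, C₁, …, C_κ have Nambu bracket 1.
The fields obtained by freeing one slot of this bracket commute by the fundamental identity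
(`IsNambuTensor.nambuField_comm`) and are dual to the chosen functions. Their common first integrals
complete these functions to a chart, and by decomposability the gradients of the integrals lie in
the kernel of Λ. In that chart λ is the Levi-Civita tensor and the remaining coordinates are
Casimirs. The count κ + 2 ≤ N gives κ ≤ K. In an arbitrary canonical chart the leading component is
{x₁, x₂, C} = {x₁, x₂} = 1, and the same construction, started from the chart's own x₁, x₂, adapts
the other coordinates. The tri-linear bracket is a contraction of λ with C₂, …, C_κ: in the
fundamental identity the extra terms contain a repeated argument.

Conversely, when J has rank two, the Hamiltonian fields of conjugate functions commute by the Jacobi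
identity, and their common first integrals are Casimirs, so J is ∂₁ ∧ ∂₂ in suitable coordinates.
The tensor ∂₁ ∧ ⋯ ∧ ∂_{κ+2} is Nambu because its bracket is a Jacobian determinant of commuting
fields, whose cofactors are divergence-free (`isNambuTensor_wedgeTensor`). Inserting the coordinates
x₃, …, x_{κ+2} recovers J.

Both directions use simultaneous rectification of commuting fields (`exists_rectifying_functions`).
It rests on a smooth joint flow, obtained by solving γ(s) = p + ∑ u_j ∫₀ˢ X_j(γ) with the implicit
function theorem in the Banach space of continuous curves on [0, 1]. -/

open Filter Topology

namespace ContinuousMap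

/-! ### Calculus on spaces of continuous curves: superposition operators -/

section Superposition

variable {I : Type*} [TopologicalSpace I] [CompactSpace I]
universe u
variable {E F : Type u} [NormedAddCommGroup E] [NormedSpace ℝ E]
  [NormedAddCommGroup F] [NormedSpace ℝ F]

/-- Pointwise application of a continuous family of continuous linear maps, as a bilinear map. -/
noncomputable def pointwiseApply : C(I, E →L[ℝ] F) →L[ℝ] C(I, E) →L[ℝ] C(I, F) :=
  LinearMap.mkContinuous₂
    (LinearMap.mk₂ ℝ
      (fun (L : C(I, E →L[ℝ] F)) (h : C(I, E)) =>
        (⟨fun s => L s (h s), L.continuous.clm_apply h.continuous⟩ : C(I, F)))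
      (fun _ _ _ => by ext; simp) (fun _ _ _ => by ext; simp)
      (fun _ _ _ => by ext; simp) (fun _ _ _ => by ext; simp)) 1 (by
    intro L h
    rw [ContinuousMap.norm_le _ (by positivity), one_mul]
    intro s
    exact ((L s).le_opNorm (h s)).trans
      (mul_le_mul (L.norm_coe_le_norm s) (h.norm_coe_le_norm s) (norm_nonneg _) (norm_nonneg L)))

@[simp] theorem pointwiseApply_apply (L : C(I, E →L[ℝ] F)) (h : C(I, E)) (s : I) :
    pointwiseApply L h s = L s (h s) := rfl

/-- The range of γ is compact, so the derivative of f varies uniformly little near it. The mean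
value inequality then bounds the first-order remainder by ε‖h‖ at all parameters simultaneously. -/
theorem hasFDerivAt_comp_left {f : E → F} (hf : ContDiff ℝ 1 f) (γ : C(I, E)) :
    HasFDerivAt (fun γ : C(I, E) => (⟨f, hf.continuous⟩ : C(E, F)).comp γ)
      (pointwiseApply
        ((⟨fderiv ℝ f, hf.continuous_fderiv one_ne_zero⟩ : C(E, E →L[ℝ] F)).comp γ)) γ := by
  have hc : Continuous (fderiv ℝ f) := hf.continuous_fderiv one_ne_zero
  have hK : IsCompact (Set.range γ) := isCompact_range γ.continuous
  rw [hasFDerivAt_iff_isLittleO_nhds_zero, Asymptotics.isLittleO_iff]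
  intro ε hε
  have hu := hK.uniformContinuousAt_of_continuousAt (fderiv ℝ f)
    (fun x _ => hc.continuousAt) (Metric.dist_mem_uniformity hε)
  obtain ⟨δ, hδ, hδ'⟩ := Metric.mem_uniformity_dist.1 hu
  filter_upwards [Metric.ball_mem_nhds (0 : C(I, E)) hδ] with h hh
  rw [mem_ball_zero_iff] at hh
  rw [ContinuousMap.norm_le _ (by positivity)]
  intro s
  have hs : ‖h s‖ < δ := (h.norm_coe_le_norm s).trans_lt hh
  have key := (convex_ball (γ s) δ).norm_image_sub_le_of_norm_hasFDerivWithin_le'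
    (f := f) (f' := fderiv ℝ f) (φ := fderiv ℝ f (γ s)) (C := ε) (x := γ s) (y := γ s + h s)
    (fun x _ => (hf.differentiable one_ne_zero x).hasFDerivAt.hasFDerivWithinAt)
    (fun x hx => by
      have := hδ' (a := γ s) (b := x) (by rwa [dist_comm]) ⟨s, rfl⟩
      rw [← dist_eq_norm, dist_comm]
      exact le_of_lt this)
    (Metric.mem_ball_self hδ) (by simpa [Metric.mem_ball, dist_eq_norm] using hs)
  have h2 : ‖f (γ s + h s) - f (γ s) - fderiv ℝ f (γ s) (h s)‖ ≤ ε * ‖h s‖ := by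
    simpa using key
  exact h2.trans (by gcongr; exact h.norm_coe_le_norm s)

/-- The derivative is again a superposition operator, that of `fderiv ℝ f`, followed by a continuous
linear map. The induction therefore passes from F to `E →L[ℝ] F`, which is why both spaces share a
universe. -/
theorem contDiff_comp_left_nat (n : ℕ) {F : Type u} [NormedAddCommGroup F] [NormedSpace ℝ F]
    {f : E → F} (hf : ContDiff ℝ ∞ f) :
    ContDiff ℝ n (fun γ : C(I, E) => (⟨f, hf.continuous⟩ : C(E, F)).comp γ) := by
  induction n generalizing F with
  | zero =>
    exact contDiff_zero.2 (ContinuousMap.continuous_postcomp _)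
  | succ n ih =>
    have h1 : ContDiff ℝ 1 f := hf.of_le (by simp)
    have hd : ContDiff ℝ ∞ (fderiv ℝ f) := (contDiff_infty_iff_fderiv.1 hf).2
    push_cast
    refine contDiff_succ_iff_hasFDerivAt.2 ⟨_, ?_, fun γ => hasFDerivAt_comp_left h1 γ⟩
    exact (pointwiseApply (I := I) (E := E) (F := F)).contDiff.comp (ih hd)

/-- The superposition operator `γ ↦ f ∘ γ` of a smooth function is smooth. -/
theorem contDiff_comp_left {f : E → F} (hf : ContDiff ℝ ∞ f) :
    ContDiff ℝ ∞ (fun γ : C(I, E) => (⟨f, hf.continuous⟩ : C(E, F)).comp γ) :=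
  contDiff_infty.2 fun n => contDiff_comp_left_nat n hf

end Superposition

/-! ### Primitives of continuous curves -/

section Integral

variable {E : Type*} [NormedAddCommGroup E] [NormedSpace ℝ E]

/-- The primitive `s ↦ ∫_0^s γ` of a continuous curve on `[0, 1]`. -/
noncomputable def primitive : C(unitInterval, E) →L[ℝ] C(unitInterval, E) :=
  LinearMap.mkContinuous
    { toFun := fun γ => ⟨fun s => ∫ t in (0 : ℝ)..s, Set.IccExtend zero_le_one γ t, by
        have : Continuous fun s : ℝ => ∫ t in (0 : ℝ)..s, Set.IccExtend zero_le_one γ t :=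
          intervalIntegral.continuous_primitive
            (fun a b => (γ.continuous.Icc_extend').intervalIntegrable a b) 0
        exact this.comp continuous_subtype_val⟩
      map_add' := fun γ η => by
        ext s
        exact intervalIntegral.integral_add
          ((γ.continuous.Icc_extend').intervalIntegrable _ _)
          ((η.continuous.Icc_extend').intervalIntegrable _ _)
      map_smul' := fun c γ => by
        ext s
        exact intervalIntegral.integral_smul c _ } 1 (by
    intro γ
    rw [ContinuousMap.norm_le _ (by positivity), one_mul]
    intro s
    have := intervalIntegral.norm_integral_le_of_norm_le_const (a := (0 : ℝ)) (b := s)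
      (f := Set.IccExtend zero_le_one γ) (C := ‖γ‖) (fun t _ => γ.norm_coe_le_norm _)
    refine this.trans ?_
    rw [sub_zero, abs_of_nonneg s.2.1]
    exact mul_le_of_le_one_right (norm_nonneg _) s.2.2)

theorem primitive_apply (γ : C(unitInterval, E)) (s : unitInterval) :
    primitive γ s = ∫ t in (0 : ℝ)..s, Set.IccExtend zero_le_one γ t := rfl

end Integral

end ContinuousMap

/-! ### Smooth local inverses -/

section InverseFunction

variable {E F : Type*} [NormedAddCommGroup E] [NormedSpace ℝ E] [CompleteSpace E]
  [NormedAddCommGroup F] [NormedSpace ℝ F]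

theorem isOpen_setOf_isInvertible : IsOpen {L : E →L[ℝ] F | L.IsInvertible} :=
  ContinuousLinearEquiv.isOpen

/-- The inverse function theorem for smooth functions, with a smooth inverse on an open set. -/
theorem exists_smooth_openPartialHomeomorph {f : E → F} {s : Set E} {a : E} (hs : IsOpen s)
    (ha : a ∈ s) (hf : ContDiffOn ℝ ∞ f s) (hinv : (fderiv ℝ f a).IsInvertible) :
    ∃ e : OpenPartialHomeomorph E F, a ∈ e.source ∧ e.source ⊆ s ∧ ⇑e = f ∧
      ContDiffOn ℝ ∞ e.symm e.target := by
  have hat : ∀ z ∈ s, ContDiffAt ℝ ∞ f z := fun z hz => hf.contDiffAt (hs.mem_nhds hz)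
  have hdz : ∀ z ∈ s, HasFDerivAt f (fderiv ℝ f z) z := fun z hz =>
    ((hat z hz).differentiableAt (by simp)).hasFDerivAt
  obtain ⟨f', hf'⟩ := hinv
  have hda := hdz a ha
  rw [← hf'] at hda
  set e₀ := (hat a ha).toOpenPartialHomeomorph f hda (by simp) with he₀
  -- Restricting to points with invertible derivative makes the inverse smooth on the whole target,
  -- not merely at the image of a.
  set s' : Set E := s ∩ fderiv ℝ f ⁻¹' {L | L.IsInvertible} with hs'
  have hs'o : IsOpen s' :=
    (hf.continuousOn_fderiv_of_isOpen hs (by simp)).isOpen_inter_preimage hs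
      isOpen_setOf_isInvertible
  have hcoe : ⇑e₀ = f := (hat a ha).toOpenPartialHomeomorph_coe hda (by simp)
  refine ⟨e₀.restrOpen s' hs'o, ?_, ?_, ?_, ?_⟩
  · exact ⟨(hat a ha).mem_toOpenPartialHomeomorph_source hda (by simp), ha, f', hf'⟩
  · exact fun z hz => hz.2.1
  · exact hcoe
  · intro x hx
    have hz := (e₀.restrOpen s' hs'o).map_target hx
    obtain ⟨g, hg⟩ := hz.2.2
    have h1 := hdz _ hz.2.1
    rw [← hg] at h1
    exact ((e₀.restrOpen s' hs'o).contDiffAt_symm hx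
      (f₀' := g) (by simpa [hcoe] using h1)
      (by simpa [hcoe] using hat _ hz.2.1)).contDiffWithinAt

end InverseFunction

/-! ### Joint flows of commuting vector fields -/

section CommutingFlow

universe u
variable {ι : Type*} [Fintype ι]
  {E : Type u} [NormedAddCommGroup E] [NormedSpace ℝ E] [CompleteSpace E]

open ContinuousMap in
/-- Along a solution `γ` of `γ' = ∑ j, u j • X j γ`, the curve `s ↦ s • X i (γ s)` solves the
variational equation, when `X i` commutes with all `X j`. -/
theorem smul_vectorField_eq_primitive {X : ι → E → E} (hX : ∀ i, ContDiff ℝ ∞ (X i))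
    (u : ι → ℝ) (p : E) (γ : C(unitInterval, E)) (i : ι)
    (hγ : γ = ContinuousLinearMap.const ℝ unitInterval p +
      ∑ j, u j • primitive ((⟨X j, (hX j).continuous⟩ : C(E, E)).comp γ))
    (hcomm : ∀ j s, fderiv ℝ (X i) (γ s) (X j (γ s)) = fderiv ℝ (X j) (γ s) (X i (γ s)))
    (W : C(unitInterval, E)) (hW : ∀ s, W s = (s : ℝ) • X i (γ s)) :
    W = primitive ((⟨X i, (hX i).continuous⟩ : C(E, E)).comp γ) +
      ∑ j, u j • primitive (pointwiseApply
        ((⟨fderiv ℝ (X j), (hX j).continuous_fderiv (by simp)⟩ : C(E, E →L[ℝ] E)).comp γ) W) := by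
  set g : ℝ → E := Set.IccExtend zero_le_one γ with hg
  have hgc : Continuous g := γ.continuous.Icc_extend'
  have hgs : ∀ s : unitInterval, g s = γ s := fun s => Set.IccExtend_val _ _ _
  set w : ℝ → E := Set.IccExtend zero_le_one W with hw
  have hwc : Continuous w := W.continuous.Icc_extend'
  have hws : ∀ s : unitInterval, w s = W s := fun s => Set.IccExtend_val _ _ _
  have hXc : ∀ j, Continuous fun t => X j (g t) := fun j => (hX j).continuous.comp hgc
  -- The integral formula extends γ to a differentiable curve on the whole line, so that ordinary
  -- derivatives are available at the endpoints 0 and 1 too.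
  set c : ℝ → E := fun s => p + ∑ j, u j • ∫ t in (0 : ℝ)..s, X j (g t) with hc
  have hcd : ∀ s, HasDerivAt c (∑ j, u j • X j (g s)) s := by
    intro s
    refine HasDerivAt.const_add p (HasDerivAt.fun_sum fun j _ => HasDerivAt.const_smul (u j) ?_)
    exact intervalIntegral.integral_hasDerivAt_right ((hXc j).intervalIntegrable _ _)
      ((hXc j).stronglyMeasurableAtFilter _ _) (hXc j).continuousAt
  have hcg : ∀ s : unitInterval, c s = γ s := by
    intro s
    conv_rhs => rw [hγ]
    simp only [hc, ContinuousMap.add_apply, ContinuousMap.coe_sum, Finset.sum_apply,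
      ContinuousMap.coe_smul, Pi.smul_apply, primitive_apply]
    rfl
  set f' : ℝ → E := fun t => X i (g t) + ∑ j, u j • fderiv ℝ (X j) (g t) (w t) with hf'
  have hDc : ∀ j, Continuous fun t => fderiv ℝ (X j) (g t) (w t) := fun j =>
    (((hX j).continuous_fderiv (by simp)).comp hgc).clm_apply hwc
  have hDu : ∀ j, Continuous fun t => u j • fderiv ℝ (X j) (g t) (w t) := fun j =>
    (hDc j).const_smul (u j)
  have hf'c : Continuous f' := by
    refine (hXc i).add (continuous_finsetSum _ fun j _ => hDu j)
  -- The product rule gives X_i + t DX_i(∑ u_j X_j); commutation rewrites the second term as ∑ u_j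
  -- DX_j(t X_i), the linear term of the variational equation.
  have hder : ∀ t ∈ Set.Icc (0 : ℝ) 1, HasDerivAt (fun s => s • X i (c s)) (f' t) t := by
    intro t ht
    have h1 : HasDerivAt (fun s => X i (c s)) (fderiv ℝ (X i) (c t) (∑ j, u j • X j (g t))) t :=
      (((hX i).differentiable (by simp)) (c t)).hasFDerivAt.comp_hasDerivAt t (hcd t)
    have h2 := (hasDerivAt_id' t).fun_smul h1
    have e1 : c t = γ ⟨t, ht⟩ := hcg ⟨t, ht⟩
    have e2 : g t = γ ⟨t, ht⟩ := hgs ⟨t, ht⟩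
    have e3 : w t = t • X i (γ ⟨t, ht⟩) := (hws ⟨t, ht⟩).trans (hW _)
    convert h2 using 1
    simp only [hf', one_smul, e1, e2, e3, map_sum, map_smul, hcomm, Finset.smul_sum]
    rw [add_comm]
    congr 1
    exact Finset.sum_congr rfl fun j _ => smul_comm _ _ _
  ext s
  have hint : ∫ t in (0 : ℝ)..s, f' t = (s : ℝ) • X i (c s) - (0 : ℝ) • X i (c 0) := by
    refine intervalIntegral.integral_eq_sub_of_hasDerivAt (f := fun s => s • X i (c s))
      (fun t ht => hder t ?_) (hf'c.intervalIntegrable _ _)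
    rw [Set.uIcc_of_le s.2.1] at ht
    exact ⟨ht.1, ht.2.trans s.2.2⟩
  rw [zero_smul, sub_zero, hcg, ← hW] at hint
  rw [← hint]
  simp only [hf']
  rw [intervalIntegral.integral_add ((hXc i).intervalIntegrable _ _)
    ((continuous_finsetSum _ fun j _ => hDu j).intervalIntegrable _ _),
    intervalIntegral.integral_finsetSum
      (fun j _ => (hDu j).intervalIntegrable _ _)]
  simp only [intervalIntegral.integral_smul, ContinuousMap.add_apply, ContinuousMap.coe_sum,
    Finset.sum_apply, ContinuousMap.coe_smul, Pi.smul_apply, primitive_apply]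
  rfl

/-- Near q₀ the operator ∑ u_j T_j has norm less than 1, because the coefficients vanish at q₀. This
gives uniqueness for the variational equation at small times. -/
theorem eventually_eq_zero_of_eq_sum_smul {Q B : Type*} [TopologicalSpace Q]
    [NormedAddCommGroup B] [NormedSpace ℝ B] {u : Q → ι → ℝ} {T : ι → Q → B →L[ℝ] B} {q₀ : Q}
    (hu : ContinuousAt u q₀) (hu₀ : u q₀ = 0) (hT : ∀ j, ContinuousAt (T j) q₀) :
    ∀ᶠ q in 𝓝 q₀, ∀ W, W = ∑ j, u q j • T j q W → W = 0 := by
  set A : Q → B →L[ℝ] B := fun q => ∑ j, u q j • T j q with hA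
  have hAc : ContinuousAt A q₀ := tendsto_finsetSum _ fun j _ =>
    Tendsto.smul ((continuous_apply j).continuousAt.comp hu) (hT j)
  have hA1 : ∀ᶠ q in 𝓝 q₀, ‖A q‖ < 1 := by
    refine hAc.norm.eventually (gt_mem_nhds ?_)
    simp [hA, hu₀]
  filter_upwards [hA1] with q hq W hW
  by_contra hne
  have h2 : 0 < ‖W‖ := norm_pos_iff.2 hne
  have h3 : ‖W‖ ≤ ‖A q‖ * ‖W‖ := by
    have : W = A q W := by simpa [hA] using hW
    conv_lhs => rw [this]
    exact (A q).le_opNorm _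
  nlinarith

/-- Smooth solutions of the fixed point equation `γ = c p + ∑ i, u i • P i γ` for small `u`. -/
theorem exists_smooth_fixedPoint [DecidableEq ι] {B : Type*} [NormedAddCommGroup B]
    [NormedSpace ℝ B] [CompleteSpace B] (c : E →L[ℝ] B) {P : ι → B → B}
    (hP : ∀ i, ContDiff ℝ ∞ (P i)) (z₀ : E) :
    ∃ Γ : (ι → ℝ) × E → B, ContDiffAt ℝ ∞ Γ (0, z₀) ∧ Γ (0, z₀) = c z₀ ∧
      ∀ᶠ q in 𝓝 ((0 : ι → ℝ), z₀), Γ q = c q.2 + ∑ i, q.1 i • P i (Γ q) ∧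
        ContDiffAt ℝ ∞ Γ q ∧ ∀ i V, V = P i (Γ q) + ∑ j, q.1 j • fderiv ℝ (P j) (Γ q) V →
          fderiv ℝ Γ q (Pi.single i 1, 0) = V := by
  set F : ((ι → ℝ) × E) × B → B := fun v => v.2 - c v.1.2 - ∑ i, v.1.1 i • P i v.2 with hF
  have hFs : ContDiff ℝ ∞ F := by
    refine (contDiff_snd.sub (c.contDiff.comp (contDiff_snd.comp contDiff_fst))).sub
      (ContDiff.sum fun i _ => ContDiff.fun_smul ?_ ((hP i).comp contDiff_snd))
    exact (contDiff_apply ℝ ℝ i).comp (contDiff_fst.comp contDiff_fst)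
  set v₀ : ((ι → ℝ) × E) × B := ((0, z₀), c z₀) with hv₀
  have hF0 : F v₀ = 0 := by simp [hF, hv₀]
  -- At u = 0 the equation reads γ − c z₀ = 0, so the partial derivative in γ is the identity.
  have hinv : (fderiv ℝ F v₀ ∘L .inr ℝ ((ι → ℝ) × E) B).IsInvertible := by
    have h1 : HasFDerivAt (fun γ : B => F ((0, z₀), γ))
        (fderiv ℝ F v₀ ∘L .inr ℝ ((ι → ℝ) × E) B) (c z₀) :=
      ((hFs.differentiable (by simp)) v₀).hasFDerivAt.comp (c z₀)
        (hasFDerivAt_prodMk_right (0, z₀) (c z₀))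
    have h2 : HasFDerivAt (fun γ : B => F ((0, z₀), γ)) (ContinuousLinearMap.id ℝ B) (c z₀) := by
      have : (fun γ : B => F ((0, z₀), γ)) = fun γ => γ - c z₀ := by
        ext γ; simp [hF]
      rw [this]
      exact (hasFDerivAt_id _).sub_const _
    rw [h1.unique h2]
    exact ⟨ContinuousLinearEquiv.refl ℝ _, rfl⟩
  have hFa : ContDiffAt ℝ ∞ F v₀ := hFs.contDiffAt
  have hne : (∞ : WithTop ℕ∞) ≠ 0 := by simp
  set Γ : (ι → ℝ) × E → B := hFa.implicitFunction hne hinv with hΓ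
  have hΓs : ContDiffAt ℝ ∞ Γ (0, z₀) := hFa.contDiffAt_implicitFunction hne hinv
  have hΓ0 : Γ (0, z₀) = c z₀ := hFa.implicitFunction_apply_self hne hinv
  have hΓe : ∀ᶠ q in 𝓝 ((0 : ι → ℝ), z₀), F (q, Γ q) = 0 := by
    have := hFa.eventually_apply_implicitFunction hne hinv
    rwa [hF0] at this
  have hΓc : ∀ᶠ q in 𝓝 ((0 : ι → ℝ), z₀), ContinuousAt Γ q :=
    ((hΓs.of_le (m := 1) (by simp)).eventually (by simp)).mono fun q hq => hq.continuousAt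
  have hinv' : ∀ᶠ q in 𝓝 ((0 : ι → ℝ), z₀),
      (fderiv ℝ F (q, Γ q) ∘L .inr ℝ ((ι → ℝ) × E) B).IsInvertible := by
    have h1 : ContinuousAt (fun q => fderiv ℝ F (q, Γ q) ∘L .inr ℝ ((ι → ℝ) × E) B) (0, z₀) :=
      ((hFs.continuous_fderiv (by simp)).clm_comp continuous_const).continuousAt.comp
        (continuousAt_id.prodMk hΓs.continuousAt)
    refine h1.eventually (isOpen_setOf_isInvertible.mem_nhds ?_)
    simpa only [hΓ0, Set.mem_ofPred_eq] using hinv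
  -- Smoothness of infinite order at one point does not pass to a fixed neighbourhood. The implicit
  -- function theorem is therefore applied again at each nearby q, and local uniqueness identifies
  -- its solution with Γ.
  have hdiff : ∀ᶠ q in 𝓝 ((0 : ι → ℝ), z₀), ContDiffAt ℝ ∞ Γ q := by
    filter_upwards [hΓc, hinv', hΓe.eventually_nhds] with q hq1 hq2 hq3
    have hFq : ContDiffAt ℝ ∞ F (q, Γ q) := hFs.contDiffAt
    refine (hFq.contDiffAt_implicitFunction hne hq2).congr_of_eventuallyEq ?_
    have h1 := hFq.eventually_apply_eq_iff_implicitFunction hne hq2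
    have h2 : Tendsto (fun p => (p, Γ p)) (𝓝 q) (𝓝 (q, Γ q)) := continuousAt_id.prodMk hq1
    filter_upwards [h2.eventually h1, hq3] with p hp1 hp2
    exact (hp1.1 (hp2.trans hq3.self_of_nhds.symm)).symm
  have hA1 : ∀ᶠ q in 𝓝 ((0 : ι → ℝ), z₀), ∀ W : B,
      W = ∑ j, q.1 j • fderiv ℝ (P j) (Γ q) W → W = 0 :=
    eventually_eq_zero_of_eq_sum_smul (u := fun q : (ι → ℝ) × E => q.1)
      (T := fun j q => fderiv ℝ (P j) (Γ q)) continuous_fst.continuousAt rfl fun j =>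
      (((hP j).continuous_fderiv (by simp)).continuousAt (x := Γ (0, z₀))).comp hΓs.continuousAt
  refine ⟨Γ, hΓs, hΓ0, ?_⟩
  filter_upwards [hA1, hdiff, hΓe.eventually_nhds] with q hq1 hq3 hq4
  refine ⟨by simpa only [hF, sub_sub, sub_eq_zero] using hq4.self_of_nhds, hq3, fun i V hV => ?_⟩
  set Γ' := fderiv ℝ Γ q with hΓ'
  have hΓd : HasFDerivAt Γ Γ' q := (hq3.differentiableAt hne).hasFDerivAt
  have hd : HasFDerivAt (fun q => F (q, Γ q))
      (Γ' - c ∘L ContinuousLinearMap.snd ℝ _ _ -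
        ∑ j, (q.1 j • (fderiv ℝ (P j) (Γ q) ∘L Γ') +
          (ContinuousLinearMap.proj j ∘L ContinuousLinearMap.fst ℝ (ι → ℝ) E).smulRight
            (P j (Γ q)))) q := by
    have h1 : HasFDerivAt (fun q : (ι → ℝ) × E => c q.2)
        (c ∘L ContinuousLinearMap.snd ℝ (ι → ℝ) E) q :=
      (c ∘L ContinuousLinearMap.snd ℝ (ι → ℝ) E).hasFDerivAt
    have h2 : ∀ j, HasFDerivAt (fun q : (ι → ℝ) × E => q.1 j)
        (ContinuousLinearMap.proj j ∘L ContinuousLinearMap.fst ℝ (ι → ℝ) E) q := fun j =>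
      ContinuousLinearMap.hasFDerivAt
        ((ContinuousLinearMap.proj j : (ι → ℝ) →L[ℝ] ℝ) ∘L ContinuousLinearMap.fst ℝ (ι → ℝ) E)
    have h3 : ∀ j, HasFDerivAt (fun q => P j (Γ q)) (fderiv ℝ (P j) (Γ q) ∘L Γ') q := fun j =>
      ((hP j).differentiable (by simp) (Γ q)).hasFDerivAt.comp q hΓd
    exact (hΓd.fun_sub h1).fun_sub (HasFDerivAt.fun_sum fun j _ => (h2 j).fun_smul (h3 j))
  have hz : HasFDerivAt (fun q => F (q, Γ q)) (0 : (ι → ℝ) × E →L[ℝ] B) q :=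
    (hasFDerivAt_const (0 : B) q).congr_of_eventuallyEq hq4
  have hW := congrArg (fun T => T (Pi.single i (1 : ℝ), (0 : E))) (hd.unique hz)
  set W := Γ' (Pi.single i (1 : ℝ), (0 : E)) with hWdef
  have hW' : W = P i (Γ q) + ∑ j, q.1 j • fderiv ℝ (P j) (Γ q) W := by
    simp only [_root_.sub_apply, ContinuousLinearMap.comp_apply, _root_.sum_apply,
      _root_.add_apply, _root_.smul_apply, ContinuousLinearMap.smulRight_apply,
      ContinuousLinearMap.coe_snd', map_zero, ContinuousLinearMap.coe_fst', sub_zero,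
      ContinuousLinearMap.proj_apply, _root_.zero_apply, ← hWdef,
      Finset.sum_add_distrib, Pi.single_apply, ite_smul, one_smul, zero_smul,
      Finset.sum_ite_eq', Finset.mem_univ, if_true] at hW
    rw [sub_eq_zero] at hW
    rw [add_comm]
    exact hW
  -- The derivative of Γ and V solve the same inhomogeneous linear equation, so their difference
  -- solves the homogeneous one, which has only the zero solution.
  refine sub_eq_zero.1 (hq1 _ ?_)
  simp only [map_sub, smul_sub, Finset.sum_sub_distrib]
  nth_rewrite 1 [hW', hV]
  abel

open ContinuousMap in
/-- The joint flow of commuting vector fields, at a small multi-time: it is smooth, and its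
derivative in the `i`-th time is the `i`-th vector field. -/
theorem exists_commuting_flow [DecidableEq ι] {X : ι → E → E} (hX : ∀ i, ContDiff ℝ ∞ (X i))
    {z₀ : E}
    (hcomm : ∀ᶠ z in 𝓝 z₀, ∀ i j, fderiv ℝ (X i) z (X j z) = fderiv ℝ (X j) z (X i z)) :
    ∃ G : (ι → ℝ) × E → E, (∀ᶠ q in 𝓝 (0, z₀), ContDiffAt ℝ ∞ G q) ∧ (∀ᶠ p in 𝓝 z₀, G (0, p) = p) ∧
      ∀ᶠ q in 𝓝 ((0 : ι → ℝ), z₀), ∀ i, fderiv ℝ G q (Pi.single i 1, 0) = X i (G q) := by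
  set P : ι → C(unitInterval, E) → C(unitInterval, E) := fun i γ =>
    primitive ((⟨X i, (hX i).continuous⟩ : C(E, E)).comp γ) with hP
  have hPs : ∀ i, ContDiff ℝ ∞ (P i) := fun i =>
    (primitive (E := E)).contDiff.comp (contDiff_comp_left (hX i))
  have hPd : ∀ i γ, HasFDerivAt (P i) ((primitive (E := E)) ∘L (pointwiseApply
      ((⟨fderiv ℝ (X i), (hX i).continuous_fderiv (by simp)⟩ : C(E, E →L[ℝ] E)).comp γ))) γ :=
    fun i γ => (primitive (E := E)).hasFDerivAt.comp γ
      (hasFDerivAt_comp_left ((hX i).of_le (by simp)) γ)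
  obtain ⟨Γ, hΓs, hΓ0, hΓ⟩ :=
    exists_smooth_fixedPoint (ContinuousLinearMap.const ℝ unitInterval) hPs z₀
  have hev : ∀ s : unitInterval, ContDiff ℝ ∞ (fun γ : C(unitInterval, E) => γ s) := fun s =>
    (ContinuousMap.evalCLM ℝ s : C(unitInterval, E) →L[ℝ] E).contDiff
  refine ⟨fun q => Γ q 1, hΓ.mono fun q hq => (hev 1).contDiffAt.comp _ hq.2.1, ?_, ?_⟩
  · have hcont : Tendsto (fun p : E => ((0 : ι → ℝ), p)) (𝓝 z₀) (𝓝 (0, z₀)) :=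
      (Continuous.prodMk_right (0 : ι → ℝ)).tendsto z₀
    filter_upwards [hcont.eventually hΓ] with p hp
    have : Γ (0, p) = ContinuousLinearMap.const ℝ unitInterval p := by
      simpa using hp.1
    rw [this]; rfl
  -- For q near (0, z₀) the curve Γ q is uniformly close to the constant curve z₀, so it stays where
  -- the fields commute.
  · have hball : ∀ᶠ q in 𝓝 ((0 : ι → ℝ), z₀), ∀ s, ∀ i j,
        fderiv ℝ (X i) (Γ q s) (X j (Γ q s)) = fderiv ℝ (X j) (Γ q s) (X i (Γ q s)) := by
      obtain ⟨ρ, hρ, hb⟩ := Metric.eventually_nhds_iff.1 hcomm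
      have h1 := hΓs.continuousAt.eventually (Metric.ball_mem_nhds (Γ (0, z₀)) hρ)
      filter_upwards [h1] with q hq s
      refine hb ?_
      rw [hΓ0] at hq
      exact (ContinuousMap.dist_apply_le_dist (f := Γ q)
        (g := ContinuousLinearMap.const ℝ unitInterval z₀) s).trans_lt hq
    filter_upwards [hΓ, hball] with q hq hq2 i
    obtain ⟨hq1, hqd, hq3⟩ := hq
    -- The curve s ↦ s X_i(γ(s)) is the derivative of the solution in the i-th time; its value at s
    -- = 1 is X_i at the endpoint.
    set V : C(unitInterval, E) :=
      ⟨fun s => (s : ℝ) • X i (Γ q s), continuous_subtype_val.smul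
        ((hX i).continuous.comp (Γ q).continuous)⟩ with hV
    have hV' : V = P i (Γ q) + ∑ j, q.1 j • fderiv ℝ (P j) (Γ q) V := by
      simp only [fun j => (hPd j (Γ q)).fderiv]
      exact smul_vectorField_eq_primitive hX q.1 q.2 (Γ q) i hq1 (fun j s => hq2 s i j) V
        (fun s => rfl)
    have hG : HasFDerivAt (fun q => Γ q 1)
        ((ContinuousMap.evalCLM ℝ (1 : unitInterval) : C(unitInterval, E) →L[ℝ] E) ∘L
          fderiv ℝ Γ q) q :=
      (ContinuousMap.evalCLM ℝ (1 : unitInterval) :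
        C(unitInterval, E) →L[ℝ] E).hasFDerivAt.comp q (hqd.differentiableAt (by simp)).hasFDerivAt
    rw [hG.fderiv]
    change fderiv ℝ Γ q (Pi.single i 1, 0) 1 = _
    rw [hq3 i V hV']
    simp [hV]

end CommutingFlow

/-! ### Simultaneous rectification of commuting fields -/

section Rectification

universe u
variable {E : Type u} [NormedAddCommGroup E] [NormedSpace ℝ E] [FiniteDimensional ℝ E]

/-- A smooth function on an open set agrees near each point with a globally smooth function. -/
theorem exists_contDiff_eventuallyEq {F : Type*} [NormedAddCommGroup F] [NormedSpace ℝ F]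
    {f : E → F} {V : Set E} (hV : IsOpen V) (hf : ContDiffOn ℝ ∞ f V) {z₀ : E} (hz : z₀ ∈ V) :
    ∃ g : E → F, ContDiff ℝ ∞ g ∧ g =ᶠ[𝓝 z₀] f := by
  obtain ⟨d, hd, hdV⟩ := Metric.nhds_basis_closedBall.mem_iff.1 (hV.mem_nhds hz)
  let χ : ContDiffBump z₀ := ⟨d / 2, d, half_pos hd, half_lt_self hd⟩
  refine ⟨fun x => χ x • f x, contDiff_iff_contDiffAt.2 fun x => ?_, ?_⟩
  · by_cases hx : x ∈ V
    · exact χ.contDiffAt.smul (hf.contDiffAt (hV.mem_nhds hx))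
    · have hx' : x ∉ Metric.closedBall z₀ d := fun h => hx (hdV h)
      refine (contDiffAt_const (c := (0 : F))).congr_of_eventuallyEq ?_
      filter_upwards [Metric.isClosed_closedBall.isOpen_compl.mem_nhds hx'] with y hy
      have : χ y = 0 := χ.zero_of_le_dist (le_of_lt (by simpa using hy))
      rw [this, zero_smul]
  · filter_upwards [χ.eventuallyEq_one] with x hx
    rw [hx, Pi.one_apply, one_smul]

/-- Simultaneous rectification of commuting, linearly independent vector fields: near each point
there are functions `t i` with `X j (t i) = δ_ij`, and independent common first integrals, as many
as the dimension permits. -/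
theorem exists_rectifying_functions {ι : Type*} [Fintype ι] [DecidableEq ι] {X : ι → E → E}
    {V : Set E} (hV : IsOpen V) {z₀ : E} (hz₀ : z₀ ∈ V) (hX : ∀ i, ContDiffOn ℝ ∞ (X i) V)
    (hcomm : ∀ z ∈ V, ∀ i j, fderiv ℝ (X i) z (X j z) = fderiv ℝ (X j) z (X i z))
    (hli : LinearIndependent ℝ fun i => X i z₀) :
    ∃ (O : Set E) (t : ι → E → ℝ) (m : ℕ) (y : Fin m → E → ℝ),
      IsOpen O ∧ z₀ ∈ O ∧ O ⊆ V ∧ (∀ i, ContDiffOn ℝ ∞ (t i) O) ∧ (∀ a, ContDiffOn ℝ ∞ (y a) O) ∧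
      (∀ z ∈ O, ∀ i j, fderiv ℝ (t i) z (X j z) = if i = j then 1 else 0) ∧
      (∀ z ∈ O, ∀ a j, fderiv ℝ (y a) z (X j z) = 0) ∧
      (LinearIndependent ℝ fun a => fderiv ℝ (y a) z₀) ∧
      Fintype.card ι + m = Module.finrank ℝ E := by
  -- The flow construction requires globally smooth fields; only the germs at z₀ matter, so cut-offs
  -- serve.
  choose X' hX's hX'e using fun i => exists_contDiff_eventuallyEq hV (hX i) hz₀
  have hX'all : ∀ᶠ z in 𝓝 z₀, ∀ i, X' i =ᶠ[𝓝 z] X i :=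
    eventually_all.2 fun i => (hX'e i).eventually_nhds
  have hcomm' : ∀ᶠ z in 𝓝 z₀, ∀ i j,
      fderiv ℝ (X' i) z (X' j z) = fderiv ℝ (X' j) z (X' i z) := by
    filter_upwards [hX'all, hV.mem_nhds hz₀] with z hz hzV i j
    rw [(hz i).fderiv_eq, (hz j).fderiv_eq, (hz i).self_of_nhds, (hz j).self_of_nhds]
    exact hcomm z hzV i j
  obtain ⟨G, hGs, hG0, hGd⟩ := exists_commuting_flow hX's hcomm'
  -- W is a transversal: flowing for multi-time u from z₀ + w, with w in W, defines the rectifying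
  -- map Ψ.
  obtain ⟨W, hW⟩ := Submodule.exists_isCompl (Submodule.span ℝ (Set.range fun i => X i z₀))
  have hdim : Fintype.card ι + Module.finrank ℝ W = Module.finrank ℝ E := by
    rw [← finrank_span_eq_card hli]
    exact Submodule.finrank_add_eq_of_isCompl hW
  set j : (ι → ℝ) × W →L[ℝ] (ι → ℝ) × E :=
    (ContinuousLinearMap.id ℝ _).prodMap W.subtypeL with hj
  set κ : (ι → ℝ) × W → (ι → ℝ) × E := fun q => j q + (0, z₀) with hκ
  have hκ0 : κ 0 = (0, z₀) := by simp [hκ]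
  have hκs : ContDiff ℝ ∞ κ := j.contDiff.add contDiff_const
  have hκd : ∀ q, HasFDerivAt κ j q := fun q => j.hasFDerivAt.add_const _
  have hκt : Tendsto κ (𝓝 0) (𝓝 (0, z₀)) := by
    rw [← hκ0]; exact hκs.continuous.continuousAt
  set Ψ : (ι → ℝ) × W → E := fun q => G (κ q) with hΨ
  have hG00 : G (0, z₀) = z₀ := hG0.self_of_nhds
  have hΨ0 : Ψ 0 = z₀ := by rw [hΨ]; simp only [hκ0, hG00]
  have hΨfd : ∀ q, DifferentiableAt ℝ G (κ q) → fderiv ℝ Ψ q = (fderiv ℝ G (κ q)) ∘L j :=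
    fun q hq => (hq.hasFDerivAt.comp q (hκd q)).fderiv
  have hGsz : ContDiffAt ℝ ∞ G (0, z₀) := hGs.self_of_nhds
  have hΨt : Tendsto Ψ (𝓝 0) (𝓝 z₀) := by
    have : Tendsto G (𝓝 (0, z₀)) (𝓝 (G (0, z₀))) := hGsz.continuousAt
    rw [hG00] at this
    exact this.comp hκt
  have hgood : ∀ᶠ q in 𝓝 (0 : (ι → ℝ) × W), ContDiffAt ℝ ∞ Ψ q ∧ Ψ q ∈ V ∧
      ∀ i, fderiv ℝ Ψ q (Pi.single i 1, 0) = X i (Ψ q) := by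
    filter_upwards [hκt.eventually hGs, hκt.eventually hGd, hΨt.eventually hX'all,
      hΨt.eventually (hV.mem_nhds hz₀)] with q h1 h2 h3 h4
    refine ⟨h1.comp q hκs.contDiffAt, h4, fun i => ?_⟩
    rw [hΨfd q (h1.differentiableAt (by simp)), ← (h3 i).self_of_nhds]
    have : j (Pi.single i 1, 0) = (Pi.single i 1, 0) := by simp [hj]
    rw [ContinuousLinearMap.comp_apply, this]
    exact h2 i
  obtain ⟨s, hs, hso, hs0⟩ := eventually_nhds_iff.1 hgood
  -- At time zero the flow is the identity, so the derivative of Ψ is the inclusion on W and sends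
  -- the time directions to the X_i(z₀). Complementarity then makes it invertible.
  have hW0 : ∀ w : W, fderiv ℝ Ψ 0 (0, w) = w := by
    intro w
    have h1 : HasFDerivAt (fun p : E => G (0, p))
        ((fderiv ℝ G (0, z₀)) ∘L .inr ℝ (ι → ℝ) E) z₀ :=
      (hGsz.differentiableAt (by simp)).hasFDerivAt.comp z₀ (hasFDerivAt_prodMk_right 0 z₀)
    have h2 : HasFDerivAt (fun p : E => G (0, p)) (ContinuousLinearMap.id ℝ E) z₀ :=
      (hasFDerivAt_id z₀).congr_of_eventuallyEq hG0
    have h3 := congrArg (fun T : E →L[ℝ] E => T w) (h1.unique h2)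
    rw [hΨfd 0 (by rw [hκ0]; exact hGsz.differentiableAt (by simp)), hκ0]
    simpa [hj] using h3
  have hinv : (fderiv ℝ Ψ 0).IsInvertible := by
    have hinj : Function.Injective (fderiv ℝ Ψ 0) := by
      rw [injective_iff_map_eq_zero]
      rintro ⟨u, w⟩ huw
      have h1 : fderiv ℝ Ψ 0 (u, w) = ∑ i, u i • X i z₀ + w := by
        have e : ((u, w) : (ι → ℝ) × W) = ∑ i, u i • (Pi.single i (1 : ℝ), (0 : W)) + (0, w) := by
          refine Prod.ext ?_ ?_
          · simp only [Prod.fst_add, Prod.fst_sum, Prod.smul_fst, add_zero]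
            exact pi_eq_sum_univ' u
          · simp [Prod.snd_sum]
        rw [e, map_add, hW0, map_sum]
        congr 1
        refine Finset.sum_congr rfl fun i _ => ?_
        rw [map_smul, (hs 0 hs0).2.2 i, hΨ0]
      rw [h1] at huw
      have hmem : ∑ i, u i • X i z₀ ∈ Submodule.span ℝ (Set.range fun i => X i z₀) :=
        Submodule.sum_mem _ fun i _ => Submodule.smul_mem _ _ (Submodule.subset_span ⟨i, rfl⟩)
      have hw : (w : E) = -∑ i, u i • X i z₀ := by
        rw [eq_neg_iff_add_eq_zero, add_comm]; exact huw
      have hw0 : (w : E) = 0 := Submodule.disjoint_def.1 hW.disjoint _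
        (by rw [hw]; exact neg_mem hmem) w.2
      have hu : ∑ i, u i • X i z₀ = 0 := by rwa [hw0, add_zero] at huw
      refine Prod.ext ?_ (Subtype.ext hw0)
      funext i
      exact Fintype.linearIndependent_iff.1 hli u hu i
    refine ⟨(LinearEquiv.ofInjectiveOfFinrankEq (fderiv ℝ Ψ 0 : (ι → ℝ) × W →ₗ[ℝ] E) hinj
      ?_).toContinuousLinearEquiv, ?_⟩
    · rw [Module.finrank_prod, Module.finrank_fintype_fun_eq_card, hdim]
    · ext <;> rfl
  obtain ⟨e, he0, hes, hecoe, hesymm⟩ := exists_smooth_openPartialHomeomorph hso hs0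
    (fun q hq => (hs q hq).1.contDiffWithinAt) hinv
  have hz₀t : z₀ ∈ e.target := by
    have := e.map_source he0
    rwa [hecoe, hΨ0] at this
  have hsymm0 : e.symm z₀ = 0 := by
    have := e.left_inv he0
    rwa [hecoe, hΨ0] at this
  have hed : ∀ z ∈ e.target, HasFDerivAt e.symm (fderiv ℝ e.symm z) z := fun z hz =>
    ((hesymm.contDiffAt (e.open_target.mem_nhds hz)).differentiableAt (by simp)).hasFDerivAt
  have hcomp : ∀ z ∈ e.target, ∀ v, fderiv ℝ e.symm z (fderiv ℝ Ψ (e.symm z) v) = v := by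
    intro z hz v
    have h1 : HasFDerivAt Ψ (fderiv ℝ Ψ (e.symm z)) (e.symm z) :=
      ((hs _ (hes (e.map_target hz))).1.differentiableAt (by simp)).hasFDerivAt
    have hz' : Ψ (e.symm z) = z := by rw [← hecoe]; exact e.right_inv hz
    have h2 := hed z hz
    rw [← hz'] at h2
    have h3 := h2.comp (e.symm z) h1
    have h4 : HasFDerivAt (e.symm ∘ Ψ) (ContinuousLinearMap.id ℝ _) (e.symm z) := by
      refine (hasFDerivAt_id _).congr_of_eventuallyEq ?_
      filter_upwards [e.open_source.mem_nhds (e.map_target hz)] with q hq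
      simp only [Function.comp, id, ← hecoe]
      exact e.left_inv hq
    have h5 := congrArg (fun T => T v) (h3.unique h4)
    rw [hz'] at h5
    exact h5
  have hXe : ∀ z ∈ e.target, ∀ i, fderiv ℝ e.symm z (X i z) = (Pi.single i 1, 0) := by
    intro z hz i
    have h1 := (hs _ (hes (e.map_target hz))).2.2 i
    have hz' : Ψ (e.symm z) = z := by rw [← hecoe]; exact e.right_inv hz
    rw [hz'] at h1
    rw [← h1, hcomp z hz]
  -- The times and the linear coordinates of W, read through the inverse of Ψ, are the required
  -- functions.
  let b := Module.finBasis ℝ W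
  let pt : ι → (ι → ℝ) × W →L[ℝ] ℝ := fun i =>
    (ContinuousLinearMap.proj i : (ι → ℝ) →L[ℝ] ℝ) ∘L ContinuousLinearMap.fst ℝ (ι → ℝ) W
  let py : Fin (Module.finrank ℝ W) → (ι → ℝ) × W →L[ℝ] ℝ := fun a =>
    (LinearMap.toContinuousLinearMap (b.coord a)) ∘L ContinuousLinearMap.snd ℝ (ι → ℝ) W
  have hfd : ∀ (L : (ι → ℝ) × W →L[ℝ] ℝ), ∀ z ∈ e.target,
      fderiv ℝ (fun z => L (e.symm z)) z = L ∘L fderiv ℝ e.symm z := fun L z hz =>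
    (L.hasFDerivAt.comp z (hed z hz)).fderiv
  refine ⟨e.target, fun i z => pt i (e.symm z), Module.finrank ℝ W, fun a z => py a (e.symm z),
    e.open_target, hz₀t, ?_, fun i => (pt i).contDiff.comp_contDiffOn hesymm,
    fun a => (py a).contDiff.comp_contDiffOn hesymm, ?_, ?_, ?_, hdim⟩
  · intro z hz
    have h1 := (hs _ (hes (e.map_target hz))).2.1
    have hz' : Ψ (e.symm z) = z := by rw [← hecoe]; exact e.right_inv hz
    rwa [hz'] at h1
  · intro z hz i k
    rw [hfd _ z hz, ContinuousLinearMap.comp_apply, hXe z hz]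
    simp [pt, Pi.single_apply]
  · intro z hz a k
    rw [hfd _ z hz, ContinuousLinearMap.comp_apply, hXe z hz]
    simp [py]
  · refine Fintype.linearIndependent_iff.2 fun c hc a => ?_
    have h1 := congrArg (fun T : E →L[ℝ] ℝ => T (b a : E)) hc
    have h2 : ∀ k, fderiv ℝ (fun z => py k (e.symm z)) z₀ (b a : E) = if k = a then 1 else 0 := by
      intro k
      have h3 := hcomp z₀ hz₀t (0, b a)
      rw [hsymm0, hW0] at h3
      rw [hfd _ z₀ hz₀t, ContinuousLinearMap.comp_apply, h3]
      simp [py, Finsupp.single_apply, eq_comm]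
    simpa [_root_.sum_apply, h2] using h1

end Rectification

/-! ### Decomposability of the Nambu form -/

section Algebra

variable {V : Type*} [AddCommGroup V] [Module ℝ V]

theorem vecCons_vecCons_comp_perm {p : ℕ} {β : Type*} (u : Fin (p + 2) → β) {a b : Fin (p + 2)}
    (hab : a ≠ b) :
    ∃ (σ : Equiv.Perm (Fin (p + 2))) (E : Fin p → β),
      u ∘ σ = Matrix.vecCons (u a) (Matrix.vecCons (u b) E) := by
  have hb : Equiv.swap 0 a b ≠ 0 := by
    intro h
    rw [Equiv.swap_apply_eq_iff, Equiv.swap_apply_left] at h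
    exact hab h.symm
  -- The second swap uses the position that b occupies after a has been exchanged with 0.
  refine ⟨Equiv.swap 0 a * Equiv.swap 1 (Equiv.swap 0 a b),
    fun k => u ((Equiv.swap 0 a * Equiv.swap 1 (Equiv.swap 0 a b)) k.succ.succ), ?_⟩
  funext k
  refine Fin.cases ?_ (fun k => Fin.cases ?_ (fun k => ?_) k) k
  · have : (0 : Fin (p + 2)) ≠ 1 := by simp
    simp [Equiv.swap_apply_of_ne_of_ne this hb.symm]
  · simp
  · simp

theorem update_vecCons_vecCons_one {p : ℕ} {β : Type*} (a b c : β) (E : Fin p → β) :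
    Function.update (Matrix.vecCons a (Matrix.vecCons b E)) 1 c =
      Matrix.vecCons a (Matrix.vecCons c E) := by
  funext k
  refine Fin.cases ?_ (fun k => Fin.cases ?_ (fun k => ?_) k) k
  · rw [Function.update_of_ne (by simp)]; rfl
  · rw [show (Fin.succ 0 : Fin (p + 2)) = 1 from rfl, Function.update_self]; rfl
  · rw [Function.update_of_ne (fun h => by simp [Fin.ext_iff] at h)]; rfl

theorem update_vecCons_zero {p : ℕ} {β : Type*} (a c : β) (E : Fin p → β) :
    Function.update (Matrix.vecCons a E) 0 c = Matrix.vecCons c E :=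
  Fin.update_cons_zero (α := fun _ => β) a E c

/-- The algebraic part of the fundamental identity. -/
def NambuQuadratic {p : ℕ} (Λ : V [⋀^Fin (p + 2)]→ₗ[ℝ] ℝ) : Prop :=
  ∀ (A : Fin (p + 2) → V) (ξ : V) (E : Fin p → V),
    ∑ k, Λ (Function.update A k ξ) * Λ (Matrix.vecCons (A k) (Matrix.vecCons ξ E)) = 0

theorem AlternatingMap.map_eq_zero_of_vecCons {p : ℕ} (Λ : V [⋀^Fin (p + 2)]→ₗ[ℝ] ℝ) {x y : V}
    (h : ∀ E, Λ (Matrix.vecCons x (Matrix.vecCons y E)) = 0) {u : Fin (p + 2) → V}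
    {a b : Fin (p + 2)} (hab : a ≠ b) (ha : u a = x) (hb : u b = y) : Λ u = 0 := by
  obtain ⟨σ, E, hσ⟩ := vecCons_vecCons_comp_perm u hab
  have h1 := Λ.map_perm u σ
  rw [hσ, ha, hb, h, eq_comm, Units.smul_def, zsmul_eq_mul] at h1
  simpa using h1

theorem AlternatingMap.map_update_self_ne {ι : Type*} [DecidableEq ι] (Λ : V [⋀^ι]→ₗ[ℝ] ℝ)
    (ε : ι → V) (k l : ι) : Λ (Function.update ε k (ε l)) = if k = l then Λ ε else 0 := by
  split_ifs with h
  · rw [h, Function.update_eq_self]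
  · refine Λ.map_eq_zero_of_eq _ (i := k) (j := l) ?_ h
    rw [Function.update_self, Function.update_of_ne (Ne.symm h)]

/-- A vector splits into a combination of a family on which an alternating form does not vanish,
and a vector that cannot replace any member of the family. -/
theorem AlternatingMap.map_update_sub_sum {ι : Type*} [Fintype ι] [DecidableEq ι]
    (Λ : V [⋀^ι]→ₗ[ℝ] ℝ) {ε : ι → V} (hε : Λ ε = 1) (v : V) (k : ι) :
    Λ (Function.update ε k (v - ∑ l, Λ (Function.update ε l v) • ε l)) = 0 := by
  rw [Λ.map_update_sub, Λ.map_update_sum]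
  simp only [Λ.map_update_smul, Λ.map_update_self_ne, hε]
  simp

/-- Polarising the quadratic relation at ξ = ε_i + w shows that Λ vanishes on arguments containing
ε_i and w. Replacing one ε_n by w and taking ξ = ε_n + w' handles two such vectors w, w'. Every
vector is a combination of the ε_i plus a vector of this kind, so w is in the kernel. The order must
be at least three: the quadratic relation holds for every alternating form of order two. -/
theorem NambuQuadratic.map_eq_zero {q : ℕ} {Λ : V [⋀^Fin (q + 3)]→ₗ[ℝ] ℝ}
    (hQ : NambuQuadratic Λ) {ε : Fin (q + 3) → V} (hε : Λ ε = 1) {w : V}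
    (hw : ∀ k, Λ (Function.update ε k w) = 0) {u : Fin (q + 3) → V} {a : Fin (q + 3)}
    (ha : u a = w) : Λ u = 0 := by
  have mixed : ∀ w : V, (∀ k, Λ (Function.update ε k w) = 0) → ∀ i E,
      Λ (Matrix.vecCons (ε i) (Matrix.vecCons w E)) = 0 := by
    intro w hw i E
    have h := hQ ε (ε i + w) E
    simp only [Λ.map_update_add, hw, add_zero, Λ.map_update_self_ne, hε, ite_mul, one_mul,
      zero_mul, Finset.sum_ite_eq', Finset.mem_univ, if_true] at h
    have h2 : Λ (Matrix.vecCons (ε i) (Matrix.vecCons (ε i + w) E)) =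
        Λ (Matrix.vecCons (ε i) (Matrix.vecCons (ε i) E)) +
        Λ (Matrix.vecCons (ε i) (Matrix.vecCons w E)) := by
      have := Λ.map_update_add (Matrix.vecCons (ε i) (Matrix.vecCons w E)) 1 (ε i) w
      simpa only [update_vecCons_vecCons_one] using this
    rw [h2, Λ.map_eq_zero_of_eq (Matrix.vecCons (ε i) (Matrix.vecCons (ε i) E)) (i := 0) (j := 1)
      rfl (by simp), zero_add] at h
    exact h
  have both : ∀ w w' : V, (∀ k, Λ (Function.update ε k w) = 0) →
      (∀ k, Λ (Function.update ε k w') = 0) → ∀ E,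
      Λ (Matrix.vecCons w (Matrix.vecCons w' E)) = 0 := by
    intro w w' hw hw' E
    set n : Fin (q + 3) := Fin.last _ with hn
    have h := hQ (Function.update ε n w) (ε n + w') E
    rw [Finset.sum_eq_single n] at h
    · rw [Function.update_idem, Function.update_self, Λ.map_update_add, hw', add_zero,
        Function.update_eq_self, hε, one_mul] at h
      have h2 : Λ (Matrix.vecCons w (Matrix.vecCons (ε n + w') E)) =
          Λ (Matrix.vecCons w (Matrix.vecCons (ε n) E)) +
          Λ (Matrix.vecCons w (Matrix.vecCons w' E)) := by
        have := Λ.map_update_add (Matrix.vecCons w (Matrix.vecCons w' E)) 1 (ε n) w'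
        simpa only [update_vecCons_vecCons_one] using this
      rw [h2, Λ.map_eq_zero_of_vecCons (mixed w hw n)
        (u := Matrix.vecCons w (Matrix.vecCons (ε n) E)) (a := 1) (b := 0) (by simp) rfl rfl,
        zero_add] at h
      exact h
    · intro k _ hk
      -- A third index exists because the order is at least three; the term then contains both ε_j
      -- and w, hence vanishes by `mixed`.
      obtain ⟨j, hjk, hjn⟩ : ∃ j : Fin (q + 3), j ≠ k ∧ j ≠ n := by
        have : ∃ j : Fin (q + 3), j ∉ ({k, n} : Finset (Fin (q + 3))) := by
          by_contra! hall
          have h1 := Finset.card_le_card (fun j _ => hall j : Finset.univ ⊆ {k, n})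
          have h2 := Finset.card_le_two (a := k) (b := n)
          simp at h1
          omega
        obtain ⟨j, hj⟩ := this
        exact ⟨j, by simpa using hj⟩
      rw [Λ.map_eq_zero_of_vecCons (mixed w hw j) (a := j) (b := n) hjn, zero_mul]
      · rw [Function.update_of_ne hjk, Function.update_of_ne hjn]
      · rw [Function.update_of_ne hk.symm, Function.update_self]
    · simp
  obtain ⟨b, hb⟩ : ∃ b : Fin (q + 3), a ≠ b := by
    by_cases h : a = 0
    · exact ⟨1, by rw [h]; simp⟩
    · exact ⟨0, h⟩
  refine Λ.map_eq_zero_of_vecCons (x := u b) (y := w) (fun E => ?_) hb.symm rfl ha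
  have hsplit : u b = ∑ l, Λ (Function.update ε l (u b)) • ε l +
      (u b - ∑ l, Λ (Function.update ε l (u b)) • ε l) := by abel
  have hlin : ∀ x : V, Λ (Matrix.vecCons x (Matrix.vecCons w E)) =
      Λ (Function.update (Matrix.vecCons 0 (Matrix.vecCons w E)) 0 x) := by
    intro x
    rw [update_vecCons_zero]
  rw [hlin, hsplit, Λ.map_update_add, Λ.map_update_sum]
  simp only [Λ.map_update_smul, ← hlin]
  rw [both _ w (fun k => Λ.map_update_sub_sum hε (u b) k) hw]
  simp [mixed w hw]

end Algebra

/-! ### Component tensors as alternating forms -/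

section TensorForm

variable {N n : ℕ}

/-- The multilinear form on covectors with the components `L`. -/
noncomputable def tensorForm (L : (Fin n → Fin N) → ℝ) :
    MultilinearMap ℝ (fun _ : Fin n => Fin N → ℝ) ℝ :=
  ∑ i, L i • (MultilinearMap.mkPiAlgebra ℝ (Fin n) ℝ).compLinearMap
    (fun k => (LinearMap.proj (i k) : (Fin N → ℝ) →ₗ[ℝ] ℝ))

theorem tensorForm_apply (L : (Fin n → Fin N) → ℝ) (v : Fin n → Fin N → ℝ) :
    tensorForm L v = ∑ i, L i * ∏ k, v k (i k) := by
  simp [tensorForm]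

theorem tensorForm_comp_perm {L : (Fin n → Fin N) → ℝ}
    (hL : ∀ (i : Fin n → Fin N) (σ : Equiv.Perm (Fin n)),
      L (i ∘ σ) = ((Equiv.Perm.sign σ : ℤ) : ℝ) * L i)
    (v : Fin n → Fin N → ℝ) (σ : Equiv.Perm (Fin n)) :
    tensorForm L (v ∘ σ) = ((Equiv.Perm.sign σ : ℤ) : ℝ) * tensorForm L v := by
  rw [tensorForm_apply, tensorForm_apply, Finset.mul_sum]
  rw [← Equiv.sum_comp (Equiv.arrowCongr σ.symm (Equiv.refl (Fin N)))]
  refine Finset.sum_congr rfl fun i _ => ?_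
  have : (Equiv.arrowCongr σ.symm (Equiv.refl (Fin N))) i = i ∘ σ := by
    funext k; simp [Equiv.arrowCongr]
  rw [this, hL, mul_assoc]
  congr 2
  exact Equiv.prod_comp σ fun k => v k (i k)

/-- The alternating form on covectors with the components `L`. -/
noncomputable def altForm (L : (Fin n → Fin N) → ℝ)
    (hL : ∀ (i : Fin n → Fin N) (σ : Equiv.Perm (Fin n)),
      L (i ∘ σ) = ((Equiv.Perm.sign σ : ℤ) : ℝ) * L i) :
    (Fin N → ℝ) [⋀^Fin n]→ₗ[ℝ] ℝ :=
  { tensorForm L with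
    map_eq_zero_of_eq' := fun v k l hv hkl => by
      have h := tensorForm_comp_perm hL v (Equiv.swap k l)
      have hvs : v ∘ Equiv.swap k l = v := by
        funext m
        rcases eq_or_ne m k with rfl | hk
        · simp [hv]
        · rcases eq_or_ne m l with rfl | hl
          · simp [hv]
          · simp [Equiv.swap_apply_of_ne_of_ne hk hl]
      rw [hvs, Equiv.Perm.sign_swap hkl] at h
      change tensorForm L v = 0
      push_cast at h
      linarith }

theorem tensorForm_single (L : (Fin n → Fin N) → ℝ) (i : Fin n → Fin N) :
    tensorForm L (fun k => Pi.single (i k) 1) = L i := by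
  rw [tensorForm_apply, Finset.sum_eq_single i]
  · simp
  · intro j _ hj
    obtain ⟨k, hk⟩ := Function.ne_iff.1 hj
    rw [Finset.prod_eq_zero (Finset.mem_univ k) (by simp [hk]), mul_zero]
  · simp

/-- The values of an alternating form on members of a family, when the indices are among the first
ones, are given by the Levi-Civita tensor. -/
theorem AlternatingMap.map_comp_eq_leviCivita {V : Type*} [AddCommGroup V] [Module ℝ V]
    (Λ : V [⋀^Fin n]→ₗ[ℝ] ℝ) (g : Fin N → V) (hn : n ≤ N) (i : Fin n → Fin N)
    (hi : ∀ k, (i k).val < n) :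
    Λ (fun k => g (i k)) = leviCivita N n i * Λ (fun k => g (Fin.castLE hn k)) := by
  by_cases hinj : Function.Injective i
  · have hinj' : Function.Injective fun k => (⟨(i k).val, hi k⟩ : Fin n) := fun a b hab =>
      hinj (Fin.ext (by simpa using hab))
    let σ : Equiv.Perm (Fin n) := Equiv.ofBijective _ (Finite.injective_iff_bijective.1 hinj')
    have hσ : ∀ k, i k = Fin.castLE hn (σ k) := fun k => Fin.ext rfl
    have h1 : leviCivita N n i = ((Equiv.Perm.sign σ : ℤ) : ℝ) := by
      unfold leviCivita
      rw [Finset.sum_eq_single σ]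
      · rw [if_pos fun k => by rw [hσ]; rfl]
      · intro τ _ hτ
        rw [if_neg]
        intro h
        refine hτ (Equiv.ext fun k => Fin.ext ?_)
        rw [← h k, hσ]; rfl
      · simp
    have h2 := Λ.map_perm (fun k => g (Fin.castLE hn k)) σ
    have h3 : (fun k => g (i k)) = (fun k => g (Fin.castLE hn k)) ∘ σ := by
      funext k; simp [hσ]
    rw [h3, h2, h1, Units.smul_def, zsmul_eq_mul]
  · have h1 : leviCivita N n i = 0 := by
      unfold leviCivita
      refine Finset.sum_eq_zero fun σ _ => if_neg fun h => hinj fun a b hab => ?_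
      have := h a
      rw [hab, h b] at this
      exact (σ.injective (Fin.ext this)).symm
    rw [h1, zero_mul]
    simp only [Function.Injective, not_forall] at hinj
    obtain ⟨a, b, hab, hne⟩ := hinj
    exact Λ.map_eq_zero_of_eq _ (by simp [hab]) hne

theorem leviCivita_eq_zero {i : Fin n → Fin N} (hi : ∃ k, n ≤ (i k).val) :
    leviCivita N n i = 0 := by
  obtain ⟨k, hk⟩ := hi
  refine Finset.sum_eq_zero fun σ _ => if_neg fun h => ?_
  have := h k
  have := (σ k).isLt
  omega

end TensorForm

/-! ### Brackets as forms on gradients -/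

section Brackets

variable {N n : ℕ} {U V : Set (Fin N → ℝ)}

/-- The gradient of `A` at `z`, as a covector. -/
noncomputable def gradAt (A : (Fin N → ℝ) → ℝ) (z : Fin N → ℝ) : Fin N → ℝ :=
  fun i => pderivAt i A z

theorem fderiv_eq_sum_pderivAt (A : (Fin N → ℝ) → ℝ) (z v : Fin N → ℝ) :
    fderiv ℝ A z v = ∑ i, v i * pderivAt i A z := by
  conv_lhs => rw [pi_eq_sum_univ' v]
  rw [map_sum]
  exact Finset.sum_congr rfl fun i _ => by rw [map_smul]; rfl

theorem gradAt_congr {A B : (Fin N → ℝ) → ℝ} {z : Fin N → ℝ} (h : A =ᶠ[𝓝 z] B) :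
    gradAt A z = gradAt B z := by
  funext i
  rw [gradAt, gradAt, pderivAt, pderivAt, h.fderiv_eq]

theorem gradAt_eq_zero_of_eventuallyEq_const {A : (Fin N → ℝ) → ℝ} {z : Fin N → ℝ} {c : ℝ}
    (h : A =ᶠ[𝓝 z] fun _ => c) : gradAt A z = 0 := by
  rw [gradAt_congr h]
  funext i
  simp [gradAt, pderivAt]

theorem gradAt_clm (L : (Fin N → ℝ) →L[ℝ] ℝ) (z : Fin N → ℝ) :
    gradAt L z = fun i => L (Pi.single i 1) := by
  funext i
  rw [gradAt, pderivAt, L.fderiv]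

theorem gradAt_apply_coord (l : Fin N) (z : Fin N → ℝ) :
    gradAt (fun z => z l) z = Pi.single l 1 := by
  have := gradAt_clm (ContinuousLinearMap.proj l : (Fin N → ℝ) →L[ℝ] ℝ) z
  refine this.trans ?_
  funext i
  simp [Pi.single_apply, eq_comm]

/-- The linear function with gradient `α`. -/
noncomputable def linearFunction (α : Fin N → ℝ) : (Fin N → ℝ) →L[ℝ] ℝ :=
  ∑ i, α i • (ContinuousLinearMap.proj i : (Fin N → ℝ) →L[ℝ] ℝ)

@[simp] theorem gradAt_linearFunction (α z : Fin N → ℝ) : gradAt (linearFunction α) z = α := by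
  rw [gradAt_clm]
  funext i
  simp [linearFunction, _root_.sum_apply, Pi.single_apply]

theorem isObservable_clm (L : (Fin N → ℝ) →L[ℝ] ℝ) : IsObservable U L := L.contDiff.contDiffOn

theorem IsObservable.pderivAt {A : (Fin N → ℝ) → ℝ} (hU : IsOpen U) (hA : IsObservable U A)
    (i : Fin N) : IsObservable U (fun z => pderivAt i A z) :=
  (hA.fderiv_of_isOpen hU (by simp)).clm_apply contDiffOn_const

theorem IsObservable.differentiableAt {A : (Fin N → ℝ) → ℝ} (hU : IsOpen U)
    (hA : IsObservable U A) {z : Fin N → ℝ} (hz : z ∈ U) : DifferentiableAt ℝ A z :=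
  (ContDiffOn.contDiffAt hA (hU.mem_nhds hz)).differentiableAt (by simp)

theorem gradAt_mul {A B : (Fin N → ℝ) → ℝ} {z : Fin N → ℝ} (hA : DifferentiableAt ℝ A z)
    (hB : DifferentiableAt ℝ B z) :
    gradAt (fun z => A z * B z) z = A z • gradAt B z + B z • gradAt A z := by
  funext i
  simp [gradAt, pderivAt, fderiv_fun_mul hA hB]

theorem gradAt_const_mul {A : (Fin N → ℝ) → ℝ} {z : Fin N → ℝ} (c : ℝ) :
    gradAt (fun z => c * A z) z = c • gradAt A z := by
  funext i
  simp only [gradAt, pderivAt, Pi.smul_apply]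
  rw [show (fun z => c * A z) = c • A from rfl, fderiv_const_smul_field]
  rfl

theorem gradAt_vecCons (A : (Fin N → ℝ) → ℝ) (E : Fin n → (Fin N → ℝ) → ℝ) (z : Fin N → ℝ) :
    (fun k => gradAt (Matrix.vecCons A E k) z) =
      Matrix.vecCons (gradAt A z) fun k => gradAt (E k) z := by
  funext k
  refine Fin.cases ?_ (fun k => ?_) k <;> rfl

theorem gradAt_update (A : Fin n → (Fin N → ℝ) → ℝ) (k : Fin n) (B : (Fin N → ℝ) → ℝ)
    (z : Fin N → ℝ) :
    (fun l => gradAt (Function.update A k B l) z) =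
      Function.update (fun l => gradAt (A l) z) k (gradAt B z) := by
  funext l
  by_cases h : l = k
  · subst h; simp
  · simp [Function.update_of_ne h]

theorem nambuBracket_eq_tensorForm (lam : (Fin N → ℝ) → (Fin n → Fin N) → ℝ)
    (A : Fin n → (Fin N → ℝ) → ℝ) (z : Fin N → ℝ) :
    nambuBracket lam A z = tensorForm (lam z) fun k => gradAt (A k) z := by
  rw [tensorForm_apply]; rfl

/-- The conclusion is about germs rather than values, so that it can be used inside iterated
brackets. -/
theorem nambuBracket_congr {lam : (Fin N → ℝ) → (Fin n → Fin N) → ℝ}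
    {A B : Fin n → (Fin N → ℝ) → ℝ} {z : Fin N → ℝ} (h : ∀ k, A k =ᶠ[𝓝 z] B k) :
    nambuBracket lam A =ᶠ[𝓝 z] nambuBracket lam B := by
  filter_upwards [eventually_all.2 fun k => (h k).eventually_nhds] with y hy
  rw [nambuBracket_eq_tensorForm, nambuBracket_eq_tensorForm]
  congr 1
  funext k
  exact gradAt_congr (hy k)

theorem IsObservable.nambuBracket {lam : (Fin N → ℝ) → (Fin n → Fin N) → ℝ} (hU : IsOpen U)
    (hlam : ∀ i, ContDiffOn ℝ ∞ (fun z => lam z i) U) {A : Fin n → (Fin N → ℝ) → ℝ}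
    (hA : ∀ k, IsObservable U (A k)) : IsObservable U (nambuBracket lam A) :=
  ContDiffOn.sum fun i _ => (hlam i).mul (contDiffOn_prod fun k _ => (hA k).pderivAt hU (i k))

theorem IsObservable.mono {A : (Fin N → ℝ) → ℝ} (hA : IsObservable U A) (hVU : V ⊆ U) :
    IsObservable V A := ContDiffOn.mono hA hVU

theorem IsObservable.vecCons {A : (Fin N → ℝ) → ℝ} {E : Fin n → (Fin N → ℝ) → ℝ}
    (hA : IsObservable U A) (hE : ∀ k, IsObservable U (E k)) (k : Fin (n + 1)) :
    IsObservable U (Matrix.vecCons A E k) :=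
  Fin.cases hA hE k

theorem IsObservable.update {A : (Fin N → ℝ) → ℝ} {E : Fin n → (Fin N → ℝ) → ℝ}
    (hA : IsObservable U A) (hE : ∀ k, IsObservable U (E k)) (i k : Fin n) :
    IsObservable U (Function.update E i A k) := by
  by_cases h : k = i
  · subst h; simpa using hA
  · simpa [Function.update_of_ne h] using hE k

theorem poissonBracket_congr {J : (Fin N → ℝ) → Matrix (Fin N) (Fin N) ℝ}
    {A A' B B' : (Fin N → ℝ) → ℝ} {z : Fin N → ℝ} (hA : A =ᶠ[𝓝 z] A') (hB : B =ᶠ[𝓝 z] B') :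
    poissonBracket J A B =ᶠ[𝓝 z] poissonBracket J A' B' := by
  filter_upwards [hA.eventually_nhds, hB.eventually_nhds] with y hy1 hy2
  simp only [poissonBracket, pderivAt, Filter.EventuallyEq.fderiv_eq hy1,
    Filter.EventuallyEq.fderiv_eq hy2]

theorem IsObservable.poissonBracket {J : (Fin N → ℝ) → Matrix (Fin N) (Fin N) ℝ} (hU : IsOpen U)
    (hJ : ∀ i j, ContDiffOn ℝ ∞ (fun z => J z i j) U) {A B : (Fin N → ℝ) → ℝ}
    (hA : IsObservable U A) (hB : IsObservable U B) : IsObservable U (poissonBracket J A B) :=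
  ContDiffOn.sum fun i _ => ContDiffOn.sum fun j _ =>
    ((hJ i j).mul (hA.pderivAt hU i)).mul (hB.pderivAt hU j)

/-- The restriction of a Nambu tensor to a smaller open set. -/
theorem IsNambuTensor.mono {m : ℕ} {lam : (Fin N → ℝ) → (Fin (m + 1) → Fin N) → ℝ}
    (h : IsNambuTensor U lam) (hV : IsOpen V) (hVU : V ⊆ U) : IsNambuTensor V lam where
  smooth i := (h.smooth i).mono hVU
  antisymm z hz := h.antisymm z (hVU hz)
  fundamental A E hA hE z hz := by
    -- An observable on V need not extend to U. The identity at z depends only on germs, so globally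
    -- smooth representatives suffice.
    choose A' hA's hA' using fun k => exists_contDiff_eventuallyEq hV (hA k) hz
    choose E' hE's hE' using fun k => exists_contDiff_eventuallyEq hV (hE k) hz
    have hcons : ∀ {B B' : (Fin N → ℝ) → ℝ}, B =ᶠ[𝓝 z] B' → ∀ k,
        Matrix.vecCons B E' k =ᶠ[𝓝 z] Matrix.vecCons B' E k := by
      intro B B' hB k
      exact Fin.cases hB hE' k
    have key := h.fundamental A' E' (fun k => (hA's k).contDiffOn) (fun k => (hE's k).contDiffOn)
      z (hVU hz)
    rw [(nambuBracket_congr (hcons (nambuBracket_congr hA'))).self_of_nhds] at key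
    rw [key]
    refine Finset.sum_congr rfl fun k _ => ?_
    refine (nambuBracket_congr fun l => ?_).self_of_nhds
    by_cases hl : l = k
    · subst hl
      simpa using nambuBracket_congr (hcons (hA' l))
    · simpa [Function.update_of_ne hl] using hA' l

theorem IsPoissonMatrix.mono {J : (Fin N → ℝ) → Matrix (Fin N) (Fin N) ℝ}
    (h : IsPoissonMatrix U J) (hV : IsOpen V) (hVU : V ⊆ U) : IsPoissonMatrix V J where
  smooth i j := (h.smooth i j).mono hVU
  antisymm z hz := h.antisymm z (hVU hz)
  jacobi A B D hA hB hD z hz := by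
    obtain ⟨A', hA's, hA'⟩ := exists_contDiff_eventuallyEq hV hA hz
    obtain ⟨B', hB's, hB'⟩ := exists_contDiff_eventuallyEq hV hB hz
    obtain ⟨D', hD's, hD'⟩ := exists_contDiff_eventuallyEq hV hD hz
    have key := h.jacobi A' B' D' hA's.contDiffOn hB's.contDiffOn hD's.contDiffOn z (hVU hz)
    rwa [(poissonBracket_congr (poissonBracket_congr hA' hB') hD').self_of_nhds,
      (poissonBracket_congr (poissonBracket_congr hD' hA') hB').self_of_nhds,
      (poissonBracket_congr (poissonBracket_congr hB' hD') hA').self_of_nhds] at key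

/-- The bilinear form of the matrix `M` on covectors. -/
def matrixForm (M : Matrix (Fin N) (Fin N) ℝ) (α β : Fin N → ℝ) : ℝ :=
  ∑ i, ∑ j, M i j * α i * β j

theorem poissonBracket_eq_matrixForm (J : (Fin N → ℝ) → Matrix (Fin N) (Fin N) ℝ)
    (A B : (Fin N → ℝ) → ℝ) (z : Fin N → ℝ) :
    poissonBracket J A B z = matrixForm (J z) (gradAt A z) (gradAt B z) := rfl

theorem matrixForm_eq_dotProduct (M : Matrix (Fin N) (Fin N) ℝ) (α β : Fin N → ℝ) :
    matrixForm M α β = α ⬝ᵥ M.mulVec β := by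
  simp only [matrixForm, dotProduct, Matrix.mulVec, Finset.mul_sum]
  exact Finset.sum_congr rfl fun i _ => Finset.sum_congr rfl fun j _ => by ring

theorem IsPoissonMatrix.matrixForm_swap {J : (Fin N → ℝ) → Matrix (Fin N) (Fin N) ℝ}
    (h : IsPoissonMatrix U J) {z : Fin N → ℝ} (hz : z ∈ U) (α β : Fin N → ℝ) :
    matrixForm (J z) β α = -matrixForm (J z) α β := by
  simp only [matrixForm]
  rw [Finset.sum_comm, ← Finset.sum_neg_distrib]
  refine Finset.sum_congr rfl fun i _ => ?_
  rw [← Finset.sum_neg_distrib]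
  refine Finset.sum_congr rfl fun j _ => ?_
  rw [h.antisymm z hz]; ring

theorem IsPoissonMatrix.matrixForm_self {J : (Fin N → ℝ) → Matrix (Fin N) (Fin N) ℝ}
    (h : IsPoissonMatrix U J) {z : Fin N → ℝ} (hz : z ∈ U) (α : Fin N → ℝ) :
    matrixForm (J z) α α = 0 := by
  have := h.matrixForm_swap hz α α
  linarith

/-- Linear functions realise every pair of covectors as gradients, which turns the identity of
brackets into a pointwise one of forms. -/
theorem IsDerivedFrom.matrixForm_eq {κ : ℕ} {J : (Fin N → ℝ) → Matrix (Fin N) (Fin N) ℝ}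
    {lam : (Fin N → ℝ) → (Fin (κ + 2) → Fin N) → ℝ} {C : Fin κ → (Fin N → ℝ) → ℝ}
    (h : IsDerivedFrom U J lam C) {z : Fin N → ℝ} (hz : z ∈ U) (α β : Fin N → ℝ) :
    matrixForm (J z) α β =
      tensorForm (lam z) (Matrix.vecCons α (Matrix.vecCons β fun k => gradAt (C k) z)) := by
  have := h (linearFunction α) (linearFunction β) (isObservable_clm _) (isObservable_clm _) z hz
  rw [poissonBracket_eq_matrixForm, nambuBracket_eq_tensorForm, gradAt_vecCons, gradAt_vecCons,
    gradAt_linearFunction, gradAt_linearFunction] at this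
  exact this

/-- The alternating form of a Nambu tensor at a point. -/
noncomputable def IsNambuTensor.form {m : ℕ} {lam : (Fin N → ℝ) → (Fin (m + 1) → Fin N) → ℝ}
    (h : IsNambuTensor U lam) {z : Fin N → ℝ} (hz : z ∈ U) :
    (Fin N → ℝ) [⋀^Fin (m + 1)]→ₗ[ℝ] ℝ :=
  altForm (lam z) (h.antisymm z hz)

theorem IsNambuTensor.bracket_eq_form {m : ℕ} {lam : (Fin N → ℝ) → (Fin (m + 1) → Fin N) → ℝ}
    (h : IsNambuTensor U lam) {z : Fin N → ℝ} (hz : z ∈ U)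
    (A : Fin (m + 1) → (Fin N → ℝ) → ℝ) :
    nambuBracket lam A z = h.form hz fun k => gradAt (A k) z :=
  nambuBracket_eq_tensorForm _ _ _

/-- Take E₁ = q²/2 with q affine, q(z) = 0 and gradient ξ. Every bracket containing E₁ carries the
factor q, so the left side of the fundamental identity vanishes at z. On the right, the gradient of
q·f at z is f(z) ξ, which leaves exactly the quadratic relation. -/
theorem IsNambuTensor.nambuQuadratic {p : ℕ} {lam : (Fin N → ℝ) → (Fin (p + 2) → Fin N) → ℝ}
    (hU : IsOpen U) (h : IsNambuTensor U lam) {z : Fin N → ℝ} (hz : z ∈ U) :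
    NambuQuadratic (h.form hz) := by
  intro A ξ E
  set q : (Fin N → ℝ) → ℝ := fun y => linearFunction ξ y - linearFunction ξ z with hq
  have hqs : ContDiff ℝ ∞ q := (linearFunction ξ).contDiff.sub contDiff_const
  have hqg : ∀ y, gradAt q y = ξ := by
    intro y
    rw [← gradAt_linearFunction ξ y]
    funext i
    simp only [gradAt, pderivAt, hq, fderiv_sub_const]
  have hqz : q z = 0 := by simp [hq]
  set Q : (Fin N → ℝ) → ℝ := fun y => (1 / 2) * (q y * q y) with hQ
  have hQs : ContDiff ℝ ∞ Q := contDiff_const.mul (hqs.mul hqs)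
  have hQg : ∀ y, gradAt Q y = q y • ξ := by
    intro y
    have hd := (hqs.differentiable (by simp)) y
    rw [hQ, gradAt_const_mul, gradAt_mul hd hd, hqg, ← two_smul ℝ (q y • ξ), smul_smul]
    norm_num
  set A' : Fin (p + 2) → (Fin N → ℝ) → ℝ := fun k => linearFunction (A k) with hA'
  set E' : Fin (p + 1) → (Fin N → ℝ) → ℝ :=
    Matrix.vecCons Q (fun k => linearFunction (E k)) with hE'
  have hA's : ∀ k, IsObservable U (A' k) := fun k => isObservable_clm _
  have hE's : ∀ k, IsObservable U (E' k) :=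
    IsObservable.vecCons hQs.contDiffOn fun k => isObservable_clm _
  have key := h.fundamental A' E' hA's hE's z hz
  have hgE : ∀ (B : (Fin N → ℝ) → ℝ) (y : Fin N → ℝ),
      nambuBracket lam (Matrix.vecCons B E') y =
        q y * tensorForm (lam y) (Matrix.vecCons (gradAt B y) (Matrix.vecCons ξ E)) := by
    intro B y
    rw [nambuBracket_eq_tensorForm, gradAt_vecCons, hE', gradAt_vecCons, hQg]
    simp only [gradAt_linearFunction]
    have := (tensorForm (lam y)).map_update_smul
      (Matrix.vecCons (gradAt B y) (Matrix.vecCons ξ E)) 1 (q y) ξ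
    simpa only [update_vecCons_vecCons_one, smul_eq_mul] using this
  rw [hgE, hqz, zero_mul, eq_comm] at key
  rw [← key]
  refine Finset.sum_congr rfl fun k _ => ?_
  have hfun : nambuBracket lam (Matrix.vecCons (A' k) E') = fun y => q y *
      nambuBracket lam (Matrix.vecCons (A' k) (Matrix.vecCons (linearFunction ξ)
        fun k => linearFunction (E k))) y := by
    funext y
    rw [hgE, nambuBracket_eq_tensorForm, gradAt_vecCons, gradAt_vecCons]
    simp only [gradAt_linearFunction]
  have hobs : IsObservable U (nambuBracket lam (Matrix.vecCons (A' k)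
      (Matrix.vecCons (linearFunction ξ) fun k => linearFunction (E k)))) :=
    IsObservable.nambuBracket hU h.smooth (IsObservable.vecCons (isObservable_clm _)
      (IsObservable.vecCons (isObservable_clm _) fun k => isObservable_clm _))
  rw [h.bracket_eq_form hz, gradAt_update, hfun,
    gradAt_mul (hqs.differentiable (by simp) z) (hobs.differentiableAt hU hz), hqz, zero_smul,
    zero_add, hqg, AlternatingMap.map_update_smul, smul_eq_mul, h.bracket_eq_form hz,
    gradAt_vecCons, gradAt_vecCons, mul_comm]
  simp only [hA', gradAt_linearFunction]

end Brackets

/-! ### Commuting Nambu fields and adapted charts -/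

section Charts

variable {N n : ℕ} {U V : Set (Fin N → ℝ)}

/-- Smooth functions with independent gradients are local coordinates. -/
theorem exists_chart_of_linearIndependent (hV : IsOpen V) {z₀ : Fin N → ℝ} (hz₀ : z₀ ∈ V)
    (f : Fin N → (Fin N → ℝ) → ℝ) (hf : ∀ i, IsObservable V (f i))
    (hli : LinearIndependent ℝ fun i => gradAt (f i) z₀) :
    ∃ e : OpenPartialHomeomorph (Fin N → ℝ) (Fin N → ℝ), z₀ ∈ e.source ∧ e.source ⊆ V ∧
      (∀ z i, e z i = f i z) ∧ ContDiffOn ℝ ∞ e e.source ∧ ContDiffOn ℝ ∞ e.symm e.target := by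
  set F : (Fin N → ℝ) → (Fin N → ℝ) := fun z i => f i z with hF
  have hFs : ContDiffOn ℝ ∞ F V := contDiffOn_pi.2 hf
  have hinv : (fderiv ℝ F z₀).IsInvertible := by
    have happ : ∀ v, fderiv ℝ F z₀ v = (Matrix.of fun i => gradAt (f i) z₀).mulVec v := by
      intro v
      funext i
      rw [hF, fderiv_pi fun i => (hf i).differentiableAt hV hz₀, ContinuousLinearMap.pi_apply,
        fderiv_eq_sum_pderivAt]
      exact Finset.sum_congr rfl fun j _ => mul_comm _ _
    have hinj : Function.Injective (fderiv ℝ F z₀) := by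
      have h1 : IsUnit (Matrix.of fun i => gradAt (f i) z₀) :=
        Matrix.linearIndependent_rows_iff_isUnit.1 hli
      have h2 := Matrix.mulVec_injective_of_isUnit h1
      intro v w hvw
      rw [happ, happ] at hvw
      exact h2 hvw
    refine ⟨(LinearEquiv.ofInjectiveEndo (fderiv ℝ F z₀ : (Fin N → ℝ) →ₗ[ℝ] (Fin N → ℝ))
      hinj).toContinuousLinearEquiv, ?_⟩
    ext; rfl
  obtain ⟨e, h1, h2, h3, h4⟩ := exists_smooth_openPartialHomeomorph hV hz₀ hFs hinv
  exact ⟨e, h1, h2, fun z i => by rw [h3], by rw [h3]; exact hFs.mono h2, h4⟩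

/-- Functions dual to vectors `X j`, together with independent functions whose gradients vanish on
the `X j`, form local coordinates. -/
theorem exists_chart_of_dual_fields {m : ℕ} (hV : IsOpen V) {z₀ : Fin N → ℝ} (hz₀ : z₀ ∈ V)
    {x : Fin n → (Fin N → ℝ) → ℝ} {y : Fin m → (Fin N → ℝ) → ℝ}
    (hx : ∀ k, IsObservable V (x k)) (hy : ∀ a, IsObservable V (y a)) {X : Fin n → Fin N → ℝ}
    (hdual : ∀ i j, fderiv ℝ (x i) z₀ (X j) = if j = i then 1 else 0)
    (hyX : ∀ a j, fderiv ℝ (y a) z₀ (X j) = 0)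
    (hyli : LinearIndependent ℝ fun a => fderiv ℝ (y a) z₀) (hcard : n + m = N) :
    ∃ e : OpenPartialHomeomorph (Fin N → ℝ) (Fin N → ℝ), z₀ ∈ e.source ∧ e.source ⊆ V ∧
      ContDiffOn ℝ ∞ e e.source ∧ ContDiffOn ℝ ∞ e.symm e.target ∧
      (∀ (k : Fin n) (i : Fin N), i.val = k.val → ∀ z, e z i = x k z) ∧
      ∀ (a : Fin m) (i : Fin N), i.val = n + a.val → ∀ z, e z i = y a z := by
  set f : Fin N → (Fin N → ℝ) → ℝ := fun i =>
    Fin.append x y (Fin.cast hcard.symm i) with hf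
  have hfx : ∀ (k : Fin n) (i : Fin N), i.val = k.val → f i = x k := by
    intro k i hik
    have : Fin.cast hcard.symm i = Fin.castAdd m k := Fin.ext hik
    simp only [hf, this, Fin.append_left]
  have hfy : ∀ (a : Fin m) (i : Fin N), i.val = n + a.val → f i = y a := by
    intro a i hi
    have : Fin.cast hcard.symm i = Fin.natAdd n a := Fin.ext hi
    simp only [hf, this, Fin.append_right]
  have hfs : ∀ i, IsObservable V (f i) := by
    intro i
    by_cases hi : i.val < n
    · rw [hfx ⟨i.val, hi⟩ i rfl]; exact hx _
    · rw [hfy ⟨i.val - n, by omega⟩ i (by simp; omega)]; exact hy _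
  have hgrad : ∀ (A : (Fin N → ℝ) → ℝ) v, fderiv ℝ A z₀ v = v ⬝ᵥ gradAt A z₀ :=
    fun A v => fderiv_eq_sum_pderivAt A z₀ v
  have hfli : LinearIndependent ℝ fun i => gradAt (f i) z₀ := by
    have hsum : LinearIndependent ℝ fun i : Fin (n + m) => gradAt (Fin.append x y i) z₀ := by
      refine Fintype.linearIndependent_iff.2 fun c hc => ?_
      rw [Fin.sum_univ_add] at hc
      simp only [Fin.append_left, Fin.append_right] at hc
      -- Pairing a linear relation with X_j annihilates the y-gradients and isolates the coefficient
      -- of x_j.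
      have hcl : ∀ j, c (Fin.castAdd m j) = 0 := by
        intro j
        have h1 := congrArg (fun w => X j ⬝ᵥ w) hc
        simpa [dotProduct_add, dotProduct_sum, dotProduct_smul, ← hgrad, hdual, hyX] using h1
      simp only [hcl, zero_smul, Finset.sum_const_zero, zero_add] at hc
      have hcr : ∀ a, c (Fin.natAdd n a) = 0 := by
        refine Fintype.linearIndependent_iff.1 hyli (fun a => c (Fin.natAdd n a)) ?_
        ext v
        have h1 := congrArg (fun w => v ⬝ᵥ w) hc
        simpa [dotProduct_sum, dotProduct_smul, ← hgrad, _root_.sum_apply] using h1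
      intro i
      exact Fin.addCases hcl hcr i
    exact hsum.comp (Fin.cast hcard.symm) (Fin.cast_injective _)
  obtain ⟨e, he1, he2, he3, he4, he5⟩ := exists_chart_of_linearIndependent hV hz₀ f hfs hfli
  exact ⟨e, he1, he2, he4, he5, fun k i hik z => by rw [he3, hfx k i hik],
    fun a i hi z => by rw [he3, hfy a i hi]⟩

/-- The vector field `A ↦ {x_1, …, A, …, x_n}`, with `A` at the `i`-th place. -/
noncomputable def nambuField (lam : (Fin N → ℝ) → (Fin n → Fin N) → ℝ)
    (x : Fin n → (Fin N → ℝ) → ℝ) (i : Fin n) (z : Fin N → ℝ) : Fin N → ℝ :=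
  fun l => nambuBracket lam (Function.update x i fun z => z l) z

theorem fderiv_nambuField (lam : (Fin N → ℝ) → (Fin n → Fin N) → ℝ)
    (x : Fin n → (Fin N → ℝ) → ℝ) (i : Fin n) (A : (Fin N → ℝ) → ℝ) (z : Fin N → ℝ) :
    fderiv ℝ A z (nambuField lam x i z) = nambuBracket lam (Function.update x i A) z := by
  rw [fderiv_eq_sum_pderivAt, nambuBracket_eq_tensorForm, gradAt_update]
  have h : gradAt A z = ∑ l, pderivAt l A z • Pi.single l (1 : ℝ) := pi_eq_sum_univ' _
  rw [h, MultilinearMap.map_update_sum]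
  refine Finset.sum_congr rfl fun l _ => ?_
  rw [MultilinearMap.map_update_smul, smul_eq_mul, mul_comm, nambuField,
    nambuBracket_eq_tensorForm, gradAt_update, gradAt_apply_coord]

theorem isObservable_coord (l : Fin N) : IsObservable U fun z => z l :=
  isObservable_clm (ContinuousLinearMap.proj l : (Fin N → ℝ) →L[ℝ] ℝ)

theorem contDiffOn_nambuField {lam : (Fin N → ℝ) → (Fin n → Fin N) → ℝ} (hU : IsOpen U)
    (hlam : ∀ i, ContDiffOn ℝ ∞ (fun z => lam z i) U) {x : Fin n → (Fin N → ℝ) → ℝ}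
    (hx : ∀ k, IsObservable U (x k)) (i : Fin n) : ContDiffOn ℝ ∞ (nambuField lam x i) U :=
  contDiffOn_pi.2 fun l =>
    IsObservable.nambuBracket hU hlam (IsObservable.update (isObservable_coord l) hx i)

/-- Two smooth vector fields commute if they commute as derivations of the coordinates. -/
theorem fderiv_comm_of_coord {X Y : (Fin N → ℝ) → (Fin N → ℝ)} {z : Fin N → ℝ}
    (hX : DifferentiableAt ℝ X z) (hY : DifferentiableAt ℝ Y z)
    (h : ∀ l, fderiv ℝ (fun z => X z l) z (Y z) = fderiv ℝ (fun z => Y z l) z (X z)) :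
    fderiv ℝ X z (Y z) = fderiv ℝ Y z (X z) := by
  funext l
  have h1 : ∀ {Z : (Fin N → ℝ) → (Fin N → ℝ)} (_ : DifferentiableAt ℝ Z z) (v : Fin N → ℝ),
      fderiv ℝ Z z v l = fderiv ℝ (fun z => Z z l) z v := by
    intro Z hZ v
    rw [fderiv_apply hZ]
    rfl
  rw [h1 hX, h1 hY, h l]

theorem AlternatingMap.map_update_eq_vecCons {W : Type*} [AddCommGroup W] [Module ℝ W] {m : ℕ}
    (Λ : W [⋀^Fin (m + 1)]→ₗ[ℝ] ℝ) (g : Fin (m + 1) → W) (j : Fin (m + 1)) (b : W) :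
    Λ (Function.update g j b) = ((Equiv.Perm.sign (Equiv.swap 0 j) : ℤ) : ℝ) *
      Λ (Matrix.vecCons b fun k => g (Equiv.swap 0 j k.succ)) := by
  have h1 : Function.update g j b ∘ Equiv.swap 0 j =
      Matrix.vecCons b fun k => g (Equiv.swap 0 j k.succ) := by
    funext k
    refine Fin.cases ?_ (fun k => ?_) k
    · simp
    · have : Equiv.swap 0 j k.succ ≠ j := by
        rw [Ne, Equiv.swap_apply_eq_iff, Equiv.swap_apply_right]
        exact Fin.succ_ne_zero k
      simp [Function.update_of_ne this]
  have h2 := Λ.map_perm (Function.update g j b) (Equiv.swap 0 j)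
  rw [h1, Units.smul_def, zsmul_eq_mul] at h2
  rw [h2, ← mul_assoc, ← Int.cast_mul, ← Units.val_mul, Int.units_mul_self]
  simp

/-- Expand {{A, E_i}, E_j}, where E_i lists the x's other than x_i. The term differentiating A is
{{A, E_j}, E_i}; every other term contains a bracket of some x_k with E_j, which is locally constant
(0 or ±1) and has zero gradient. The signs s come from moving the free slot to the front. -/
theorem IsNambuTensor.nambuField_comm {m : ℕ} {lam : (Fin N → ℝ) → (Fin (m + 1) → Fin N) → ℝ}
    (hV : IsOpen V) (h : IsNambuTensor V lam) {x : Fin (m + 1) → (Fin N → ℝ) → ℝ}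
    (hx : ∀ k, IsObservable V (x k)) (hx1 : ∀ z ∈ V, nambuBracket lam x z = 1) {z : Fin N → ℝ}
    (hz : z ∈ V) (i j : Fin (m + 1)) :
    fderiv ℝ (nambuField lam x i) z (nambuField lam x j z) =
      fderiv ℝ (nambuField lam x j) z (nambuField lam x i z) := by
  have hd : ∀ i, DifferentiableAt ℝ (nambuField lam x i) z := fun i =>
    ((contDiffOn_nambuField hV h.smooth hx i).contDiffAt (hV.mem_nhds hz)).differentiableAt
      (by simp)
  set s : Fin (m + 1) → ℝ := fun j => ((Equiv.Perm.sign (Equiv.swap 0 j) : ℤ) : ℝ) with hs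
  set E : Fin (m + 1) → Fin m → (Fin N → ℝ) → ℝ := fun j k => x (Equiv.swap 0 j k.succ) with hE
  have hEs : ∀ j k, IsObservable V (E j k) := fun j k => hx _
  have hpos : ∀ j (F : (Fin N → ℝ) → ℝ), ∀ z ∈ V, nambuBracket lam (Function.update x j F) z =
      s j * nambuBracket lam (Matrix.vecCons F (E j)) z := by
    intro j F z hz
    rw [h.bracket_eq_form hz, h.bracket_eq_form hz, gradAt_update, gradAt_vecCons,
      AlternatingMap.map_update_eq_vecCons]
  have hconst : ∀ j l, ∀ z ∈ V,
      nambuBracket lam (Function.update x j (x l)) z = if j = l then 1 else 0 := by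
    intro j l z hz
    have h1 := hx1 z hz
    rw [h.bracket_eq_form hz] at h1
    rw [h.bracket_eq_form hz, gradAt_update,
      AlternatingMap.map_update_self_ne (h.form hz) (fun l => gradAt (x l) z) j l, h1]
  have hs2 : ∀ j, s j * s j = 1 := by
    intro j
    rw [hs]
    simp only
    rw [← Int.cast_mul, ← Units.val_mul, Int.units_mul_self]
    simp
  have hmain : ∀ (A : (Fin N → ℝ) → ℝ), IsObservable V A → ∀ i j,
      nambuBracket lam (Function.update x j (nambuBracket lam (Function.update x i A))) z =
        s j * s i * nambuBracket lam (Matrix.vecCons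
          (nambuBracket lam (Matrix.vecCons A (E i))) (E j)) z := by
    intro A hA i j
    rw [hpos j _ z hz, mul_assoc]
    congr 1
    have h1 : nambuBracket lam (Function.update x i A) =ᶠ[𝓝 z]
        fun y => s i * nambuBracket lam (Matrix.vecCons A (E i)) y := by
      filter_upwards [hV.mem_nhds hz] with y hy using hpos i A y hy
    rw [h.bracket_eq_form hz, h.bracket_eq_form hz, gradAt_vecCons, gradAt_vecCons,
      gradAt_congr h1, gradAt_const_mul]
    have := (h.form hz).map_update_smul (Matrix.vecCons (gradAt (nambuBracket lam
      (Matrix.vecCons A (E i))) z) fun k => gradAt (E j k) z) 0 (s i)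
      (gradAt (nambuBracket lam (Matrix.vecCons A (E i))) z)
    simpa only [update_vecCons_zero, smul_eq_mul] using this
  have hswap : ∀ (A : (Fin N → ℝ) → ℝ), IsObservable V A → ∀ i j,
      nambuBracket lam (Matrix.vecCons (nambuBracket lam (Matrix.vecCons A (E i))) (E j)) z =
      nambuBracket lam (Matrix.vecCons (nambuBracket lam (Matrix.vecCons A (E j))) (E i)) z := by
    intro A hA i j
    rw [h.fundamental (Matrix.vecCons A (E i)) (E j) (IsObservable.vecCons hA (hEs i)) (hEs j)
      z hz, Fin.sum_univ_succ, Finset.sum_eq_zero, add_zero, update_vecCons_zero]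
    · rfl
    · intro k _
      have h1 : nambuBracket lam (Matrix.vecCons (E i k) (E j)) =ᶠ[𝓝 z]
          fun _ => s j * if j = Equiv.swap 0 i k.succ then 1 else 0 := by
        filter_upwards [hV.mem_nhds hz] with y hy
        rw [← hconst j _ y hy, hpos j _ y hy, ← mul_assoc, hs2, one_mul]
      rw [h.bracket_eq_form hz, gradAt_update]
      refine AlternatingMap.map_coord_zero _ k.succ ?_
      rw [Function.update_self]
      exact gradAt_eq_zero_of_eventuallyEq_const h1
  refine fderiv_comm_of_coord (hd i) (hd j) fun l => ?_
  rw [fderiv_nambuField, fderiv_nambuField]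
  change nambuBracket lam (Function.update x j (nambuBracket lam
      (Function.update x i fun z => z l))) z =
    nambuBracket lam (Function.update x i (nambuBracket lam
      (Function.update x j fun z => z l))) z
  rw [hmain _ (isObservable_coord l), hmain _ (isObservable_coord l),
    hswap _ (isObservable_coord l), mul_comm (s j)]

/-- Functions whose Nambu bracket is `1` can be completed to local coordinates by functions whose
gradients are in the kernel of the tensor. -/
theorem IsNambuTensor.exists_chart {q : ℕ} {lam : (Fin N → ℝ) → (Fin (q + 3) → Fin N) → ℝ}
    (hV : IsOpen V) (h : IsNambuTensor V lam) {x : Fin (q + 3) → (Fin N → ℝ) → ℝ}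
    (hx : ∀ k, IsObservable V (x k)) (hx1 : ∀ z ∈ V, nambuBracket lam x z = 1)
    {z₀ : Fin N → ℝ} (hz₀ : z₀ ∈ V) :
    q + 3 ≤ N ∧ ∃ e : OpenPartialHomeomorph (Fin N → ℝ) (Fin N → ℝ), z₀ ∈ e.source ∧
      e.source ⊆ V ∧ ContDiffOn ℝ ∞ e e.source ∧ ContDiffOn ℝ ∞ e.symm e.target ∧
      (∀ (k : Fin (q + 3)) (i : Fin N), i.val = k.val → ∀ z, e z i = x k z) ∧
      ∀ z (hz : z ∈ V), z ∈ e.source → ∀ i : Fin N, q + 3 ≤ i.val →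
        ∀ (u : Fin (q + 3) → Fin N → ℝ) (a : Fin (q + 3)),
          u a = gradAt (fun z => e z i) z → h.form hz u = 0 := by
  have hdual : ∀ z ∈ V, ∀ i j, fderiv ℝ (x i) z (nambuField lam x j z) =
      if j = i then 1 else 0 := by
    intro z hz i j
    have h1 := hx1 z hz
    rw [h.bracket_eq_form hz] at h1
    rw [fderiv_nambuField, h.bracket_eq_form hz, gradAt_update,
      AlternatingMap.map_update_self_ne (h.form hz) (fun l => gradAt (x l) z) j i, h1]
  have hli : LinearIndependent ℝ fun i => nambuField lam x i z₀ := by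
    refine Fintype.linearIndependent_iff.2 fun c hc i => ?_
    have := congrArg (fderiv ℝ (x i) z₀) hc
    simpa [map_sum, hdual z₀ hz₀] using this
  -- The rectifying times are discarded: the prescribed x's are already dual to the fields, and only
  -- the common first integrals are needed.
  obtain ⟨O, -, m, y, hO, hz₀O, hOV, -, hys, -, hyX, hyli, hcard⟩ :=
    exists_rectifying_functions hV hz₀ (fun i => contDiffOn_nambuField hV h.smooth hx i)
      (fun z hz i j => h.nambuField_comm hV hx hx1 hz i j) hli
  rw [Fintype.card_fin, Module.finrank_fin_fun] at hcard
  refine ⟨by omega, ?_⟩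
  obtain ⟨e, he1, he2, he4, he5, hex, hey⟩ := exists_chart_of_dual_fields hO hz₀O
    (fun k => (hx k).mono hOV) hys (fun i j => hdual z₀ hz₀ i j) (hyX z₀ hz₀O) hyli hcard
  refine ⟨e, he1, he2.trans hOV, he4, he5, hex, ?_⟩
  intro z hz hze i hi u a hu
  have hef : (fun z => e z i) = y ⟨i.val - (q + 3), by omega⟩ :=
    funext fun z => hey ⟨i.val - (q + 3), by omega⟩ i (by simp; omega) z
  have h1 := hx1 z hz
  rw [h.bracket_eq_form hz] at h1
  -- A first integral of all the fields has a gradient that cannot replace any dx_k, so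
  -- decomposability puts it in the kernel.
  refine (h.nambuQuadratic hV hz).map_eq_zero h1 (fun k => ?_) (hu.trans (by rw [hef]))
  have h2 := hyX z (he2 hze) ⟨i.val - (q + 3), by omega⟩ k
  rwa [fderiv_nambuField, h.bracket_eq_form hz, gradAt_update] at h2

end Charts

/-! ### Contraction to a tri-linear bracket -/

section Contraction

/-- Three values followed by a family. -/
def consThree {q : ℕ} {β : Type*} (v : Fin 3 → β) (D : Fin q → β) : Fin (q + 3) → β :=
  Matrix.vecCons (v 0) (Matrix.vecCons (v 1) (Matrix.vecCons (v 2) D))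

theorem update_vecCons_succ {p : ℕ} {β : Type*} (a : β) (E : Fin p → β) (k : Fin p) (c : β) :
    Function.update (Matrix.vecCons a E) k.succ c = Matrix.vecCons a (Function.update E k c) :=
  (Fin.cons_update (α := fun _ => β) a E k c).symm

theorem consThree_castLE {q : ℕ} {β : Type*} (v : Fin 3 → β) (D : Fin q → β) (k : Fin 3) :
    consThree v D (Fin.castLE (by omega) k) = v k := by
  fin_cases k <;> rfl

theorem consThree_update {q : ℕ} {β : Type*} (v : Fin 3 → β) (D : Fin q → β) (k : Fin 3) (c : β) :
    consThree (Function.update v k c) D =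
      Function.update (consThree v D) (Fin.castLE (by omega) k) c := by
  fin_cases k
  · exact (update_vecCons_zero _ _ _).symm
  · refine Eq.symm ((update_vecCons_succ _ _ 0 _).trans ?_)
    rw [update_vecCons_zero]; rfl
  · refine Eq.symm ((update_vecCons_succ _ _ (Fin.succ 0) _).trans ?_)
    rw [update_vecCons_succ, update_vecCons_zero]; rfl

variable {q N : ℕ}

/-- The contraction of an alternating form with all but three of its arguments. -/
def AlternatingMap.contractThree {W : Type*} [AddCommGroup W] [Module ℝ W]
    (Λ : W [⋀^Fin (q + 3)]→ₗ[ℝ] ℝ) (D : Fin q → W) : W [⋀^Fin 3]→ₗ[ℝ] ℝ where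
  toFun v := Λ (consThree v D)
  map_update_add' := by
    intro _ v k x y
    rename_i inst
    obtain rfl : inst = instDecidableEqFin 3 := Subsingleton.elim _ _
    rw [consThree_update, consThree_update, consThree_update, Λ.map_update_add]
  map_update_smul' := by
    intro _ v k c x
    rename_i inst
    obtain rfl : inst = instDecidableEqFin 3 := Subsingleton.elim _ _
    rw [consThree_update, consThree_update, Λ.map_update_smul]
  map_eq_zero_of_eq' v a b hv hab := by
    refine Λ.map_eq_zero_of_eq _ (i := Fin.castLE (by omega) a) (j := Fin.castLE (by omega) b)
      ?_ (fun h => hab ?_)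
    · rw [consThree_castLE, consThree_castLE, hv]
    · exact Fin.ext (by simpa [Fin.ext_iff] using h)

theorem gradAt_consThree (A : Fin 3 → (Fin N → ℝ) → ℝ) (D : Fin q → (Fin N → ℝ) → ℝ)
    (z : Fin N → ℝ) : (fun k => gradAt (consThree A D k) z) =
      consThree (fun k => gradAt (A k) z) fun k => gradAt (D k) z := by
  simp only [consThree, gradAt_vecCons]

variable {U : Set (Fin N → ℝ)}

theorem IsObservable.consThree {A : Fin 3 → (Fin N → ℝ) → ℝ} {D : Fin q → (Fin N → ℝ) → ℝ}
    (hA : ∀ k, IsObservable U (A k)) (hD : ∀ k, IsObservable U (D k)) (k : Fin (q + 3)) :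
    IsObservable U (consThree A D k) :=
  IsObservable.vecCons (hA 0) (IsObservable.vecCons (hA 1) (IsObservable.vecCons (hA 2) hD)) k

/-- The contraction of a tensor with the gradients of `D`. -/
noncomputable def contractedTensor (lam : (Fin N → ℝ) → (Fin (q + 3) → Fin N) → ℝ)
    (D : Fin q → (Fin N → ℝ) → ℝ) (z : Fin N → ℝ) (i : Fin 3 → Fin N) : ℝ :=
  nambuBracket lam (consThree (fun k z => z (i k)) D) z

theorem IsNambuTensor.tensorForm_contractedTensor
    {lam : (Fin N → ℝ) → (Fin (q + 3) → Fin N) → ℝ} (h : IsNambuTensor U lam)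
    (D : Fin q → (Fin N → ℝ) → ℝ) {z : Fin N → ℝ} (hz : z ∈ U) :
    tensorForm (contractedTensor lam D z) =
      ((h.form hz).contractThree fun k => gradAt (D k) z).toMultilinearMap := by
  refine Module.Basis.ext_multilinear (fun _ => Pi.basisFun ℝ (Fin N)) fun i => ?_
  simp only [Pi.basisFun_apply]
  rw [tensorForm_single, contractedTensor, h.bracket_eq_form hz, gradAt_consThree]
  simp only [gradAt_apply_coord]
  rfl

theorem IsNambuTensor.nambuBracket_contractedTensor
    {lam : (Fin N → ℝ) → (Fin (q + 3) → Fin N) → ℝ} (h : IsNambuTensor U lam)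
    (D : Fin q → (Fin N → ℝ) → ℝ) {z : Fin N → ℝ} (hz : z ∈ U) (A : Fin 3 → (Fin N → ℝ) → ℝ) :
    nambuBracket (contractedTensor lam D) A z = nambuBracket lam (consThree A D) z := by
  rw [nambuBracket_eq_tensorForm, h.tensorForm_contractedTensor D hz, h.bracket_eq_form hz,
    gradAt_consThree]
  rfl

/-- The contraction of a Nambu tensor with the gradients of observables is a Nambu tensor. -/
theorem IsNambuTensor.contractedTensor {lam : (Fin N → ℝ) → (Fin (q + 3) → Fin N) → ℝ}
    (hU : IsOpen U) (h : IsNambuTensor U lam) {D : Fin q → (Fin N → ℝ) → ℝ}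
    (hD : ∀ k, IsObservable U (D k)) :
    IsNambuTensor (m := 2) U (contractedTensor lam D) where
  smooth i := IsObservable.nambuBracket hU h.smooth
    (IsObservable.consThree (fun k => isObservable_coord _) hD)
  antisymm z hz i σ := by
    have h1 := ((h.form hz).contractThree fun k => gradAt (D k) z).map_perm
      (fun k => Pi.single (i k) (1 : ℝ)) σ
    have h2 : ∀ j : Fin 3 → Fin N, _root_.contractedTensor lam D z j =
        ((h.form hz).contractThree fun k => gradAt (D k) z) fun k => Pi.single (j k) (1 : ℝ) := by
      intro j
      rw [← tensorForm_single (_root_.contractedTensor lam D z) j,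
        h.tensorForm_contractedTensor D hz]
      rfl
    rw [Units.smul_def, zsmul_eq_mul, ← h2] at h1
    rw [h2]
    exact h1
  fundamental A E hA hE z hz := by
    have hev : ∀ A : Fin 3 → (Fin N → ℝ) → ℝ,
        nambuBracket (_root_.contractedTensor lam D) A =ᶠ[𝓝 z]
          nambuBracket lam (consThree A D) := fun A => by
      filter_upwards [hU.mem_nhds hz] with y hy using h.nambuBracket_contractedTensor D hy A
    have hcongr : ∀ {A A' : Fin (q + 3) → (Fin N → ℝ) → ℝ}, (∀ k, A k =ᶠ[𝓝 z] A' k) →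
        nambuBracket lam A z = nambuBracket lam A' z := fun hAA' =>
      (nambuBracket_congr hAA').self_of_nhds
    have hup : ∀ {A : Fin (q + 3) → (Fin N → ℝ) → ℝ} (k) {B B' : (Fin N → ℝ) → ℝ},
        B =ᶠ[𝓝 z] B' → nambuBracket lam (Function.update A k B) z =
          nambuBracket lam (Function.update A k B') z := by
      intro A k B B' hB
      refine hcongr fun l => ?_
      by_cases hl : l = k
      · subst hl; simpa using hB
      · simp [Function.update_of_ne hl]
    have hE0 : ∀ B : (Fin N → ℝ) → ℝ, consThree (Matrix.vecCons B E) D =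
        Matrix.vecCons B (Matrix.vecCons (E 0) (Matrix.vecCons (E 1) D)) := fun B => rfl
    rw [h.nambuBracket_contractedTensor D hz, hE0]
    have h1 := hup (A := Matrix.vecCons 0 (Matrix.vecCons (E 0) (Matrix.vecCons (E 1) D))) 0 (hev A)
    rw [update_vecCons_zero, update_vecCons_zero] at h1
    rw [h1, h.fundamental (consThree A D) _ (IsObservable.consThree hA hD)
      (IsObservable.vecCons (hE 0) (IsObservable.vecCons (hE 1) hD)) z hz]
    have hsum : ∀ f : Fin (q + 3) → ℝ, (∀ k : Fin q, f k.succ.succ.succ = 0) →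
        ∑ k, f k = ∑ k : Fin 3, f (Fin.castLE (by omega) k) := by
      intro f hf
      rw [Fin.sum_univ_succ, Fin.sum_univ_succ, Fin.sum_univ_succ,
        Finset.sum_eq_zero fun k _ => hf k, Fin.sum_univ_three, add_zero, ← add_assoc]
      rfl
    rw [hsum]
    · refine Finset.sum_congr rfl fun k _ => ?_
      rw [h.nambuBracket_contractedTensor D hz, consThree_update, consThree_castLE, ← hE0]
      exact hup _ (hev _).symm
    -- In a term where D_k is differentiated, the inner bracket contains D_k twice, so it vanishes
    -- near z.
    · intro k
      rw [h.bracket_eq_form hz, gradAt_update]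
      refine AlternatingMap.map_coord_zero _ k.succ.succ.succ ?_
      rw [Function.update_self]
      refine gradAt_eq_zero_of_eventuallyEq_const (c := 0) ?_
      filter_upwards [hU.mem_nhds hz] with y hy
      rw [h.bracket_eq_form hy]
      refine AlternatingMap.map_eq_zero_of_eq _ _ (i := 0) (j := k.succ.succ.succ) rfl ?_
      exact (Fin.succ_ne_zero _).symm

end Contraction

/-! ### Antisymmetric matrices of rank two -/

section Rank

variable {N : ℕ}

/-- Pairing a relation with α and with β isolates its two coefficients, since antisymmetry kills the
diagonal pairings. -/
theorem linearIndependent_mulVec_pair {M : Matrix (Fin N) (Fin N) ℝ}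
    (hM : ∀ α β, matrixForm M β α = -matrixForm M α β) {α β : Fin N → ℝ}
    (hαβ : matrixForm M α β ≠ 0) :
    LinearIndependent ℝ ![M.mulVec α, M.mulVec β] := by
  have hself : ∀ γ, γ ⬝ᵥ M.mulVec γ = 0 := by
    intro γ
    have := hM γ γ
    rw [matrixForm_eq_dotProduct] at this
    linarith
  have hβα : β ⬝ᵥ M.mulVec α ≠ 0 := by
    rw [← matrixForm_eq_dotProduct, hM α β]; exact neg_ne_zero.2 hαβ
  rw [matrixForm_eq_dotProduct] at hαβ
  refine LinearIndependent.pair_iff.2 fun s t hst => ?_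
  have h1 := congrArg (fun w => α ⬝ᵥ w) hst
  have h2 := congrArg (fun w => β ⬝ᵥ w) hst
  simp only [dotProduct_add, dotProduct_smul, hself, mul_zero, zero_add, add_zero,
    dotProduct_zero, smul_eq_mul, mul_eq_zero, hαβ, hβα, or_false] at h1 h2
  exact ⟨h2, h1⟩

theorem finrank_span_mulVec_pair {M : Matrix (Fin N) (Fin N) ℝ}
    (hM : ∀ α β, matrixForm M β α = -matrixForm M α β) {α β : Fin N → ℝ}
    (hαβ : matrixForm M α β ≠ 0) :
    Module.finrank ℝ (Submodule.span ℝ {M.mulVec α, M.mulVec β}) = 2 := by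
  have hr : ({M.mulVec α, M.mulVec β} : Set (Fin N → ℝ)) =
      Set.range ![M.mulVec α, M.mulVec β] := by
    simp only [Matrix.range_cons, Matrix.range_empty, Set.union_empty, Set.singleton_union]
  rw [hr, finrank_span_eq_card (linearIndependent_mulVec_pair hM hαβ), Fintype.card_fin]

theorem span_mulVec_pair_le_range (M : Matrix (Fin N) (Fin N) ℝ) (α β : Fin N → ℝ) :
    Submodule.span ℝ {M.mulVec α, M.mulVec β} ≤ LinearMap.range M.mulVecLin := by
  rw [Submodule.span_le]
  rintro _ (rfl | rfl)
  · exact ⟨α, rfl⟩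
  · exact ⟨β, rfl⟩

/-- An antisymmetric matrix has rank two if its range is spanned by the images of two vectors. -/
theorem rank_eq_two {M : Matrix (Fin N) (Fin N) ℝ}
    (hM : ∀ α β, matrixForm M β α = -matrixForm M α β) {α β : Fin N → ℝ}
    (hαβ : matrixForm M α β ≠ 0)
    (h : ∀ v, ∃ c d : ℝ, M.mulVec v = c • M.mulVec α + d • M.mulVec β) : M.rank = 2 := by
  suffices hr : LinearMap.range M.mulVecLin = Submodule.span ℝ {M.mulVec α, M.mulVec β} by
    rw [← finrank_span_mulVec_pair hM hαβ, Matrix.rank, hr]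
  refine le_antisymm ?_ (span_mulVec_pair_le_range M α β)
  rintro _ ⟨v, rfl⟩
  obtain ⟨c, d, hcd⟩ := h v
  rw [Matrix.mulVecLin_apply, hcd]
  exact Submodule.mem_span_pair.2 ⟨c, d, rfl⟩

/-- The kernel of an antisymmetric matrix of rank two. -/
theorem matrixForm_eq_zero_of_rank_eq_two {M : Matrix (Fin N) (Fin N) ℝ}
    (hM : ∀ α β, matrixForm M β α = -matrixForm M α β) (hr : M.rank = 2) {α β γ : Fin N → ℝ}
    (hαβ : matrixForm M α β ≠ 0) (hα : matrixForm M α γ = 0) (hβ : matrixForm M β γ = 0)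
    (v : Fin N → ℝ) : matrixForm M v γ = 0 := by
  -- By dimension, Mα and Mβ span the range, so Mγ = c Mα + d Mβ. Testing with α and β makes d and c
  -- vanish.
  have hspan : Submodule.span ℝ {M.mulVec α, M.mulVec β} = LinearMap.range M.mulVecLin := by
    refine Submodule.eq_of_le_of_finrank_eq (span_mulVec_pair_le_range M α β) ?_
    rw [finrank_span_mulVec_pair hM hαβ]
    exact hr.symm
  have hmem : M.mulVec γ ∈ Submodule.span ℝ {M.mulVec α, M.mulVec β} := by
    rw [hspan]; exact ⟨γ, rfl⟩
  obtain ⟨c, d, hcd⟩ := Submodule.mem_span_pair.1 hmem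
  have hself : ∀ δ, matrixForm M δ δ = 0 := fun δ => by
    have := hM δ δ
    linarith
  have key : ∀ w, matrixForm M w γ = c * matrixForm M w α + d * matrixForm M w β := by
    intro w
    simp only [matrixForm_eq_dotProduct, ← hcd, dotProduct_add, dotProduct_smul, smul_eq_mul]
  have hd : d = 0 := by
    have := key α
    rw [hα, hself, mul_zero, zero_add] at this
    exact (mul_eq_zero.1 this.symm).resolve_right hαβ
  have hc : c = 0 := by
    have := key β
    rw [hβ, hself, mul_zero, add_zero, hM α β] at this
    exact (mul_eq_zero.1 this.symm).resolve_right (neg_ne_zero.2 hαβ)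
  rw [key, hc, hd]; ring

theorem matrixForm_single (M : Matrix (Fin N) (Fin N) ℝ) (i j : Fin N) :
    matrixForm M (Pi.single i 1) (Pi.single j 1) = M i j := by
  simp [matrixForm, Pi.single_apply]

theorem exists_matrixForm_ne_zero {M : Matrix (Fin N) (Fin N) ℝ} (hM : M.rank ≠ 0) :
    ∃ i j, M i j ≠ 0 := by
  by_contra! h
  refine hM ?_
  have : M = 0 := by ext i j; exact h i j
  rw [this, Matrix.rank_zero]

end Rank

/-! ### Conjugate functions and canonical charts -/

section Darboux

variable {N : ℕ} {U V : Set (Fin N → ℝ)}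

/-- Near each point where a Poisson matrix does not vanish there are conjugate functions. -/
theorem exists_conjugate_functions {J : (Fin N → ℝ) → Matrix (Fin N) (Fin N) ℝ} (hU : IsOpen U)
    (hJ : IsPoissonMatrix U J) {z₀ : Fin N → ℝ} (hz₀ : z₀ ∈ U) {k l : Fin N}
    (hkl : J z₀ k l ≠ 0) :
    ∃ V : Set (Fin N → ℝ), IsOpen V ∧ z₀ ∈ V ∧ V ⊆ U ∧ ∃ x₁ x₂ : (Fin N → ℝ) → ℝ,
      IsObservable V x₁ ∧ IsObservable V x₂ ∧ ∀ z ∈ V, poissonBracket J x₁ x₂ z = 1 := by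
  obtain ⟨O, t, m, y, hO, hz₀O, hOU, hts, -, htX, -, -, -⟩ :=
    -- Column l of J is the derivation A ↦ {A, z_l}. Its rectifying time t satisfies {t, z_l} = 1.
    exists_rectifying_functions (ι := Unit) (X := fun _ z i => J z i l) hU hz₀
      (fun _ => contDiffOn_pi.2 fun i => hJ.smooth i l) (fun _ _ _ _ => rfl)
      (by
        refine LinearIndependent.of_subsingleton () fun h => hkl ?_
        exact congrFun h k)
  refine ⟨O, hO, hz₀O, hOU, t (), fun z => z l, hts (), isObservable_coord l, fun z hz => ?_⟩
  have h1 := htX z hz () ()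
  rw [fderiv_eq_sum_pderivAt, if_pos rfl] at h1
  rw [poissonBracket_eq_matrixForm, gradAt_apply_coord, matrixForm]
  refine Eq.trans ?_ h1
  refine Finset.sum_congr rfl fun i _ => ?_
  simp [Pi.single_apply, gradAt]

variable {q : ℕ} {J : (Fin N → ℝ) → Matrix (Fin N) (Fin N) ℝ}
  {lam : (Fin N → ℝ) → (Fin (q + 1 + 2) → Fin N) → ℝ} {C : Fin (q + 1) → (Fin N → ℝ) → ℝ}

theorem IsDerivedFrom.matrixForm_eq_form (h : IsDerivedFrom U J lam C)
    (hN : IsNambuTensor (m := q + 2) U lam) {z : Fin N → ℝ} (hz : z ∈ U) (α β : Fin N → ℝ) :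
    matrixForm (J z) α β =
      hN.form hz (Matrix.vecCons α (Matrix.vecCons β fun k => gradAt (C k) z)) :=
  h.matrixForm_eq hz α β

/-- A Poisson matrix derived from a Nambu tensor has rank two, where it does not vanish. -/
theorem IsDerivedFrom.rank_eq_two (hU : IsOpen U) (hJ : IsPoissonMatrix U J)
    (hN : IsNambuTensor (m := q + 2) U lam) (h : IsDerivedFrom U J lam C) {z : Fin N → ℝ}
    (hz : z ∈ U) (h0 : (J z).rank ≠ 0) : (J z).rank = 2 := by
  obtain ⟨i, j, hij⟩ := exists_matrixForm_ne_zero h0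
  set α : Fin N → ℝ := (J z i j)⁻¹ • Pi.single i 1 with hα
  set β : Fin N → ℝ := Pi.single j 1 with hβ
  have hαβ : matrixForm (J z) α β = 1 := by
    rw [hα, matrixForm_eq_dotProduct, smul_dotProduct, ← matrixForm_eq_dotProduct,
      matrixForm_single, smul_eq_mul, inv_mul_cancel₀ hij]
  set ε : Fin (q + 3) → Fin N → ℝ :=
    Matrix.vecCons α (Matrix.vecCons β fun k => gradAt (C k) z) with hε
  have hε1 : hN.form hz ε = 1 := by rw [← hαβ, h.matrixForm_eq_form hN hz]
  have hQ := hN.nambuQuadratic hU hz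
  refine _root_.rank_eq_two (fun α β => hJ.matrixForm_swap hz α β)
    (α := α) (β := β) (by rw [hαβ]; exact one_ne_zero) fun v => ?_
  set c : Fin (q + 3) → ℝ := fun l => hN.form hz (Function.update ε l v) with hc
  refine ⟨c 0, c 1, ?_⟩
  have hw : ∀ k, hN.form hz (Function.update ε k (v - ∑ l, c l • ε l)) = 0 :=
    fun k => (hN.form hz).map_update_sub_sum hε1 v k
  have hC : ∀ k : Fin (q + 1), ∀ γ, matrixForm (J z) γ (ε k.succ.succ) = 0 := by
    intro k γ
    rw [h.matrixForm_eq_form hN hz]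
    exact AlternatingMap.map_eq_zero_of_eq _ _ (i := 1) (j := k.succ.succ) rfl
      (fun hk => by have := congrArg Fin.val hk; simp at this)
  -- Expand v in the family ε = (α, β, dC) up to a vector in the kernel of the Nambu form. J
  -- annihilates that vector and all dC_k, which leaves the α and β parts.
  have hdot : ∀ γ, γ ⬝ᵥ (J z).mulVec v = γ ⬝ᵥ (c 0 • (J z).mulVec α + c 1 • (J z).mulVec β) := by
    intro γ
    have h1 : matrixForm (J z) γ (v - ∑ l, c l • ε l) = 0 := by
      rw [h.matrixForm_eq_form hN hz]
      exact hQ.map_eq_zero hε1 hw (a := 1) rfl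
    have h2 : ∀ l : Fin (q + 1), c l.succ.succ * (γ ⬝ᵥ (J z).mulVec (ε l.succ.succ)) = 0 :=
      fun l => by rw [← matrixForm_eq_dotProduct, hC, mul_zero]
    rw [matrixForm_eq_dotProduct, Matrix.mulVec_sub, dotProduct_sub, sub_eq_zero,
      Matrix.mulVec_sum, dotProduct_sum, Fin.sum_univ_succ, Fin.sum_univ_succ] at h1
    simp only [Matrix.mulVec_smul, dotProduct_smul, smul_eq_mul] at h1
    rw [Finset.sum_eq_zero fun l _ => h2 l, add_zero] at h1
    rw [h1, dotProduct_add, dotProduct_smul, dotProduct_smul]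
    rfl
  exact dotProduct_eq _ _ fun γ => by rw [dotProduct_comm, hdot, dotProduct_comm]

/-- Conjugate functions and the Casimir invariants `C` can be completed to canonical coordinates in
which the Nambu tensor is the Levi-Civita tensor. -/
theorem IsDerivedFrom.exists_canonicalChart (hV : IsOpen V) (hVU : V ⊆ U)
    (hJ : IsPoissonMatrix U J) (hN : IsNambuTensor (m := q + 2) U lam)
    (hC : ∀ k, IsObservable U (C k)) (h : IsDerivedFrom U J lam C) {x₁ x₂ : (Fin N → ℝ) → ℝ}
    (hx₁ : IsObservable V x₁) (hx₂ : IsObservable V x₂)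
    (hx : ∀ z ∈ V, poissonBracket J x₁ x₂ z = 1) {z₀ : Fin N → ℝ} (hz₀ : z₀ ∈ V) :
    q + 3 ≤ N ∧ ∃ e : OpenPartialHomeomorph (Fin N → ℝ) (Fin N → ℝ),
      z₀ ∈ e.source ∧ e.source ⊆ V ∧ IsCanonicalChart U J C e ∧
      (∀ i : Fin N, i.val = 0 → ∀ z, e z i = x₁ z) ∧
      (∀ i : Fin N, i.val = 1 → ∀ z, e z i = x₂ z) ∧
      ∀ x ∈ e.target, ∀ i, transformedNambu e lam x i = leviCivita N (q + 1 + 2) i := by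
  have hNV := hN.mono hV hVU
  have hgcons : ∀ z, (fun k => gradAt (Matrix.vecCons x₁ (Matrix.vecCons x₂ C) k) z) =
      Matrix.vecCons (gradAt x₁ z) (Matrix.vecCons (gradAt x₂ z) fun k => gradAt (C k) z) :=
    fun z => by rw [gradAt_vecCons, gradAt_vecCons]
  obtain ⟨hqN, e, he0, heV, hes, hesymm, hex, heker⟩ := hNV.exists_chart hV
    (x := Matrix.vecCons x₁ (Matrix.vecCons x₂ C))
    (IsObservable.vecCons hx₁ (IsObservable.vecCons hx₂ fun k => (hC k).mono hVU))
    (fun z hz => by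
      rw [nambuBracket_eq_tensorForm, hgcons, ← h.matrixForm_eq (hVU hz)]
      exact hx z hz) hz₀
  have hx1 : ∀ i : Fin N, i.val = 0 → ∀ z, e z i = x₁ z := fun i hi => hex 0 i hi
  have hx2 : ∀ i : Fin N, i.val = 1 → ∀ z, e z i = x₂ z := fun i hi => hex 1 i hi
  have hxC : ∀ (k : Fin (q + 1)) (i : Fin N), i.val = k.val + 2 → ∀ z, e z i = C k z :=
    fun k i hi => hex k.succ.succ i hi
  -- The coordinates C_k are Casimirs because they appear twice in the form; the remaining ones have
  -- gradients in its kernel.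
  have hcas : ∀ i : Fin N, 2 ≤ i.val → ∀ z ∈ e.source, ∀ α,
      matrixForm (J z) α (gradAt (fun z => e z i) z) = 0 := by
    intro i hi z hz α
    rw [h.matrixForm_eq_form hN (hVU (heV hz))]
    by_cases hi' : i.val < q + 3
    · have h1 : (fun z => e z i) = C ⟨i.val - 2, by omega⟩ :=
        funext fun z => hxC ⟨i.val - 2, by omega⟩ i (by simp; omega) z
      rw [h1]
      refine AlternatingMap.map_eq_zero_of_eq _ _ (i := 1)
        (j := Fin.succ (Fin.succ ⟨i.val - 2, by omega⟩)) rfl (fun hk => ?_)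
      simp [Fin.ext_iff] at hk
    · exact heker z (heV hz) hz i (by omega) _ 1 rfl
  refine ⟨hqN, e, he0, heV, ⟨heV.trans hVU, hes, hesymm, fun i hi A _ z hz => hcas i hi z hz _,
    fun k i hi z _ => hxC k i hi z, ?_⟩, hx1, hx2, ?_⟩
  · intro x hxt
    have hz := e.map_target hxt
    set z := e.symm x with hzdef
    have hzU := hVU (heV hz)
    ext i j
    rw [transformedPoisson, canonicalPoisson, Matrix.of_apply, Matrix.of_apply,
      poissonBracket_eq_matrixForm, ← hzdef]
    have hx' := hx z (heV hz)
    rw [poissonBracket_eq_matrixForm] at hx'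
    have hf1 : ∀ i : Fin N, i.val = 0 → (fun z => e z i) = x₁ := fun i hi => funext (hx1 i hi)
    have hf2 : ∀ i : Fin N, i.val = 1 → (fun z => e z i) = x₂ := fun i hi => funext (hx2 i hi)
    by_cases hj : 2 ≤ j.val
    · rw [hcas j hj z hz, if_neg (by omega), if_neg (by omega)]
    by_cases hi : 2 ≤ i.val
    · rw [hJ.matrixForm_swap hzU, hcas i hi z hz, if_neg (by omega), if_neg (by omega), neg_zero]
    obtain hi0 | hi1 : i.val = 0 ∨ i.val = 1 := by omega
    · obtain hj0 | hj1 : j.val = 0 ∨ j.val = 1 := by omega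
      · rw [hf1 i hi0, hf1 j hj0, hJ.matrixForm_self hzU, if_neg (by omega), if_neg (by omega)]
      · rw [hf1 i hi0, hf2 j hj1, hx', if_pos ⟨hi0, hj1⟩]
    · obtain hj0 | hj1 : j.val = 0 ∨ j.val = 1 := by omega
      · rw [hf2 i hi1, hf1 j hj0, hJ.matrixForm_swap hzU, hx', if_neg (by omega),
          if_pos ⟨hi1, hj0⟩]
      · rw [hf2 i hi1, hf2 j hj1, hJ.matrixForm_self hzU, if_neg (by omega), if_neg (by omega)]
  · intro x hxt i
    have hz := e.map_target hxt
    rw [transformedNambu]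
    set z := e.symm x with hzdef
    rw [hNV.bracket_eq_form (heV hz)]
    by_cases hi : ∃ k, q + 3 ≤ (i k).val
    · rw [leviCivita_eq_zero hi]
      obtain ⟨k, hk⟩ := hi
      exact heker z (heV hz) hz (i k) hk _ k rfl
    · push Not at hi
      rw [AlternatingMap.map_comp_eq_leviCivita (hNV.form (heV hz))
        (fun i => gradAt (fun z => e z i) z) hqN i hi]
      have h1 : (fun k : Fin (q + 3) => gradAt (fun z => e z (Fin.castLE hqN k)) z) =
          Matrix.vecCons (gradAt x₁ z)
            (Matrix.vecCons (gradAt x₂ z) fun k => gradAt (C k) z) := by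
        rw [← hgcons]
        funext k
        congr 1
        exact funext fun z => hex k (Fin.castLE hqN k) rfl z
      have h2 := hx z (heV hz)
      rw [poissonBracket_eq_matrixForm, h.matrixForm_eq (hVU (heV hz))] at h2
      have h3 : hNV.form (heV hz) (Matrix.vecCons (gradAt x₁ z)
            (Matrix.vecCons (gradAt x₂ z) fun k => gradAt (C k) z)) = 1 := h2
      rw [h1, h3, mul_one]

/-- In canonical coordinates, the Nambu tensor agrees with the Levi-Civita tensor on the first
indices. -/
theorem IsCanonicalChart.transformedNambu_eq (hqN : q + 3 ≤ N)
    (hN : IsNambuTensor (m := q + 2) U lam) (h : IsDerivedFrom U J lam C)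
    {e : OpenPartialHomeomorph (Fin N → ℝ) (Fin N → ℝ)} (he : IsCanonicalChart U J C e)
    {x : Fin N → ℝ} (hx : x ∈ e.target) (i : Fin (q + 1 + 2) → Fin N)
    (hi : ∀ k, (i k).val < q + 1 + 2) :
    transformedNambu e lam x i = leviCivita N (q + 1 + 2) i := by
  have hz := e.map_target hx
  have hP := congrFun (congrFun (he.poisson_eq x hx) ⟨0, by omega⟩) ⟨1, by omega⟩
  rw [transformedPoisson, canonicalPoisson, Matrix.of_apply, Matrix.of_apply,
    if_pos ⟨rfl, rfl⟩] at hP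
  rw [transformedNambu]
  set z := e.symm x with hzdef
  have hzU := he.source_subset hz
  rw [poissonBracket_eq_matrixForm, h.matrixForm_eq_form hN hzU] at hP
  rw [hN.bracket_eq_form hzU, AlternatingMap.map_comp_eq_leviCivita (hN.form hzU)
    (fun i => gradAt (fun z => e z i) z) hqN i hi]
  -- The normalising component is the Nambu bracket of x₁, x₂, C₁, …, C_κ, which is the canonical
  -- Poisson entry {x₁, x₂} = 1.
  refine (congrArg _ ?_).trans (mul_one _)
  rw [← hP]
  congr 1
  funext k
  refine Fin.cases rfl (fun k => Fin.cases rfl (fun k => ?_) k) k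
  refine gradAt_congr ?_
  filter_upwards [e.open_source.mem_nhds hz] with y hy
  exact he.casimir_eq k _ rfl y hy

end Darboux

/-! ### Derivatives of determinants -/

section Determinant

open scoped Matrix

variable {n : ℕ}

/-- The determinant as a continuous alternating map of the rows. -/
noncomputable def detRows : (Fin n → ℝ) [⋀^Fin n]→L[ℝ] ℝ :=
  { Matrix.detRowAlternating with cont := Continuous.matrix_det continuous_id }

theorem detRows_apply (R : Fin n → Fin n → ℝ) : detRows R = (Matrix.of R).det := rfl

/-- By Cramer's rule each summand is a diagonal entry of adj(Rᵀ) M Rᵀ; cyclicity of the trace brings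
Rᵀ next to its adjugate. This turns the error terms of the fundamental identity into a divergence.
-/
theorem sum_det_update_mulVec (R : Fin n → Fin n → ℝ) (M : Matrix (Fin n) (Fin n) ℝ) :
    ∑ k, detRows (Function.update R k (M.mulVec (R k))) = M.trace * detRows R := by
  have h1 : ∀ k, detRows (Function.update R k (M.mulVec (R k))) =
      ((Matrix.of R)ᵀ.adjugate * (M * (Matrix.of R)ᵀ)) k k := by
    intro k
    have h2 := Matrix.cramer_transpose_apply (Matrix.of R) (M.mulVec (R k)) k
    rw [Matrix.cramer_eq_adjugate_mulVec] at h2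
    exact h2.symm
  have h3 : ∑ k, detRows (Function.update R k (M.mulVec (R k))) =
      ((Matrix.of R)ᵀ.adjugate * (M * (Matrix.of R)ᵀ)).trace :=
    Finset.sum_congr rfl fun k _ => h1 k
  rw [h3, Matrix.trace_mul_comm, Matrix.mul_assoc, Matrix.mul_adjugate, Matrix.det_transpose,
    Matrix.mul_smul, Matrix.mul_one, Matrix.trace_smul, smul_eq_mul, mul_comm, detRows_apply]

theorem fderiv_detRows {E : Type*} [NormedAddCommGroup E] [NormedSpace ℝ E]
    {R : E → Fin n → Fin n → ℝ} {z : E} (hR : ∀ a b, DifferentiableAt ℝ (fun y => R y a b) z)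
    (v : E) : fderiv ℝ (fun y => detRows (R y)) z v =
      ∑ a, detRows (Function.update (R z) a fun b => fderiv ℝ (fun y => R y a b) z v) := by
  have hd : HasFDerivAt R (ContinuousLinearMap.pi fun a => ContinuousLinearMap.pi fun b =>
      fderiv ℝ (fun y => R y a b) z) z :=
    hasFDerivAt_pi.2 fun a => hasFDerivAt_pi.2 fun b => (hR a b).hasFDerivAt
  have h1 : HasFDerivAt (fun y => detRows (R y)) _ z :=
    (detRows.hasFDerivAt (R z)).comp z hd
  rw [h1.fderiv]
  rw [ContinuousLinearMap.comp_apply, ContinuousMultilinearMap.linearDeriv_apply]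
  rfl

end Determinant

/-! ### Exterior products of commuting fields -/

section Jacobian

variable {N m : ℕ} {V : Set (Fin N → ℝ)}

/-- The tensor of the exterior product of vector fields. -/
noncomputable def wedgeTensor {n : ℕ} (D : Fin n → (Fin N → ℝ) → (Fin N → ℝ)) (z : Fin N → ℝ)
    (i : Fin n → Fin N) : ℝ :=
  detRows fun a b => D b z (i a)

theorem tensorForm_wedgeTensor {n : ℕ} (D : Fin n → (Fin N → ℝ) → (Fin N → ℝ)) (z : Fin N → ℝ) :
    tensorForm (wedgeTensor D z) = (detRows.toAlternatingMap.compLinearMap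
      (Matrix.of fun b => D b z).mulVecLin).toMultilinearMap := by
  refine Module.Basis.ext_multilinear (fun _ => Pi.basisFun ℝ (Fin N)) fun i => ?_
  simp only [Pi.basisFun_apply]
  rw [tensorForm_single]
  change _ = detRows fun a => (Matrix.of fun b => D b z).mulVecLin (Pi.single (i a) 1)
  rw [wedgeTensor]
  congr 1
  funext a b
  simp

/-- The derivative of `A` along the vector field `X`. -/
noncomputable def along (X : (Fin N → ℝ) → (Fin N → ℝ)) (A : (Fin N → ℝ) → ℝ) :
    (Fin N → ℝ) → ℝ := fun z => fderiv ℝ A z (X z)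

theorem IsObservable.along {X : (Fin N → ℝ) → (Fin N → ℝ)} {A : (Fin N → ℝ) → ℝ} (hV : IsOpen V)
    (hA : IsObservable V A) (hX : ContDiffOn ℝ ∞ X V) : IsObservable V (along X A) :=
  (hA.fderiv_of_isOpen hV (by simp)).clm_apply hX

theorem nambuBracket_wedgeTensor {n : ℕ} (D : Fin n → (Fin N → ℝ) → (Fin N → ℝ))
    (A : Fin n → (Fin N → ℝ) → ℝ) (z : Fin N → ℝ) :
    nambuBracket (wedgeTensor D) A z = detRows fun a b => along (D b) (A a) z := by
  rw [nambuBracket_eq_tensorForm, tensorForm_wedgeTensor]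
  change detRows (fun a => (Matrix.of fun b => D b z).mulVecLin (gradAt (A a) z)) = _
  congr 1
  funext a b
  exact (fderiv_eq_sum_pderivAt (A a) z (D b z)).symm

theorem isObservable_detRows {n : ℕ} {R : Fin n → Fin n → (Fin N → ℝ) → ℝ}
    (hR : ∀ a b, IsObservable V (R a b)) : IsObservable V fun z => detRows fun a b => R a b z := by
  have h : (fun z => detRows fun a b => R a b z) = fun z =>
      ∑ σ : Equiv.Perm (Fin n), ((Equiv.Perm.sign σ : ℤ) : ℝ) * ∏ i, R (σ i) i z := by
    funext z
    rw [detRows_apply, Matrix.det_apply']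
    rfl
  rw [h]
  exact ContDiffOn.sum fun σ _ => contDiffOn_const.mul (contDiffOn_prod fun i _ => hR _ _)

/-- The cofactors of a family of covectors form a divergence-free vector field. -/
theorem sum_along_detRows_single (hV : IsOpen V) {D : Fin (m + 1) → (Fin N → ℝ) → (Fin N → ℝ)}
    (hD : ∀ b, ContDiffOn ℝ ∞ (D b) V)
    (hcomm : ∀ A, IsObservable V A → ∀ z ∈ V, ∀ b c,
      along (D b) (along (D c) A) z = along (D c) (along (D b) A) z)
    {E : Fin m → (Fin N → ℝ) → ℝ} (hE : ∀ k, IsObservable V (E k)) {z : Fin N → ℝ} (hz : z ∈ V) :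
    ∑ b, along (D b) (fun z => detRows (Matrix.vecCons (Pi.single b 1)
      fun r b' => along (D b') (E r) z)) z = 0 := by
  set R : Fin m → Fin (m + 1) → ℝ := fun r b' => along (D b') (E r) z with hR
  set H : Fin m → Fin (m + 1) → Fin (m + 1) → ℝ := fun r b b' =>
    along (D b) (along (D b') (E r)) z with hH
  -- The divergence becomes ∑ H·T, where H is symmetric in b, b' because the fields commute, and T
  -- is antisymmetric because exchanging b and b' swaps two rows.
  set T : Fin m → Fin (m + 1) → Fin (m + 1) → ℝ := fun r b b' =>
    detRows (Function.update (Matrix.vecCons (Pi.single b 1) R) r.succ (Pi.single b' 1)) with hT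
  have h1 : ∀ b, along (D b) (fun z => detRows (Matrix.vecCons (Pi.single b 1)
      fun r b' => along (D b') (E r) z)) z = ∑ r, ∑ b', H r b b' * T r b b' := by
    intro b
    have hdiff : ∀ a c, DifferentiableAt ℝ (fun y => (Matrix.vecCons (Pi.single b (1 : ℝ))
        fun r b' => along (D b') (E r) y : Fin (m + 1) → Fin (m + 1) → ℝ) a c) z := by
      intro a c
      refine Fin.cases ?_ (fun r => ?_) a
      · exact differentiableAt_const _
      · exact ((hE r).along hV (hD c)).differentiableAt hV hz
    rw [along, fderiv_detRows hdiff, Fin.sum_univ_succ]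
    have h0 : detRows (Function.update (Matrix.vecCons (Pi.single b 1) R) 0
        fun c => fderiv ℝ (fun y => (Matrix.vecCons (Pi.single b (1 : ℝ))
        fun r b' => along (D b') (E r) y : Fin (m + 1) → Fin (m + 1) → ℝ) 0 c) z (D b z)) = 0 := by
      refine detRows.toAlternatingMap.map_coord_zero 0 ?_
      rw [Function.update_self]
      funext c
      have : (fun y => (Matrix.vecCons (Pi.single b (1 : ℝ))
        fun r b' => along (D b') (E r) y : Fin (m + 1) → Fin (m + 1) → ℝ) 0 c) =
          fun _ => (Pi.single b (1 : ℝ) : Fin (m + 1) → ℝ) c := rfl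
      rw [this]
      simp
    rw [h0, zero_add]
    refine Finset.sum_congr rfl fun r _ => ?_
    have hrow : (fun c => fderiv ℝ (fun y => (Matrix.vecCons (Pi.single b (1 : ℝ))
        fun r b' => along (D b') (E r) y : Fin (m + 1) → Fin (m + 1) → ℝ) r.succ c) z (D b z)) =
        ∑ b', H r b b' • Pi.single b' (1 : ℝ) := pi_eq_sum_univ' _
    rw [hrow]
    exact (detRows.toAlternatingMap.map_update_sum _ _ _ _).trans
      (Finset.sum_congr rfl fun b' _ => detRows.toAlternatingMap.map_update_smul _ _ _ _)
  have hTanti : ∀ r b b', T r b' b = -T r b b' := by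
    intro r b b'
    have h2 := detRows.toAlternatingMap.map_swap
      (Function.update (Matrix.vecCons (Pi.single b 1) R) r.succ (Pi.single b' 1))
      (i := 0) (j := r.succ) (Fin.succ_ne_zero r).symm
    refine Eq.trans ?_ h2
    change detRows _ = detRows _
    congr 1
    funext k
    rcases eq_or_ne k r.succ with rfl | hk
    · simp [Function.update_of_ne (Fin.succ_ne_zero r).symm]
    · refine Fin.cases ?_ (fun k hk => ?_) k hk
      · intro h; simp [Function.update_of_ne h]
      · simp [Function.update_of_ne hk, Equiv.swap_apply_of_ne_of_ne (Fin.succ_ne_zero k) hk]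
  have hHsymm : ∀ r b b', H r b' b = H r b b' := fun r b b' => hcomm (E r) (hE r) z hz b' b
  simp only [h1]
  rw [Finset.sum_comm]
  refine Finset.sum_eq_zero fun r _ => ?_
  have h3 : ∑ b, ∑ b', H r b b' * T r b b' = -∑ b, ∑ b', H r b b' * T r b b' := by
    conv_lhs => rw [Finset.sum_comm]
    rw [← Finset.sum_neg_distrib]
    refine Finset.sum_congr rfl fun b _ => ?_
    rw [← Finset.sum_neg_distrib]
    refine Finset.sum_congr rfl fun b' _ => ?_
    rw [hTanti, hHsymm]; ring
  linarith

/-- The exterior product of commuting vector fields is a Nambu tensor. -/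
theorem isNambuTensor_wedgeTensor (hV : IsOpen V)
    {D : Fin (m + 1) → (Fin N → ℝ) → (Fin N → ℝ)} (hD : ∀ b, ContDiffOn ℝ ∞ (D b) V)
    (hcomm : ∀ A, IsObservable V A → ∀ z ∈ V, ∀ b c,
      along (D b) (along (D c) A) z = along (D c) (along (D b) A) z) :
    IsNambuTensor V (wedgeTensor D) where
  smooth i := isObservable_detRows fun a b => contDiffOn_pi.1 (hD b) (i a)
  antisymm z hz i σ := by
    have h := detRows.toAlternatingMap.map_perm (fun a b => D b z (i a)) σ
    rw [Units.smul_def, zsmul_eq_mul] at h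
    exact h
  fundamental A E hA hE z hz := by
    -- Expanding along the first row gives {F, E} = ∑ c_b D_b F, so bracketing with E is the vector
    -- field with these cofactors as coefficients.
    set c : Fin (m + 1) → (Fin N → ℝ) → ℝ := fun b z => detRows (Matrix.vecCons (Pi.single b 1)
      fun r b' => along (D b') (E r) z) with hc
    have hcs : ∀ b, IsObservable V (c b) := by
      intro b
      refine isObservable_detRows (R := fun a b' z => (Matrix.vecCons (Pi.single b (1 : ℝ))
        fun r b' => along (D b') (E r) z : Fin (m + 1) → Fin (m + 1) → ℝ) a b') fun a b' => ?_
      refine Fin.cases ?_ (fun r => ?_) a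
      · exact contDiffOn_const
      · exact (hE r).along hV (hD b')
    have hexp : ∀ (F : (Fin N → ℝ) → ℝ) (y : Fin N → ℝ),
        nambuBracket (wedgeTensor D) (Matrix.vecCons F E) y = ∑ b, along (D b) F y * c b y := by
      intro F y
      have hrow : (fun b => along (D b) F y) = ∑ b, along (D b) F y • Pi.single b (1 : ℝ) :=
        pi_eq_sum_univ' _
      have hcons : (fun a b => along (D b) (Matrix.vecCons F E a) y) =
          Matrix.vecCons (fun b => along (D b) F y) fun r b' => along (D b') (E r) y := by
        funext a
        refine Fin.cases ?_ (fun a => ?_) a <;> rfl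
      rw [nambuBracket_wedgeTensor, hcons, ← update_vecCons_zero (0 : Fin (m + 1) → ℝ), hrow]
      refine (detRows.toAlternatingMap.map_update_sum _ _ _ _).trans
        (Finset.sum_congr rfl fun b _ => ?_)
      refine (detRows.toAlternatingMap.map_update_smul _ _ _ _).trans ?_
      rw [update_vecCons_zero]
      rfl
    set R : Fin (m + 1) → Fin (m + 1) → ℝ := fun a b => along (D b) (A a) z with hR
    have hAA : ∀ a b, IsObservable V (along (D b) (A a)) := fun a b => (hA a).along hV (hD b)
    have hlhs : ∀ b, along (D b) (nambuBracket (wedgeTensor D) A) z =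
        ∑ a, detRows (Function.update R a fun b' => along (D b) (along (D b') (A a)) z) := by
      intro b
      have h1 : nambuBracket (wedgeTensor D) A =
          fun y => detRows fun a b => along (D b) (A a) y :=
        funext fun y => nambuBracket_wedgeTensor D A y
      rw [along, h1, fderiv_detRows fun a b => (hAA a b).differentiableAt hV hz]
      rfl
    set M : Matrix (Fin (m + 1)) (Fin (m + 1)) ℝ := Matrix.of fun b' b => along (D b') (c b) z
      with hM
    -- Differentiating ∑ c_b D_b A_k yields the terms of the left side and terms with derivatives of
    -- c. Summed over k, the latter are tr M times the determinant, and tr M = ∑ D_b c_b is the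
    -- vanishing divergence.
    have hrhs : ∀ k, nambuBracket (wedgeTensor D) (Function.update A k
          (nambuBracket (wedgeTensor D) (Matrix.vecCons (A k) E))) z =
        ∑ b, c b z * detRows (Function.update R k
          fun b' => along (D b) (along (D b') (A k)) z) +
        detRows (Function.update R k (M.mulVec (R k))) := by
      intro k
      have h1 : nambuBracket (wedgeTensor D) (Matrix.vecCons (A k) E) =
          fun y => ∑ b, along (D b) (A k) y * c b y := funext (hexp (A k))
      have h2 : ∀ b', along (D b') (fun y => ∑ b, along (D b) (A k) y * c b y) z =
          ∑ b, c b z * along (D b) (along (D b') (A k)) z + M.mulVec (R k) b' := by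
        intro b'
        rw [along, fderiv_fun_sum fun b _ => ((hAA k b).differentiableAt hV hz).fun_mul
          ((hcs b).differentiableAt hV hz), _root_.sum_apply, Matrix.mulVec, dotProduct,
          ← Finset.sum_add_distrib]
        refine Finset.sum_congr rfl fun b _ => ?_
        rw [fderiv_fun_mul ((hAA k b).differentiableAt hV hz) ((hcs b).differentiableAt hV hz),
          hcomm (A k) (hA k) z hz b b']
        simp only [_root_.add_apply, _root_.smul_apply, smul_eq_mul, hM, hR,
          Matrix.of_apply]
        rw [add_comm, mul_comm (along (D b) (A k) z)]
        rfl
      have h3 : (fun a b' => along (D b') (Function.update A k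
          (nambuBracket (wedgeTensor D) (Matrix.vecCons (A k) E)) a) z) =
          Function.update R k (∑ b, c b z • (fun b' => along (D b) (along (D b') (A k)) z) +
            M.mulVec (R k)) := by
        funext a
        by_cases ha : a = k
        · subst ha
          funext b'
          rw [Function.update_self, Function.update_self, h1, h2]
          simp
        · rw [Function.update_of_ne ha, Function.update_of_ne ha]
      rw [nambuBracket_wedgeTensor, h3]
      refine (detRows.toAlternatingMap.map_update_add _ _ _ _).trans ?_
      congr 1
      exact (detRows.toAlternatingMap.map_update_sum _ _ _ _).trans
        (Finset.sum_congr rfl fun b _ => detRows.toAlternatingMap.map_update_smul _ _ _ _)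
    have htr : M.trace = 0 := sum_along_detRows_single hV hD hcomm hE hz
    rw [hexp]
    simp only [hrhs, hlhs]
    rw [Finset.sum_add_distrib, sum_det_update_mulVec, htr, zero_mul, add_zero, Finset.sum_comm]
    refine Finset.sum_congr rfl fun b _ => ?_
    rw [Finset.sum_mul]
    exact Finset.sum_congr rfl fun a _ => mul_comm _ _

end Jacobian

/-! ### Coordinate vector fields of a chart -/

section CoordinateFrame

variable {N : ℕ} {e : OpenPartialHomeomorph (Fin N → ℝ) (Fin N → ℝ)}

/-- The coordinate vector fields of a chart. -/
noncomputable def coordinateField (e : OpenPartialHomeomorph (Fin N → ℝ) (Fin N → ℝ)) (i : Fin N)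
    (z : Fin N → ℝ) : Fin N → ℝ :=
  fderiv ℝ e.symm (e z) (Pi.single i 1)

theorem contDiffOn_coordinateField (he : ContDiffOn ℝ ∞ e e.source)
    (hes : ContDiffOn ℝ ∞ e.symm e.target) (i : Fin N) :
    ContDiffOn ℝ ∞ (coordinateField e i) e.source :=
  ((hes.fderiv_of_isOpen e.open_target (m := ∞) (by simp)).comp he e.mapsTo).clm_apply
    contDiffOn_const

theorem fderiv_chart_fderiv_symm (he : ContDiffOn ℝ ∞ e e.source)
    (hes : ContDiffOn ℝ ∞ e.symm e.target) {z : Fin N → ℝ} (hz : z ∈ e.source)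
    (v : Fin N → ℝ) : fderiv ℝ e z (fderiv ℝ e.symm (e z) v) = v ∧
      fderiv ℝ e.symm (e z) (fderiv ℝ e z v) = v := by
  have hx := e.map_source hz
  have h1 : HasFDerivAt e (fderiv ℝ e z) z :=
    ((he.contDiffAt (e.open_source.mem_nhds hz)).differentiableAt (by simp)).hasFDerivAt
  have h2 : HasFDerivAt e.symm (fderiv ℝ e.symm (e z)) (e z) :=
    ((hes.contDiffAt (e.open_target.mem_nhds hx)).differentiableAt (by simp)).hasFDerivAt
  constructor
  · have h1' : HasFDerivAt e (fderiv ℝ e z) (e.symm (e z)) := by rwa [e.left_inv hz]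
    have h3 : HasFDerivAt (e ∘ e.symm) (ContinuousLinearMap.id ℝ _) (e z) := by
      refine (hasFDerivAt_id _).congr_of_eventuallyEq ?_
      filter_upwards [e.open_target.mem_nhds hx] with y hy using e.right_inv hy
    exact congrArg (fun T => T v) ((h1'.comp _ h2).unique h3)
  · have h3 : HasFDerivAt (e.symm ∘ e) (ContinuousLinearMap.id ℝ _) z := by
      refine (hasFDerivAt_id _).congr_of_eventuallyEq ?_
      filter_upwards [e.open_source.mem_nhds hz] with y hy using e.left_inv hy
    exact congrArg (fun T => T v) ((h2.comp _ h1).unique h3)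

theorem fderiv_chart_apply (he : ContDiffOn ℝ ∞ e e.source) {z : Fin N → ℝ} (hz : z ∈ e.source)
    (v : Fin N → ℝ) (i : Fin N) : fderiv ℝ (fun z => e z i) z v = fderiv ℝ e z v i := by
  rw [fderiv_apply ((he.contDiffAt (e.open_source.mem_nhds hz)).differentiableAt (by simp))]
  rfl

theorem along_coordinateField_coord (he : ContDiffOn ℝ ∞ e e.source)
    (hes : ContDiffOn ℝ ∞ e.symm e.target) {z : Fin N → ℝ} (hz : z ∈ e.source) (i j : Fin N) :
    along (coordinateField e i) (fun z => e z j) z = if j = i then 1 else 0 := by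
  rw [along, fderiv_chart_apply he hz, coordinateField, (fderiv_chart_fderiv_symm he hes hz _).1,
    Pi.single_apply]

theorem eq_sum_coordinateField (he : ContDiffOn ℝ ∞ e e.source)
    (hes : ContDiffOn ℝ ∞ e.symm e.target) {z : Fin N → ℝ} (hz : z ∈ e.source)
    (w : Fin N → ℝ) : w = ∑ i, (gradAt (fun z => e z i) z ⬝ᵥ w) • coordinateField e i z := by
  conv_lhs => rw [← (fderiv_chart_fderiv_symm he hes hz w).2, pi_eq_sum_univ' (fderiv ℝ e z w)]
  rw [map_sum]
  refine Finset.sum_congr rfl fun i _ => ?_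
  rw [map_smul, ← fderiv_chart_apply he hz, fderiv_eq_sum_pderivAt, dotProduct_comm]
  rfl

/-- Coordinate vector fields commute. -/
theorem along_coordinateField_comm (he : ContDiffOn ℝ ∞ e e.source)
    (hes : ContDiffOn ℝ ∞ e.symm e.target) {A : (Fin N → ℝ) → ℝ} (hA : IsObservable e.source A)
    {z : Fin N → ℝ} (hz : z ∈ e.source) (i j : Fin N) :
    along (coordinateField e i) (along (coordinateField e j) A) z =
      along (coordinateField e j) (along (coordinateField e i) A) z := by
  have hx := e.map_source hz
  have hB : ContDiffOn ℝ ∞ (A ∘ e.symm) e.target := ContDiffOn.comp hA hes e.mapsTo_symm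
  have hBx : ContDiffAt ℝ ∞ (A ∘ e.symm) (e z) := hB.contDiffAt (e.open_target.mem_nhds hx)
  have h1 : ∀ (j : Fin N), ∀ y ∈ e.source, along (coordinateField e j) A y =
      fderiv ℝ (A ∘ e.symm) (e y) (Pi.single j 1) := by
    intro j y hy
    have hd : DifferentiableAt ℝ e.symm (e y) :=
      (hes.contDiffAt (e.open_target.mem_nhds (e.map_source hy))).differentiableAt (by simp)
    have hAd : DifferentiableAt ℝ A (e.symm (e y)) := by
      rw [e.left_inv hy]; exact hA.differentiableAt e.open_source hy
    rw [fderiv_comp _ hAd hd, e.left_inv hy]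
    rfl
  -- In the chart the iterated derivative is a second partial derivative of A ∘ e⁻¹, hence
  -- symmetric.
  have h2 : ∀ i j : Fin N, along (coordinateField e i) (along (coordinateField e j) A) z =
      fderiv ℝ (fderiv ℝ (A ∘ e.symm)) (e z) (Pi.single i 1) (Pi.single j 1) := by
    intro i j
    have h3 : along (coordinateField e j) A =ᶠ[𝓝 z]
        fun y => fderiv ℝ (A ∘ e.symm) (e y) (Pi.single j 1) := by
      filter_upwards [e.open_source.mem_nhds hz] with y hy using h1 j y hy
    have h4 : DifferentiableAt ℝ (fderiv ℝ (A ∘ e.symm)) (e z) :=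
      (hBx.fderiv_right (m := ∞) (by simp)).differentiableAt (by simp)
    have h5 : HasFDerivAt e (fderiv ℝ e z) z :=
      ((he.contDiffAt (e.open_source.mem_nhds hz)).differentiableAt (by simp)).hasFDerivAt
    have h6 : HasFDerivAt (fun y => fderiv ℝ (A ∘ e.symm) (e y) (Pi.single j 1)) _ z :=
      (h4.hasFDerivAt.comp z h5).clm_apply (hasFDerivAt_const (Pi.single j 1 : Fin N → ℝ) z)
    rw [along, h3.fderiv_eq, h6.fderiv]
    simp [coordinateField, (fderiv_chart_fderiv_symm he hes hz _).1]
  rw [h2, h2]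
  exact (hBx.isSymmSndFDerivAt (by simpa using ENat.LEInfty.out)).eq _ _

end CoordinateFrame

/-! ### Rank-two Darboux charts and the converse -/

section Sufficiency

/-- The trailing arguments already use every basis vector except the first two, so only the
components of a and b along those contribute. -/
theorem AlternatingMap.map_vecCons_vecCons_single {p : ℕ}
    (Λ : (Fin (p + 2) → ℝ) [⋀^Fin (p + 2)]→ₗ[ℝ] ℝ)
    (hΛ : Λ (fun k => Pi.single k 1) = 1) (a b : Fin (p + 2) → ℝ) :
    Λ (Matrix.vecCons a (Matrix.vecCons b fun k : Fin p => Pi.single k.succ.succ 1)) =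
      a 0 * b 1 - a 1 * b 0 := by
  have hne : ∀ k : Fin p, (1 : Fin (p + 2)) ≠ k.succ.succ := fun k h => by
    have := congrArg Fin.val h
    simp at this
  set S : Fin p → Fin (p + 2) → ℝ := fun k => Pi.single k.succ.succ 1 with hS
  have hbasis : (fun k : Fin (p + 2) => (Pi.single k 1 : Fin (p + 2) → ℝ)) =
      Matrix.vecCons (Pi.single 0 1) (Matrix.vecCons (Pi.single 1 1) S) := by
    funext k
    refine Fin.cases rfl (fun k => Fin.cases rfl (fun k => rfl) k) k
  have h01 : Λ (Matrix.vecCons (Pi.single 0 1) (Matrix.vecCons (Pi.single 1 1) S)) = 1 := by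
    rw [← hbasis, hΛ]
  have h10 : Λ (Matrix.vecCons (Pi.single 1 1) (Matrix.vecCons (Pi.single 0 1) S)) = -1 := by
    have h := Λ.map_swap (Matrix.vecCons (Pi.single 0 1) (Matrix.vecCons (Pi.single 1 1) S))
      (i := 0) (j := 1) (by simp)
    rw [h01] at h
    rw [← h]
    congr 1
    funext k
    refine Fin.cases rfl (fun k => Fin.cases rfl (fun k => ?_) k) k
    have hk : Equiv.swap (0 : Fin (p + 2)) 1 k.succ.succ = k.succ.succ :=
      Equiv.swap_apply_of_ne_of_ne (Fin.succ_ne_zero _) (hne k).symm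
    rw [Function.comp, hk]
    rfl
  have hfirst : ∀ b, Λ (Matrix.vecCons a (Matrix.vecCons b S)) =
      ∑ i, a i * Λ (Matrix.vecCons (Pi.single i 1) (Matrix.vecCons b S)) := by
    intro b
    conv_lhs => rw [pi_eq_sum_univ' a, ← update_vecCons_zero (0 : Fin (p + 2) → ℝ),
      Λ.map_update_sum]
    exact Finset.sum_congr rfl fun i _ => by
      rw [Λ.map_update_smul, update_vecCons_zero, smul_eq_mul]
  have hsecond : ∀ a, Λ (Matrix.vecCons a (Matrix.vecCons b S)) =
      ∑ i, b i * Λ (Matrix.vecCons a (Matrix.vecCons (Pi.single i 1) S)) := by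
    intro a
    conv_lhs => rw [pi_eq_sum_univ' b, ← update_vecCons_vecCons_one _ (0 : Fin (p + 2) → ℝ),
      Λ.map_update_sum]
    exact Finset.sum_congr rfl fun i _ => by
      rw [Λ.map_update_smul, update_vecCons_vecCons_one, smul_eq_mul]
  have hz1 : ∀ b (k : Fin p),
      Λ (Matrix.vecCons (Pi.single k.succ.succ 1) (Matrix.vecCons b S)) = 0 := fun b k =>
    Λ.map_eq_zero_of_eq _ (i := 0) (j := k.succ.succ) rfl (Fin.succ_ne_zero _).symm
  have hz2 : ∀ a (k : Fin p),
      Λ (Matrix.vecCons a (Matrix.vecCons (Pi.single k.succ.succ 1) S)) = 0 := fun a k =>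
    Λ.map_eq_zero_of_eq _ (i := 1) (j := k.succ.succ) rfl (hne k)
  have hd : ∀ c, Λ (Matrix.vecCons c (Matrix.vecCons c S)) = 0 := fun c =>
    Λ.map_eq_zero_of_eq _ (i := 0) (j := 1) rfl (by simp)
  have hsum : ∀ f : Fin (p + 2) → ℝ, (∀ k : Fin p, f k.succ.succ = 0) →
      ∑ i, f i = f 0 + f 1 := by
    intro f hf
    rw [Fin.sum_univ_succ, Fin.sum_univ_succ, Finset.sum_eq_zero fun k _ => hf k, add_zero]
    rfl
  rw [hfirst, hsum _ fun k => by rw [hz1, mul_zero], hsecond, hsecond,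
    hsum _ fun k => by rw [hz2, mul_zero], hsum _ fun k => by rw [hz2, mul_zero], hd, hd, h01, h10]
  ring

variable {K κ : ℕ} {U : Set (Fin (K + 2) → ℝ)}
  {J : (Fin (K + 2) → ℝ) → Matrix (Fin (K + 2)) (Fin (K + 2)) ℝ}

/-- A Poisson matrix of rank two has canonical coordinates near each point. -/
theorem IsPoissonMatrix.exists_darboux_chart (hU : IsOpen U) (hJ : IsPoissonMatrix U J)
    (hrank : ∀ z ∈ U, (J z).rank = 2) {z₀ : Fin (K + 2) → ℝ} (hz₀ : z₀ ∈ U) :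
    ∃ e : OpenPartialHomeomorph (Fin (K + 2) → ℝ) (Fin (K + 2) → ℝ), z₀ ∈ e.source ∧
      e.source ⊆ U ∧ ContDiffOn ℝ ∞ e e.source ∧ ContDiffOn ℝ ∞ e.symm e.target ∧
      (∀ z ∈ e.source, matrixForm (J z) (gradAt (fun z => e z 0) z)
        (gradAt (fun z => e z 1) z) = 1) ∧
      ∀ z ∈ e.source, ∀ (k : Fin K) v,
        matrixForm (J z) v (gradAt (fun z => e z k.succ.succ) z) = 0 := by
  obtain ⟨i, j, hij⟩ := exists_matrixForm_ne_zero (M := J z₀) (by rw [hrank z₀ hz₀]; simp)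
  obtain ⟨V, hV, hz₀V, hVU, x₁, x₂, hx₁, hx₂, hx⟩ := exists_conjugate_functions hU hJ hz₀ hij
  have hJV := hJ.mono hV hVU
  have hself : ∀ (A : (Fin (K + 2) → ℝ) → ℝ), ∀ z ∈ V, poissonBracket J A A z = 0 :=
    fun A z hz => hJV.matrixForm_self hz _
  have hswap : ∀ (A B : (Fin (K + 2) → ℝ) → ℝ), ∀ z ∈ V,
      poissonBracket J B A z = -poissonBracket J A B z :=
    fun A B z hz => hJV.matrixForm_swap hz _ _
  have hconst : ∀ {A : (Fin (K + 2) → ℝ) → ℝ} {c : ℝ} (B : (Fin (K + 2) → ℝ) → ℝ), ∀ z ∈ V,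
      (∀ y ∈ V, A y = c) → poissonBracket J A B z = 0 := by
    intro A c B z hz hA
    rw [poissonBracket_eq_matrixForm, gradAt_eq_zero_of_eventuallyEq_const (A := A) (c := c)]
    · simp [matrixForm]
    · filter_upwards [hV.mem_nhds hz] with y hy using hA y hy
  -- The fields are A ↦ {A, x₂} and A ↦ {x₁, A}; the slots are chosen so that they are dual to x₁,
  -- x₂ without signs.
  set Y : Fin 2 → (Fin (K + 2) → ℝ) → (Fin (K + 2) → ℝ) :=
    ![fun z l => poissonBracket J (fun z => z l) x₂ z,
      fun z l => poissonBracket J x₁ (fun z => z l) z] with hY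
  have hY0 : ∀ (A : (Fin (K + 2) → ℝ) → ℝ) z, fderiv ℝ A z (Y 0 z) = poissonBracket J A x₂ z := by
    intro A z
    rw [fderiv_eq_sum_pderivAt, poissonBracket]
    refine Finset.sum_congr rfl fun l _ => ?_
    change poissonBracket J (fun z => z l) x₂ z * pderivAt l A z = _
    rw [poissonBracket_eq_matrixForm, gradAt_apply_coord, matrixForm, Finset.sum_eq_single l]
    · rw [Finset.sum_mul]
      refine Finset.sum_congr rfl fun j _ => ?_
      simp only [Pi.single_eq_same, gradAt]
      ring
    · intro i _ hi
      simp [hi]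
    · simp
  have hY1 : ∀ (A : (Fin (K + 2) → ℝ) → ℝ) z, fderiv ℝ A z (Y 1 z) = poissonBracket J x₁ A z := by
    intro A z
    rw [fderiv_eq_sum_pderivAt, poissonBracket, Finset.sum_comm]
    refine Finset.sum_congr rfl fun l _ => ?_
    change poissonBracket J x₁ (fun z => z l) z * pderivAt l A z = _
    rw [poissonBracket_eq_matrixForm, gradAt_apply_coord, matrixForm, Finset.sum_mul]
    refine Finset.sum_congr rfl fun i _ => ?_
    rw [Finset.sum_eq_single l]
    · simp [gradAt]
    · intro i _ hi
      simp [hi]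
    · simp
  have hYs : ∀ i, ContDiffOn ℝ ∞ (Y i) V := by
    intro i
    fin_cases i
    · exact contDiffOn_pi.2 fun l =>
        IsObservable.poissonBracket hV hJV.smooth (isObservable_coord l) hx₂
    · exact contDiffOn_pi.2 fun l =>
        IsObservable.poissonBracket hV hJV.smooth hx₁ (isObservable_coord l)
  have hYd : ∀ i, ∀ z ∈ V, DifferentiableAt ℝ (Y i) z := fun i z hz =>
    ((hYs i).contDiffAt (hV.mem_nhds hz)).differentiableAt (by simp)
  have h01 : ∀ z ∈ V, fderiv ℝ (Y 0) z (Y 1 z) = fderiv ℝ (Y 1) z (Y 0 z) := by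
    intro z hz
    refine fderiv_comm_of_coord (hYd 0 z hz) (hYd 1 z hz) fun l => ?_
    rw [hY0, hY1]
    change poissonBracket J x₁ (poissonBracket J (fun z => z l) x₂) z =
      poissonBracket J (poissonBracket J x₁ fun z => z l) x₂ z
    -- The Jacobi term containing {x₂, x₁} = −1 drops out, and the two remaining terms express
    -- commutation.
    have hjac := hJV.jacobi x₁ (fun z => z l) x₂ hx₁ (isObservable_coord l) hx₂ z hz
    rw [hconst (A := poissonBracket J x₂ x₁) (c := -1) _ z hz
      (fun y hy => by rw [hswap x₁ x₂ y hy, hx y hy]), add_zero] at hjac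
    rw [hswap (poissonBracket J (fun z => z l) x₂) x₁ z hz]
    linarith
  have hcomm : ∀ z ∈ V, ∀ i j, fderiv ℝ (Y i) z (Y j z) = fderiv ℝ (Y j) z (Y i z) := by
    intro z hz i j
    fin_cases i <;> fin_cases j
    · rfl
    · exact h01 z hz
    · exact (h01 z hz).symm
    · rfl
  have hdual : ∀ z ∈ V, ∀ i j, fderiv ℝ (![x₁, x₂] i) z (Y j z) = if j = i then 1 else 0 := by
    intro z hz i j
    fin_cases i <;> fin_cases j
    · exact (hY0 x₁ z).trans (hx z hz)
    · exact (hY1 x₁ z).trans (hself x₁ z hz)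
    · exact (hY0 x₂ z).trans (hself x₂ z hz)
    · exact (hY1 x₂ z).trans (hx z hz)
  have hli : LinearIndependent ℝ fun i => Y i z₀ := by
    refine Fintype.linearIndependent_iff.2 fun c hc i => ?_
    have := congrArg (fderiv ℝ (![x₁, x₂] i) z₀) hc
    simpa only [map_sum, map_smul, hdual z₀ hz₀V, smul_eq_mul, mul_ite, mul_one, mul_zero,
      Finset.sum_ite_eq', Finset.mem_univ, if_true, map_zero] using this
  obtain ⟨O, -, m, y, hO, hz₀O, hOV, -, hys, -, hyY, hyli, hcard⟩ :=
    exists_rectifying_functions hV hz₀V hYs hcomm hli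
  rw [Fintype.card_fin, Module.finrank_fin_fun] at hcard
  obtain rfl : m = K := by omega
  obtain ⟨e, he0, heO, he, hes, hex, hey⟩ := exists_chart_of_dual_fields (x := ![x₁, x₂]) hO hz₀O
    (fun k => by fin_cases k; exacts [hx₁.mono hOV, hx₂.mono hOV]) hys
    (fun i j => hdual z₀ hz₀V i j) (hyY z₀ hz₀O) hyli hcard
  have hf0 : (fun z => e z 0) = x₁ := funext fun z => hex 0 0 rfl z
  have hf1 : (fun z => e z 1) = x₂ := funext fun z => hex 1 1 (by simp) z
  refine ⟨e, he0, (heO.trans hOV).trans hVU, he, hes, fun z hz => ?_, fun z hz k v => ?_⟩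
  · rw [hf0, hf1]; exact hx z (hOV (heO hz))
  · have hzV := hOV (heO hz)
    have hfk : (fun z => e z k.succ.succ) = y k :=
      funext fun z => hey k k.succ.succ (by simp; omega) z
    rw [hfk]
    have hx' : matrixForm (J z) (gradAt x₁ z) (gradAt x₂ z) = 1 := hx z hzV
    -- A common first integral has zero bracket with x₁ and x₂; rank two then forces it to be a
    -- Casimir.
    refine matrixForm_eq_zero_of_rank_eq_two (fun α β => hJV.matrixForm_swap hzV α β)
      (hrank z (hVU hzV)) (by rw [hx']; exact one_ne_zero) ?_ ?_ v
    · exact (hY1 (y k) z).symm.trans (hyY z (heO hz) k 1)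
    · rw [hJV.matrixForm_swap hzV, neg_eq_zero]
      exact (hY0 (y k) z).symm.trans (hyY z (heO hz) k 0)

/-- A Poisson matrix of rank two is locally derived from a Nambu tensor. -/
theorem IsPoissonMatrix.exists_isDerivedFrom (hκ : κ ≤ K) (hU : IsOpen U)
    (hJ : IsPoissonMatrix U J) (hrank : ∀ z ∈ U, (J z).rank = 2) {z₀ : Fin (K + 2) → ℝ}
    (hz₀ : z₀ ∈ U) :
    ∃ V : Set (Fin (K + 2) → ℝ), IsOpen V ∧ z₀ ∈ V ∧ V ⊆ U ∧
      ∃ (lam : (Fin (K + 2) → ℝ) → (Fin (κ + 2) → Fin (K + 2)) → ℝ)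
        (C : Fin κ → (Fin (K + 2) → ℝ) → ℝ),
        IsNambuTensor V lam ∧ (∀ k, IsObservable V (C k)) ∧ IsDerivedFrom V J lam C := by
  obtain ⟨e, he0, heU, he, hes, h01, hcas⟩ := hJ.exists_darboux_chart hU hrank hz₀
  have hκ2 : κ + 2 ≤ K + 2 := by omega
  set D : Fin (κ + 2) → (Fin (K + 2) → ℝ) → (Fin (K + 2) → ℝ) := fun b =>
    coordinateField e (Fin.castLE hκ2 b) with hD
  refine ⟨e.source, e.open_source, he0, heU, wedgeTensor D,
    fun k z => e z (Fin.castLE hκ k).succ.succ, ?_, ?_, ?_⟩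
  · exact isNambuTensor_wedgeTensor e.open_source
      (fun b => contDiffOn_coordinateField he hes _)
      fun A hA z hz b c => along_coordinateField_comm he hes hA hz _ _
  · exact fun k => contDiffOn_pi.1 he _
  · intro A B hA hB z hz
    have hzU := heU hz
    have hexp : ∀ α β, matrixForm (J z) α β =
        ∑ i, matrixForm (J z) (gradAt (fun z => e z i) z) β * (α ⬝ᵥ coordinateField e i z) := by
      intro α β
      rw [matrixForm_eq_dotProduct]
      conv_lhs => rw [eq_sum_coordinateField he hes hz ((J z).mulVec β)]
      rw [dotProduct_sum]
      refine Finset.sum_congr rfl fun i _ => ?_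
      rw [dotProduct_smul, smul_eq_mul, matrixForm_eq_dotProduct]
    -- Only the first two coordinate fields contribute, since the other coordinates are Casimirs.
    have hsum : ∀ α β, matrixForm (J z) α β =
        matrixForm (J z) (gradAt (fun z => e z 0) z) β * (α ⬝ᵥ coordinateField e 0 z) +
        matrixForm (J z) (gradAt (fun z => e z 1) z) β * (α ⬝ᵥ coordinateField e 1 z) := by
      intro α β
      rw [hexp, Fin.sum_univ_succ, Fin.sum_univ_succ, Finset.sum_eq_zero, add_zero]
      · rfl
      · intro k _
        rw [hJ.matrixForm_swap hzU, hcas z hz k, neg_zero, zero_mul]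
    have halong : ∀ (F : (Fin (K + 2) → ℝ) → ℝ) i,
        gradAt F z ⬝ᵥ coordinateField e i z = along (coordinateField e i) F z := by
      intro F i
      rw [along, fderiv_eq_sum_pderivAt, dotProduct_comm]
      rfl
    -- The chosen C_k are coordinates, so their rows are unit vectors and the determinant reduces to
    -- the 2 × 2 minor of A and B.
    have hrows : (fun a b => along (D b) (Matrix.vecCons A (Matrix.vecCons B
        fun k z => e z (Fin.castLE hκ k).succ.succ) a) z) =
        Matrix.vecCons (fun b => along (D b) A z) (Matrix.vecCons (fun b => along (D b) B z)
          fun k : Fin κ => Pi.single k.succ.succ 1) := by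
      funext a
      refine Fin.cases rfl (fun a => Fin.cases rfl (fun k => ?_) a) a
      funext b
      change along (D b) (fun z => e z (Fin.castLE hκ k).succ.succ) z =
        (Pi.single k.succ.succ 1 : Fin (κ + 2) → ℝ) b
      rw [hD, along_coordinateField_coord he hes hz, Pi.single_apply]
      refine if_congr ?_ rfl rfl
      simp only [Fin.ext_iff, Fin.val_succ, Fin.val_castLE]
      exact eq_comm
    have hone : detRows.toAlternatingMap (fun k : Fin (κ + 2) => Pi.single k 1) = 1 := by
      change Matrix.det (Matrix.of fun k : Fin (κ + 2) => Pi.single k 1) = 1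
      rw [← Matrix.det_one (n := Fin (κ + 2)) (R := ℝ)]
      congr 1
      ext i j
      simp [Matrix.one_apply, Pi.single_apply, eq_comm]
    rw [nambuBracket_wedgeTensor, hrows]
    refine Eq.trans ?_ (AlternatingMap.map_vecCons_vecCons_single
      detRows.toAlternatingMap hone _ _).symm
    have hJ0 : matrixForm (J z) (gradAt (fun z => e z 0) z) (gradAt B z) =
        gradAt B z ⬝ᵥ coordinateField e 1 z := by
      rw [hJ.matrixForm_swap hzU, hsum, hJ.matrixForm_self hzU, hJ.matrixForm_swap hzU,
        h01 z hz]
      ring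
    have hJ1 : matrixForm (J z) (gradAt (fun z => e z 1) z) (gradAt B z) =
        -(gradAt B z ⬝ᵥ coordinateField e 0 z) := by
      rw [hJ.matrixForm_swap hzU, hsum, hJ.matrixForm_self hzU, h01 z hz]
      ring
    rw [poissonBracket_eq_matrixForm, hsum, hJ0, hJ1]
    simp only [halong]
    have hc0 : Fin.castLE hκ2 0 = 0 := rfl
    have hc1 : Fin.castLE hκ2 1 = 1 := Fin.ext (by simp)
    simp only [hD, hc0, hc1]
    ring

end Sufficiency

/-! ### Assembly of the two directions -/

section Assembly

variable {N q : ℕ} {U V : Set (Fin N → ℝ)} {J : (Fin N → ℝ) → Matrix (Fin N) (Fin N) ℝ}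
  {lam : (Fin N → ℝ) → (Fin (q + 1 + 2) → Fin N) → ℝ} {C : Fin (q + 1) → (Fin N → ℝ) → ℝ}

theorem vecCons_succ_eq_update {β : Type*} (C : Fin (q + 1) → β) (E : β) :
    Matrix.vecCons E (fun k : Fin q => C k.succ) = Function.update C 0 E := by
  funext k
  refine Fin.cases ?_ (fun k => ?_) k
  · rw [Function.update_self]; rfl
  · rw [Function.update_of_ne (Fin.succ_ne_zero k)]; rfl

/-- A Poisson bracket derived from an `n`-linear Nambu bracket is derived from a tri-linear one. -/
theorem IsDerivedFrom.exists_trilinear (hU : IsOpen U)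
    (hN : IsNambuTensor (m := q + 2) U lam) (hC : ∀ k, IsObservable U (C k))
    (h : IsDerivedFrom U J lam C) :
    ∃ mu : (Fin N → ℝ) → (Fin 3 → Fin N) → ℝ, IsNambuTensor (m := 2) U mu ∧
      (∀ A B E, ∀ z ∈ U, nambuBracket mu ![A, B, E] z =
        nambuBracket lam (Matrix.vecCons A (Matrix.vecCons B (Function.update C 0 E))) z) ∧
      IsDerivedFrom (κ := 1) U J mu ![C 0] := by
  have key : ∀ A B E, ∀ z ∈ U,
      nambuBracket (contractedTensor lam fun k : Fin q => C k.succ) ![A, B, E] z =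
        nambuBracket lam (Matrix.vecCons A (Matrix.vecCons B (Function.update C 0 E))) z := by
    intro A B E z hz
    rw [hN.nambuBracket_contractedTensor _ hz, ← vecCons_succ_eq_update]
    rfl
  refine ⟨_, hN.contractedTensor hU fun k => hC k.succ, key, fun A B hA hB z hz => ?_⟩
  refine (h A B hA hB z hz).trans ((key A B (C 0) z hz).trans ?_).symm
  rw [Function.update_eq_self]

/-- Canonical coordinates exist near each point where the Poisson matrix does not vanish. -/
theorem IsDerivedFrom.exists_canonicalChart_near (hU : IsOpen U) (hJ : IsPoissonMatrix U J)
    (hN : IsNambuTensor (m := q + 2) U lam) (hC : ∀ k, IsObservable U (C k))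
    (h : IsDerivedFrom U J lam C) {z₀ : Fin N → ℝ} (hz₀ : z₀ ∈ U) (h0 : (J z₀).rank ≠ 0) :
    q + 3 ≤ N ∧ ∃ e : OpenPartialHomeomorph (Fin N → ℝ) (Fin N → ℝ),
      z₀ ∈ e.source ∧ IsCanonicalChart U J C e ∧
      ∀ x ∈ e.target, ∀ i, transformedNambu e lam x i = leviCivita N (q + 1 + 2) i := by
  obtain ⟨i, j, hij⟩ := exists_matrixForm_ne_zero h0
  obtain ⟨V, hV, hz₀V, hVU, x₁, x₂, hx₁, hx₂, hx⟩ := exists_conjugate_functions hU hJ hz₀ hij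
  obtain ⟨hqN, e, he0, -, he, -, -, hlc⟩ :=
    h.exists_canonicalChart hV hVU hJ hN hC hx₁ hx₂ hx hz₀V
  exact ⟨hqN, e, he0, he, hlc⟩

/-- Canonical coordinates can be adapted to the Nambu tensor by changing only the coordinates that
are not prescribed. -/
theorem IsCanonicalChart.exists_adapted (hqN : q + 3 ≤ N) (hJ : IsPoissonMatrix U J)
    (hN : IsNambuTensor (m := q + 2) U lam) (hC : ∀ k, IsObservable U (C k))
    (h : IsDerivedFrom U J lam C) {e : OpenPartialHomeomorph (Fin N → ℝ) (Fin N → ℝ)}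
    (he : IsCanonicalChart U J C e) {z₀ : Fin N → ℝ} (hz₀ : z₀ ∈ e.source) :
    ∃ e' : OpenPartialHomeomorph (Fin N → ℝ) (Fin N → ℝ),
      z₀ ∈ e'.source ∧ e'.source ⊆ e.source ∧ IsCanonicalChart U J C e' ∧
      (∀ z ∈ e'.source, ∀ i : Fin N, i.val < q + 1 + 2 → e' z i = e z i) ∧
      ∀ x ∈ e'.target, ∀ i, transformedNambu e' lam x i = leviCivita N (q + 1 + 2) i := by
  -- The construction is restarted from the first two coordinates of the given chart, which are
  -- conjugate on its source.
  obtain ⟨-, e', he0, hsub, he', h0, h1, hlc⟩ := h.exists_canonicalChart e.open_source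
    he.source_subset hJ hN hC (x₁ := fun z => e z ⟨0, by omega⟩)
    (x₂ := fun z => e z ⟨1, by omega⟩) (contDiffOn_pi.1 he.smooth ⟨0, by omega⟩)
    (contDiffOn_pi.1 he.smooth ⟨1, by omega⟩)
    (fun z hz => by
      have hP := congrFun (congrFun (he.poisson_eq _ (e.map_source hz)) ⟨0, by omega⟩)
        ⟨1, by omega⟩
      rwa [transformedPoisson, canonicalPoisson, Matrix.of_apply, Matrix.of_apply,
        if_pos ⟨rfl, rfl⟩, e.left_inv hz] at hP) hz₀
  refine ⟨e', he0, hsub, he', fun z hz i hi => ?_, hlc⟩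
  obtain ⟨i, hiN⟩ := i
  match i, hiN, hi with
  | 0, _, _ => exact h0 _ rfl z
  | 1, _, _ => exact h1 _ rfl z
  | k + 2, hiN, hi =>
    have hk : k < q + 1 := by
      change k + 2 < q + 1 + 2 at hi
      omega
    exact (he'.casimir_eq ⟨k, hk⟩ ⟨k + 2, hiN⟩ rfl z hz).trans
      (he.casimir_eq ⟨k, hk⟩ ⟨k + 2, hiN⟩ rfl z (hsub hz)).symm

end Assembly

theorem mainTheorem3 (κ N K : ℕ) (hκ : 2 ≤ κ) (hK : K < N)
    (U : Set (Fin N → ℝ)) (hU : IsOpen U) (hU' : U.Nonempty)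
    (J : (Fin N → ℝ) → Matrix (Fin N) (Fin N) ℝ) (hJ : IsPoissonMatrix U J)
    (hrank : ∀ z ∈ U, (J z).rank + K = N) :
    (∀ (lam : (Fin N → ℝ) → (Fin (κ + 2) → Fin N) → ℝ) (C : Fin κ → (Fin N → ℝ) → ℝ),
      IsNambuTensor U lam → (∀ k, IsObservable U (C k)) → IsDerivedFrom U J lam C →
      -- the Poisson bracket is derived from the tri-linear bracket `{A, B, E, C_2, …, C_κ}`
      (∃ mu : (Fin N → ℝ) → (Fin 3 → Fin N) → ℝ,
        IsNambuTensor U mu ∧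
        (∀ A B E, IsObservable U A → IsObservable U B → IsObservable U E → ∀ z ∈ U,
          nambuBracket mu ![A, B, E] z =
            nambuBracket lam (Matrix.vecCons A (Matrix.vecCons B
              (Function.update C ⟨0, by omega⟩ E))) z) ∧
        IsDerivedFrom U J mu ![C ⟨0, by omega⟩]) ∧
      -- necessary condition
      N = K + 2 ∧ κ ≤ K ∧
      -- there are canonical coordinates near each point, with the Levi-Civita Nambu tensor
      (∀ z₀ ∈ U, ∃ h : OpenPartialHomeomorph (Fin N → ℝ) (Fin N → ℝ),
        z₀ ∈ h.source ∧ IsCanonicalChart U J C h ∧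
        ∀ x ∈ h.target, ∀ i, transformedNambu h lam x i = leviCivita N (κ + 2) i) ∧
      -- in all canonical coordinates, the Nambu tensor is the Levi-Civita tensor on the first
      -- `κ + 2` indices, and it becomes so on all indices by changing only the other coordinates
      (∀ h : OpenPartialHomeomorph (Fin N → ℝ) (Fin N → ℝ), IsCanonicalChart U J C h →
        (∀ x ∈ h.target, ∀ i : Fin (κ + 2) → Fin N, (∀ k, (i k).val < κ + 2) →
          transformedNambu h lam x i = leviCivita N (κ + 2) i) ∧
        (∀ z₀ ∈ h.source, ∃ h' : OpenPartialHomeomorph (Fin N → ℝ) (Fin N → ℝ),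
          z₀ ∈ h'.source ∧ h'.source ⊆ h.source ∧ IsCanonicalChart U J C h' ∧
          (∀ z ∈ h'.source, ∀ i : Fin N, i.val < κ + 2 → h' z i = h z i) ∧
          ∀ x ∈ h'.target, ∀ i, transformedNambu h' lam x i = leviCivita N (κ + 2) i))) ∧
    -- the condition `N = K + 2` is locally sufficient
    (N = K + 2 → κ ≤ K → ∀ z₀ ∈ U, ∃ V : Set (Fin N → ℝ), IsOpen V ∧ z₀ ∈ V ∧ V ⊆ U ∧
      ∃ (lam : (Fin N → ℝ) → (Fin (κ + 2) → Fin N) → ℝ) (C : Fin κ → (Fin N → ℝ) → ℝ),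
        IsNambuTensor V lam ∧ (∀ k, IsObservable V (C k)) ∧ IsDerivedFrom V J lam C) := by
  -- The order becomes q + 3, the form in which decomposability is available.
  obtain ⟨q, rfl⟩ : ∃ q, κ = q + 1 := ⟨κ - 1, by omega⟩
  -- K < N rules out a vanishing Poisson matrix.
  have h0 : ∀ z ∈ U, (J z).rank ≠ 0 := fun z hz h => by
    have := hrank z hz
    omega
  refine ⟨fun lam C hN hC h => ?_, ?_⟩
  · obtain ⟨z₁, hz₁⟩ := hU'
    have hNK : N = K + 2 := by
      have h1 := hrank z₁ hz₁
      have h2 := h.rank_eq_two hU hJ hN hz₁ (h0 z₁ hz₁)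
      omega
    have hqN := (h.exists_canonicalChart_near hU hJ hN hC hz₁ (h0 z₁ hz₁)).1
    obtain ⟨mu, hmu, hbr, hder⟩ := h.exists_trilinear hU hN hC
    exact ⟨⟨mu, hmu, fun A B E _ _ _ => hbr A B E, hder⟩, hNK, by omega,
      fun z₀ hz₀ => (h.exists_canonicalChart_near hU hJ hN hC hz₀ (h0 z₀ hz₀)).2,
      fun e he => ⟨fun x hx i hi => he.transformedNambu_eq hqN hN h hx i hi,
        fun z₀ hz₀ => he.exists_adapted hqN hJ hN hC h hz₀⟩⟩
  · rintro rfl hκK z₀ hz₀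
    exact hJ.exists_isDerivedFrom hκK hU (fun z hz => by have := hrank z hz; omega) hz₀
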